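/- Let $S$ be a complex manifold and let $\mathcal V\to S$ be a variation of graded-polarized mixed Hodge structure: a local system $\mathcal V_{\mathbb Q}$ of finite dimensional $\mathbb Q$-vector spaces on $S$ with a finite increasing filtration $\mathcal W$ by local subsystems, a finite decreasing filtration $\mathcal F$ of $\mathcal V_{\mathbb C}\otimes\mathcal O_S$ by holomorphic subbundles with $\nabla\mathcal F^p\subseteq\Omega^1_S\otimes\mathcal F^{p-1}$ for the Gauss–Manin connection $\nabla$, and rational non-degenerate forms $\mathcal S_k$ on $Gr^{\mathcal W}_k$ such that each $(Gr^{\mathcal W}_k,\mathcal F\,Gr^{\mathcal W}_k,\mathcal S_k)$ is a variation of pure, polarized Hodge structure of weight $k$. Assume that $\mathcal V$ is unipotent: the variations induced on the $Gr^{\mathcal W}_k$ are constant (it is enough that they are locally constant, i.e. that the filtrations $\mathcal F\,Gr^{\mathcal W}_k$ are flat). At each $s\in S$ let $\mathcal V_s=\bigoplus_{p,q} I^{p,q}_s$ be the Deligne bigrading of $(\mathcal F_s,\mathcal W_s)$, i.e. the unique decomposition with $\mathcal F^p_s=\bigoplus_{r\ge p,\,q}I^{r,q}_s$, $\mathcal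 W_{k,s}=\bigoplus_{r+q\le k}I^{r,q}_s$ and $I^{p,q}_s\equiv\overline{I^{q,p}_s}$ modulo $\bigoplus_{a<p,\,b<q}I^{a,b}_s$; put $\mathcal U^p=\bigoplus_q I^{p,q}$. On the $C^\infty$ bundle $E$ underlying $\mathcal V_{\mathbb C}$, let $\bar\partial$ be the part of $\nabla^{0,1}$ that maps each $\mathcal U^p$ to itself, $\partial$ the part of $\nabla^{1,0}$ that maps each $\mathcal U^p$ to itself, and $\theta$ (the Higgs field, an $\mathrm{End}(E)$-valued $(1,0)$-form) the part of $\nabla^{1,0}$ that maps each $\mathcal U^p$ to $\mathcal U^{p-1}$. Then: 1. $\theta$ is a $C^\infty$ form, and $\theta(\mathcal W_k)\subseteq\mathcal W_{k-1}$ for every $k$. 2. $\bar\partial=\nabla^{0,1}$. 3. $\bar\partial+\partial=\nabla-\theta$, and this connection is flat (its curvature vanishes). 4. $\theta$ is flat relative both to $\nabla$ and to $\bar\partial+\partial$: for $D=\nabla$ and for $D=\bar\partial+\partial$, the covariant exterior derivative $d_D\theta$, $(d_D\theta)(X,Y)=[D_X,\theta(Y)]-[D_Y,\theta(X)]-\theta([X,Y])$,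 is zero. 5. Each $\mathcal U^p$ is a $C^\infty$ subbundle which is parallel with respect to $\nabla-\theta$. 6. If $S$ is connected, $\mathcal V$ is determined by the flat connection $\nabla$, the Higgs field $\theta$ and a single fiber: let $\mathcal V'\to S$ be a second unipotent variation of graded-polarized mixed Hodge structure, with Gauss–Manin connection $\nabla'$ and Higgs field $\theta'$, and let $\Phi$ be an isomorphism of the underlying complex vector bundles which carries $\nabla$ to $\nabla'$ and $\theta$ to $\theta'$. If for one point $s_0\in S$ the map $\Phi_{s_0}:\mathcal V_{s_0}\to\mathcal V'_{s_0}$ is an isomorphism of graded-polarized mixed Hodge structures (it is defined over $\mathbb Q$ and is compatible with the weight filtrations, the Hodge filtrations and the forms $\mathcal S_k$), then $\Phi_s$ is one for every $s\in S$, so that $\Phi$ is an isomorphism $\mathcal V\cong\mathcal V'$. -/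

import Mathlib

open scoped TensorProduct Manifold ContDiff Topology

universe u v v'

noncomputable section

/-! ### Linear algebra over `ℂ ⊗ M`, for a rational vector space `M` -/

section HodgeLinearAlgebra

variable {M : Type*} [AddCommGroup M] [Module ℚ M]

/-- Complex conjugation `z ⊗ m ↦ z̄ ⊗ m` on the complexification of a rational vector space. -/
def conjC (M : Type*) [AddCommGroup M] [Module ℚ M] :
    (ℂ ⊗[ℚ] M) →ₛₗ[starRingEnd ℂ] (ℂ ⊗[ℚ] M) where
  toFun := TensorProduct.map
    ((Complex.conjAe.toAlgHom.toLinearMap : ℂ →ₗ[ℝ] ℂ).restrictScalars ℚ) LinearMap.id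
  map_add' := map_add _
  map_smul' z v := by
    induction v using TensorProduct.induction_on with
    | zero => simp
    | tmul w m => simp [TensorProduct.smul_tmul']
    | add a b ha hb => simp only [smul_add, map_add, ha, hb]

/-- The filtration step induced by `F` on the complexification of the rational quotient `A / B`
(where `B ⊆ A`): the image of `F ∩ (ℂ ⊗ A)` in `ℂ ⊗ (A / B)`. -/
def inducedOnQuotient (A B : Submodule ℚ M) (F : Submodule ℂ (ℂ ⊗[ℚ] M)) :
    Submodule ℂ (ℂ ⊗[ℚ] (A ⧸ B.submoduleOf A)) :=
  (F.comap (A.subtype.baseChange ℂ)).map ((B.submoduleOf A).mkQ.baseChange ℂ)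

/-- `F` is (the Hodge filtration of) a pure Hodge structure of weight `k` on `ℂ ⊗ M`. -/
structure IsPureHodgeStructure (k : ℤ) (F : ℤ → Submodule ℂ (ℂ ⊗[ℚ] M)) : Prop where
  antitone : Antitone F
  exhaustive : ∃ p, F p = ⊤
  separated : ∃ p, F p = ⊥
  opposed : ∀ p, IsCompl (F p) ((F (k - p + 1)).map (conjC M))

/-- The rational bilinear form `Q` polarizes the pure Hodge structure `F` of weight `k`:
parity `(-1)^k`, non-degeneracy, and the two Riemann bilinear relations. -/
structure IsPolarization (k : ℤ) (F : ℤ → Submodule ℂ (ℂ ⊗[ℚ] M))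
    (Q : LinearMap.BilinForm ℚ M) : Prop where
  parity : ∀ a b, Q a b = (-1 : ℚ) ^ k * Q b a
  nondegenerate : Q.Nondegenerate
  riemann₁ : ∀ p, ∀ u ∈ F p, ∀ v ∈ F (k - p + 1), Q.baseChange ℂ u v = 0
  riemann₂ : ∀ p q : ℤ, p + q = k → ∀ v ∈ F p ⊓ (F q).map (conjC M), v ≠ 0 →
    0 < (Complex.I ^ (p - q) * Q.baseChange ℂ v (conjC M v)).re

/-- `I` is the bigrading of the mixed Hodge structure `(F, W)` with
`I^{p,q} ≡ conj I^{q,p}` modulo `⨁_{r<p, s<q} I^{r,s}`. -/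
structure IsDeligneBigrading (W : ℤ → Submodule ℚ M) (F : ℤ → Submodule ℂ (ℂ ⊗[ℚ] M))
    (I : ℤ → ℤ → Submodule ℂ (ℂ ⊗[ℚ] M)) : Prop where
  internal : DirectSum.IsInternal (fun pq : ℤ × ℤ => I pq.1 pq.2)
  hodge : ∀ p, F p = ⨆ (r : ℤ) (s : ℤ) (_ : p ≤ r), I r s
  weight : ∀ k, (W k).baseChange ℂ = ⨆ (r : ℤ) (s : ℤ) (_ : r + s ≤ k), I r s
  conj : ∀ p q,
    I p q ⊔ (⨆ (r : ℤ) (s : ℤ) (_ : r < p ∧ s < q), I r s) =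
      (I q p).map (conjC M) ⊔ (⨆ (r : ℤ) (s : ℤ) (_ : r < p ∧ s < q), I r s)

open Classical in
/-- The Deligne bigrading `I^{p,q}` of `(F, W)`: the unique bigrading as above (it exists and is
unique whenever `(F, W)` is a mixed Hodge structure; `⊥` is a default value otherwise). -/
def deligneI (W : ℤ → Submodule ℚ M) (F : ℤ → Submodule ℂ (ℂ ⊗[ℚ] M)) :
    ℤ → ℤ → Submodule ℂ (ℂ ⊗[ℚ] M) :=
  if h : ∃ I, IsDeligneBigrading W F I then h.choose else fun _ _ => ⊥

/-- `U^p = ⨁_q I^{p,q}`. -/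
def deligneU (W : ℤ → Submodule ℚ M) (F : ℤ → Submodule ℂ (ℂ ⊗[ℚ] M)) (p : ℤ) :
    Submodule ℂ (ℂ ⊗[ℚ] M) :=
  ⨆ q, deligneI W F p q

end HodgeLinearAlgebra

open Classical in
/-- The projection onto the summand `U p` of a direct sum decomposition `⨁ U p`, along the other
summands. -/
def gradedProj {N : Type*} [AddCommGroup N] [Module ℂ N] (U : ℤ → Submodule ℂ N) (p : ℤ) :
    N →ₗ[ℂ] N :=
  if h : IsCompl (U p) (⨆ (r : ℤ) (_ : r ≠ p), U r) then
    (U p).subtype ∘ₗ Submodule.projectionOnto _ _ h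
  else 0

section TypeDecomposition

variable {E N : Type*} [AddCommGroup E] [Module ℂ E] [Module ℝ E] [IsScalarTower ℝ ℂ E]
  [AddCommGroup N] [Module ℂ N] [Module ℝ N] [IsScalarTower ℝ ℂ N]

theorem real_map_complex_smul (α : E →ₗ[ℝ] N) (z : ℂ) (v : E) :
    α (z • v) = (z.re : ℂ) • α v + (z.im : ℂ) • α (Complex.I • v) := by
  have h : z • v = z.re • v + z.im • (Complex.I • v) := by
    conv_lhs => rw [← Complex.re_add_im z, add_smul, mul_smul]
    rw [← smul_one_smul ℂ z.re v, ← smul_one_smul ℂ z.im (Complex.I • v)]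
    simp
  rw [h, map_add, map_smul, map_smul, ← smul_one_smul ℂ z.re (α v),
    ← smul_one_smul ℂ z.im (α (Complex.I • v))]
  simp

theorem real_map_I_smul_smul (α : E →ₗ[ℝ] N) (z : ℂ) (v : E) :
    α (Complex.I • (z • v)) = (z.re : ℂ) • α (Complex.I • v) - (z.im : ℂ) • α v := by
  rw [smul_smul, real_map_complex_smul]
  simp [sub_eq_add_neg, add_comm]

/-- The `(1,0)`-part `v ↦ (α v - i α(i v)) / 2` of a real-linear form `α` on a complex vector
space, with values in a complex vector space. -/
def part10 (α : E →ₗ[ℝ] N) : E →ₗ[ℂ] N where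
  toFun v := (1 / 2 : ℂ) • (α v - Complex.I • α (Complex.I • v))
  map_add' u v := by simp only [smul_add, map_add]; module
  map_smul' z v := by
    rw [real_map_I_smul_smul, real_map_complex_smul, RingHom.id_apply]
    conv_rhs => rw [← Complex.re_add_im z]
    have hI : Complex.I * Complex.I = -1 := Complex.I_mul_I
    match_scalars
    · ring
    · linear_combination ((z.im : ℂ) / 2) * hI

/-- The `(0,1)`-part `v ↦ (α v + i α(i v)) / 2` of a real-linear form `α` on a complex vector
space, with values in a complex vector space. -/
def part01 (α : E →ₗ[ℝ] N) : E →ₛₗ[starRingEnd ℂ] N where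
  toFun v := (1 / 2 : ℂ) • (α v + Complex.I • α (Complex.I • v))
  map_add' u v := by simp only [smul_add, map_add]; module
  map_smul' z v := by
    rw [real_map_I_smul_smul, real_map_complex_smul]
    have hz : (starRingEnd ℂ) z = (z.re : ℂ) - (z.im : ℂ) * Complex.I := by
      apply Complex.ext <;> simp
    rw [hz]
    have hI : Complex.I * Complex.I = -1 := Complex.I_mul_I
    match_scalars
    · ring
    · linear_combination ((z.im : ℂ) / 2) * hI

end TypeDecomposition

/-! ### Rational local systems and their associated smooth bundles -/

/-- A local system of finite dimensional rational vector spaces on `S`: a family of fibres, with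
trivializations `transport x y : Fib x ≃ Fib y` over a connected open neighbourhood `nhd x` of each
point `x`, such that the transition functions between any two trivializations are locally
constant. -/
structure RatLocalSystem (S : Type u) [TopologicalSpace S] where
  Fib : S → Type v
  [addCommGroup : ∀ s, AddCommGroup (Fib s)]
  [module : ∀ s, Module ℚ (Fib s)]
  [finite : ∀ s, Module.Finite ℚ (Fib s)]
  nhd : S → Set S
  isOpen_nhd : ∀ x, IsOpen (nhd x)
  isConnected_nhd : ∀ x, IsConnected (nhd x)
  mem_nhd : ∀ x, x ∈ nhd x
  transport : ∀ x y, y ∈ nhd x → (Fib x ≃ₗ[ℚ] Fib y)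
  transport_self : ∀ x a, transport x x (mem_nhd x) a = a
  transition_locallyConstant : ∀ x₁ x₂ y₀ (h₁ : y₀ ∈ nhd x₁) (h₂ : y₀ ∈ nhd x₂),
    ∀ᶠ y in 𝓝 y₀, ∀ (k₁ : y ∈ nhd x₁) (k₂ : y ∈ nhd x₂) (a : Fib x₁),
      (transport x₂ y k₂).symm (transport x₁ y k₁ a) =
        (transport x₂ y₀ h₂).symm (transport x₁ y₀ h₁ a)

attribute [instance] RatLocalSystem.addCommGroup RatLocalSystem.module RatLocalSystem.finite

namespace RatLocalSystem

section Topological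

variable {S : Type u} [TopologicalSpace S] (L : RatLocalSystem.{u, v} S)

/-- The fibre at `s` of the complexified local system. -/
abbrev VC (s : S) : Type v := ℂ ⊗[ℚ] L.Fib s

/-- Sections of the underlying vector bundle of the complexified local system, with no regularity
imposed. -/
abbrev Section : Type (max u v) := ∀ s, L.VC s

open Classical in
/-- The local flat section through `e ∈ VC x` (extended by zero outside `nhd x`). -/
def flatExt (x : S) (e : L.VC x) : L.Section := fun y =>
  if h : y ∈ L.nhd x then (L.transport x y h).toLinearMap.baseChange ℂ e else 0

/-- The rank of the local system at `x`. -/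
def rk (x : S) : ℕ := Module.finrank ℂ (L.VC x)

/-- Linear coordinates on the fibre `VC x`. -/
def fibCoord (x : S) : L.VC x ≃ₗ[ℂ] (Fin (L.rk x) → ℂ) :=
  (Module.finBasis ℂ (L.VC x)).equivFun

open Classical in
/-- The components of a section, near `x`, in a flat frame: `σ y` is transported back to `VC x`
along the flat trivialization, and expressed in coordinates of `VC x`. -/
def frameCoord (x : S) (σ : L.Section) (y : S) : Fin (L.rk x) → ℂ :=
  if h : y ∈ L.nhd x then
    L.fibCoord x ((L.transport x y h).symm.toLinearMap.baseChange ℂ (σ y))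
  else 0

end Topological

section Smooth

variable (E : Type*) [NormedAddCommGroup E] [NormedSpace ℂ E]
  {S : Type u} [TopologicalSpace S] [ChartedSpace E S] (L : RatLocalSystem.{u, v} S)

/-- `σ` is a `C^∞` section (of `V_ℂ ⊗ 𝓔^0`) at `x`: its flat components are smooth at `x`. -/
def SmoothAt (σ : L.Section) (x : S) : Prop :=
  ContMDiffAt 𝓘(ℝ, E) 𝓘(ℝ, Fin (L.rk x) → ℂ) ∞ (L.frameCoord x σ) x

/-- `σ` is a holomorphic section (of `V_ℂ ⊗ 𝓞`) at `x`: its flat components are holomorphic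
(complex analytic) at `x`. -/
def HolomorphicAt (σ : L.Section) (x : S) : Prop :=
  ContMDiffAt 𝓘(ℂ, E) 𝓘(ℂ, Fin (L.rk x) → ℂ) ω (L.frameCoord x σ) x

/-- A family of subspaces of the fibres is a `C^∞` subbundle: locally it has a smooth frame. -/
def IsSmoothSubbundle (G : ∀ s, Submodule ℂ (L.VC s)) : Prop :=
  ∀ x, ∃ (m : ℕ) (f : Fin m → L.Section), ∀ᶠ s in 𝓝 x,
    (∀ i, L.SmoothAt E (f i) s) ∧ LinearIndependent ℂ (fun i => f i s) ∧
      Submodule.span ℂ (Set.range fun i => f i s) = G s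

/-- A family of subspaces of the fibres is a holomorphic subbundle: locally it has a holomorphic
frame. -/
def IsHolomorphicSubbundle (G : ∀ s, Submodule ℂ (L.VC s)) : Prop :=
  ∀ x, ∃ (m : ℕ) (f : Fin m → L.Section), ∀ᶠ s in 𝓝 x,
    (∀ i, L.HolomorphicAt E (f i) s) ∧ LinearIndependent ℂ (fun i => f i s) ∧
      Submodule.span ℂ (Set.range fun i => f i s) = G s

/-- The derivative at `x` of the flat components of `σ`. The tangent space of `S` at any point is
the complex vector space `E`. -/
def dFrameCoord (σ : L.Section) (x : S) : E →ₗ[ℝ] (Fin (L.rk x) → ℂ) :=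
  (mfderiv 𝓘(ℝ, E) 𝓘(ℝ, Fin (L.rk x) → ℂ) (L.frameCoord x σ) x).toLinearMap

/-- The Gauss–Manin connection `∇_v σ` at `x`: differentiate the flat components. -/
def nabla (σ : L.Section) (x : S) (v : E) : L.VC x :=
  (L.fibCoord x).symm (L.dFrameCoord E σ x v)

/-- `∇^{1,0} σ` at `x`. -/
def nabla10 (σ : L.Section) (x : S) : E →ₗ[ℂ] L.VC x :=
  (L.fibCoord x).symm.toLinearMap ∘ₗ part10 (L.dFrameCoord E σ x)

/-- `∇^{0,1} σ` at `x`. -/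
def nabla01 (σ : L.Section) (x : S) : E →ₛₗ[starRingEnd ℂ] L.VC x :=
  (L.fibCoord x).symm.toLinearMap.comp (part01 (L.dFrameCoord E σ x))

/-- Griffiths transversality `∇ 𝓕^p ⊆ Ω^1 ⊗ 𝓕^{p-1}`, for holomorphic sections. -/
def IsHorizontal (F : ℤ → ∀ s, Submodule ℂ (L.VC s)) : Prop :=
  ∀ (p : ℤ) (σ : L.Section) (x : S),
    (∀ᶠ s in 𝓝 x, L.HolomorphicAt E σ s ∧ σ s ∈ F p s) → ∀ v : E, L.nabla E σ x v ∈ F (p - 1) x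

/-- `(L, F, Q)` is a variation of pure Hodge structure of weight `k` polarized by `Q`. -/
structure IsPolarizedVHS (k : ℤ) (F : ℤ → ∀ s, Submodule ℂ (L.VC s))
    (Q : ∀ s, LinearMap.BilinForm ℚ (L.Fib s)) : Prop where
  holomorphic : ∀ p, L.IsHolomorphicSubbundle E (F p)
  horizontal : L.IsHorizontal E F
  form_flat : ∀ x y (h : y ∈ L.nhd x) (a b : L.Fib x),
    Q y (L.transport x y h a) (L.transport x y h b) = Q x a b
  pure : ∀ s, IsPureHodgeStructure k (fun p => F p s)
  polarized : ∀ s, IsPolarization k (fun p => F p s) (Q s)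

/-- A (not necessarily flat) connection, as a differential operator: `D σ x v = D_v σ (x)`. -/
abbrev ConnectionOp : Type _ := L.Section → ∀ x : S, E → L.VC x

variable {E}

/-- The vector field `X` is `C^∞` at `x`. -/
def SmoothFieldAt [IsManifold 𝓘(ℝ, E) 1 S] (X : ∀ s : S, TangentSpace 𝓘(ℝ, E) s) (x : S) : Prop :=
  ContMDiffAt 𝓘(ℝ, E) (𝓘(ℝ, E).prod 𝓘(ℝ, E)) ∞
    (fun s => (⟨s, X s⟩ : TangentBundle 𝓘(ℝ, E) S)) x

/-- The connection `D` is flat: its curvature `[D_X, D_Y] - D_{[X,Y]}` vanishes. -/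
def IsFlat [IsManifold 𝓘(ℝ, E) 1 S] (D : L.ConnectionOp E) : Prop :=
  ∀ (X Y : ∀ s : S, TangentSpace 𝓘(ℝ, E) s) (σ : L.Section) (x : S),
    SmoothFieldAt X x → SmoothFieldAt Y x → L.SmoothAt E σ x →
    D (fun s => D σ s (Y s)) x (X x) - D (fun s => D σ s (X s)) x (Y x)
      - D σ x (VectorField.mlieBracket 𝓘(ℝ, E) X Y x) = 0

/-- The endomorphism valued 1-form `A` is flat with respect to the connection `D`: its covariant
exterior derivative `(d_D A)(X, Y) = [D_X, A(Y)] - [D_Y, A(X)] - A([X,Y])` vanishes. -/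
def IsFlatForm [IsManifold 𝓘(ℝ, E) 1 S] (D : L.ConnectionOp E)
    (A : ∀ s : S, E →ₗ[ℂ] Module.End ℂ (L.VC s)) : Prop :=
  ∀ (X Y : ∀ s : S, TangentSpace 𝓘(ℝ, E) s) (σ : L.Section) (x : S),
    SmoothFieldAt X x → SmoothFieldAt Y x → L.SmoothAt E σ x →
    (D (fun s => A s (Y s) (σ s)) x (X x) - A x (Y x) (D σ x (X x)))
      - (D (fun s => A s (X s) (σ s)) x (Y x) - A x (X x) (D σ x (Y x)))
      - A x (VectorField.mlieBracket 𝓘(ℝ, E) X Y x) (σ x) = 0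

/-- The endomorphism valued 1-form `A` is `C^∞`. -/
def IsSmoothForm [IsManifold 𝓘(ℝ, E) 1 S]
    (A : ∀ s : S, E →ₗ[ℂ] Module.End ℂ (L.VC s)) : Prop :=
  ∀ (X : ∀ s : S, TangentSpace 𝓘(ℝ, E) s) (σ : L.Section) (x : S),
    SmoothFieldAt X x → L.SmoothAt E σ x → L.SmoothAt E (fun s => A s (X s) (σ s)) x

/-- A subbundle `G` is parallel for the connection `D`: `D` maps sections of `G` to `G`. -/
def IsParallel (D : L.ConnectionOp E) (G : ∀ s, Submodule ℂ (L.VC s)) : Prop :=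
  ∀ (σ : L.Section) (x : S), L.SmoothAt E σ x → (∀ᶠ s in 𝓝 x, σ s ∈ G s) →
    ∀ v : E, D σ x v ∈ G x

end Smooth

end RatLocalSystem

/-- The real manifold underlying a complex manifold. -/
instance isManifold_real_of_complex (E : Type*) [NormedAddCommGroup E] [NormedSpace ℂ E]
    (S : Type*) [TopologicalSpace S] [ChartedSpace E S] [IsManifold 𝓘(ℂ, E) ω S] :
    IsManifold 𝓘(ℝ, E) ω S := by
  apply isManifold_of_contDiffOn
  intro e e' he he'
  have h := (contDiffGroupoid ω 𝓘(ℂ, E)).compatible he he'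
  rw [contDiffGroupoid, mem_groupoid_of_pregroupoid] at h
  exact h.1.restrict_scalars ℝ

/-! ### Weight filtrations and their graded quotients -/

/-- A finite increasing filtration of `L` by local subsystems. -/
structure WeightFiltration {S : Type u} [TopologicalSpace S] (L : RatLocalSystem.{u, v} S) where
  W : ℤ → ∀ s, Submodule ℚ (L.Fib s)
  mono : ∀ s, Monotone (fun k => W k s)
  separated : ∀ s, ∃ k, W k s = ⊥
  exhaustive : ∀ s, ∃ k, W k s = ⊤
  flat : ∀ k x y (h : y ∈ L.nhd x), (W k x).map (L.transport x y h).toLinearMap = W k y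

namespace WeightFiltration

variable {S : Type u} [TopologicalSpace S] {L : RatLocalSystem.{u, v} S} (w : WeightFiltration L)

/-- The fibre `W_k / W_{k-1}` at `s`. -/
abbrev GrFib (k : ℤ) (s : S) : Type v := w.W k s ⧸ (w.W (k - 1) s).submoduleOf (w.W k s)

/-- The class in `W_k / W_{k-1}` of an element of `W_k`. -/
def grMk (k : ℤ) (s : S) (a : w.W k s) : w.GrFib k s := Submodule.Quotient.mk a

/-- The map induced by a flat trivialization on `W_k / W_{k-1}`. -/
def grTransport (k : ℤ) (x y : S) (h : y ∈ L.nhd x) : w.GrFib k x ≃ₗ[ℚ] w.GrFib k y :=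
  Submodule.Quotient.equiv _ _ ((L.transport x y h).ofSubmodules _ _ (w.flat k x y h)) (by
    ext ⟨b, hb⟩
    simp only [Submodule.mem_map, Submodule.submoduleOf, Submodule.mem_comap,
      Submodule.subtype_apply]
    constructor
    · rintro ⟨a, ha, hab⟩
      have : L.transport x y h a = b := congrArg Subtype.val hab
      rw [← this, ← w.flat (k - 1) x y h]
      exact Submodule.mem_map_of_mem ha
    · intro hb'
      rw [← w.flat (k - 1) x y h] at hb'
      obtain ⟨a, ha, hab⟩ := hb'
      exact ⟨⟨a, w.mono x (by omega : k - 1 ≤ k) ha⟩, ha, Subtype.ext hab⟩)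

/-- The local system `Gr^W_k = W_k / W_{k-1}`. -/
def gr (k : ℤ) : RatLocalSystem.{u, v} S where
  Fib := w.GrFib k
  nhd := L.nhd
  isOpen_nhd := L.isOpen_nhd
  isConnected_nhd := L.isConnected_nhd
  mem_nhd := L.mem_nhd
  transport := w.grTransport k
  transport_self x a := by
    induction a using Submodule.Quotient.induction_on with
    | H a =>
      refine congrArg Submodule.Quotient.mk (Subtype.ext ?_)
      exact L.transport_self x a
  transition_locallyConstant x₁ x₂ y₀ h₁ h₂ := by
    filter_upwards [L.transition_locallyConstant x₁ x₂ y₀ h₁ h₂] with y hy k₁ k₂ a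
    induction a using Submodule.Quotient.induction_on with
    | H a =>
      refine congrArg Submodule.Quotient.mk (Subtype.ext ?_)
      exact hy k₁ k₂ a

/-- The filtration step induced by `F` on `Gr^W_k`. -/
def grHodge (F : ℤ → ∀ s, Submodule ℂ (L.VC s)) (k p : ℤ) (s : S) :
    Submodule ℂ ((w.gr k).VC s) :=
  inducedOnQuotient (w.W k s) (w.W (k - 1) s) (F p s)

end WeightFiltration

/-! ### Variations of graded-polarized mixed Hodge structure -/

/-- A variation of graded-polarized mixed Hodge structure on the complex manifold `S`. -/
structure VGPMHS (E : Type*) [NormedAddCommGroup E] [NormedSpace ℂ E]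
    (S : Type u) [TopologicalSpace S] [ChartedSpace E S] where
  L : RatLocalSystem.{u, v} S
  wt : WeightFiltration L
  F : ℤ → ∀ s, Submodule ℂ (L.VC s)
  pol : ∀ (k : ℤ) (s : S), LinearMap.BilinForm ℚ (wt.GrFib k s)
  hodge_antitone : ∀ s, Antitone (fun p => F p s)
  hodge_exhaustive : ∀ s, ∃ p, F p s = ⊤
  hodge_separated : ∀ s, ∃ p, F p s = ⊥
  hodge_holomorphic : ∀ p, L.IsHolomorphicSubbundle E (F p)
  horizontal : L.IsHorizontal E F
  graded : ∀ k, (wt.gr k).IsPolarizedVHS E k (wt.grHodge F k) (pol k)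

namespace VGPMHS

variable {E : Type*} [NormedAddCommGroup E] [NormedSpace ℂ E]
  {S : Type u} [TopologicalSpace S] [ChartedSpace E S] (𝒱 : VGPMHS.{u, v} E S)

/-- The complexified weight filtration. -/
def WC (k : ℤ) (s : S) : Submodule ℂ (𝒱.L.VC s) := (𝒱.wt.W k s).baseChange ℂ

/-- The variation is unipotent: for each `k`, the variation of pure Hodge structure on `Gr^W_k` is
locally constant, i.e. its Hodge filtration is flat. -/
def IsUnipotent : Prop :=
  ∀ (k p : ℤ) (x y : S) (h : y ∈ 𝒱.L.nhd x),
    (𝒱.wt.grHodge 𝒱.F k p x).map (((𝒱.wt.gr k).transport x y h).toLinearMap.baseChange ℂ) =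
      𝒱.wt.grHodge 𝒱.F k p y

/-- The summand `𝓤^p = ⨁_q I^{p,q}` of the bundle underlying `𝒱`. -/
def U (p : ℤ) (s : S) : Submodule ℂ (𝒱.L.VC s) :=
  deligneU (fun k => 𝒱.wt.W k s) (fun r => 𝒱.F r s) p

/-- The projection onto `𝓤^p` along the other summands. -/
def proj (p : ℤ) (s : S) : 𝒱.L.VC s →ₗ[ℂ] 𝒱.L.VC s := gradedProj (fun r => 𝒱.U r s) p

/-- The `𝓤^p`-component of a section. -/
def comp (p : ℤ) (σ : 𝒱.L.Section) : 𝒱.L.Section := fun s => 𝒱.proj p s (σ s)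

/-- `∂̄`: the part of `∇^{0,1}` which maps each `𝓤^p` to itself. -/
def delbar (σ : 𝒱.L.Section) (x : S) : E →ₛₗ[starRingEnd ℂ] 𝒱.L.VC x :=
  ∑ᶠ p : ℤ, (𝒱.proj p x).comp (𝒱.L.nabla01 E (𝒱.comp p σ) x)

/-- `∂`: the part of `∇^{1,0}` which maps each `𝓤^p` to itself. -/
def del (σ : 𝒱.L.Section) (x : S) : E →ₗ[ℂ] 𝒱.L.VC x :=
  ∑ᶠ p : ℤ, 𝒱.proj p x ∘ₗ 𝒱.L.nabla10 E (𝒱.comp p σ) x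

/-- The part of `∇^{1,0}` which maps each `𝓤^p` to `𝓤^{p-1}`, as an operator on sections. -/
def higgsOp (σ : 𝒱.L.Section) (x : S) : E →ₗ[ℂ] 𝒱.L.VC x :=
  ∑ᶠ p : ℤ, 𝒱.proj (p - 1) x ∘ₗ 𝒱.L.nabla10 E (𝒱.comp p σ) x

/-- The Higgs field `θ`, as an endomorphism valued `(1,0)`-form: `θ x v e` is the value at `x` of
the above operator (which is tensorial) on a local section through `e`. -/
def θ (x : S) : E →ₗ[ℂ] Module.End ℂ (𝒱.L.VC x) :=
  ((Module.finBasis ℂ (𝒱.L.VC x)).constr ℂ fun i =>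
    𝒱.higgsOp (𝒱.L.flatExt x (Module.finBasis ℂ (𝒱.L.VC x) i)) x).flip

/-- The connection `∇ - θ`. -/
def nablaSubθ : 𝒱.L.ConnectionOp E := fun σ x v => 𝒱.L.nabla E σ x v - 𝒱.θ x v (σ x)

/-- The connection `∂̄ + ∂`. -/
def delbarAddDel : 𝒱.L.ConnectionOp E := fun σ x v => 𝒱.delbar σ x v + 𝒱.del σ x v

end VGPMHS

section Isomorphisms

variable {E : Type*} [NormedAddCommGroup E] [NormedSpace ℂ E]
  {S : Type u} [TopologicalSpace S] [ChartedSpace E S]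
  (𝒱 : VGPMHS.{u, v} E S) (𝒱' : VGPMHS.{u, v'} E S)

/-- The complex linear map `Φ` between the fibres at `s` of two variations is an isomorphism of
graded-polarized mixed Hodge structures: it is defined over `ℚ`, and it maps the weight filtrations,
the Hodge filtrations and the graded polarizations to each other. -/
def IsFiberIso (s : S) (Φ : 𝒱.L.VC s ≃ₗ[ℂ] 𝒱'.L.VC s) : Prop :=
  ∃ φ : 𝒱.L.Fib s ≃ₗ[ℚ] 𝒱'.L.Fib s,
    Φ.toLinearMap = φ.toLinearMap.baseChange ℂ ∧
    (∀ k, (𝒱.wt.W k s).map φ.toLinearMap = 𝒱'.wt.W k s) ∧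
    (∀ p, (𝒱.F p s).map Φ.toLinearMap = 𝒱'.F p s) ∧
    ∀ (k : ℤ) (a b : 𝒱.wt.W k s) (a' b' : 𝒱'.wt.W k s), φ a = a' → φ b = b' →
      𝒱'.pol k s (𝒱'.wt.grMk k s a') (𝒱'.wt.grMk k s b') =
        𝒱.pol k s (𝒱.wt.grMk k s a) (𝒱.wt.grMk k s b)

/-- `Φ` is an isomorphism of flat bundles: it maps smooth sections to smooth sections and commutes
with the Gauss–Manin connections. -/
def IsFlatBundleIso (Φ : ∀ s, 𝒱.L.VC s ≃ₗ[ℂ] 𝒱'.L.VC s) : Prop :=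
  ∀ (σ : 𝒱.L.Section) (x : S), 𝒱.L.SmoothAt E σ x →
    𝒱'.L.SmoothAt E (fun s => Φ s (σ s)) x ∧
    ∀ v : E, 𝒱'.L.nabla E (fun s => Φ s (σ s)) x v = Φ x (𝒱.L.nabla E σ x v)

/-- `Φ` is compatible with the Higgs fields. -/
def IsHiggsIso (Φ : ∀ s, 𝒱.L.VC s ≃ₗ[ℂ] 𝒱'.L.VC s) : Prop :=
  ∀ (x : S) (v : E) (e : 𝒱.L.VC x), 𝒱'.θ x v (Φ x e) = Φ x (𝒱.θ x v e)

end Isomorphisms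

end

/-! Put `G_p = ∑_q conj(F^q) ∩ W_{p+q}`. This increasing filtration is opposed to the Hodge
filtration, `V = F^p ⊕ G_{p-1}`, and every Deligne bigrading satisfies `𝓤^p = F^p ∩ G_p`. The
projection `Π_p` onto `𝓤^p` is therefore `P_p - P_{p+1}`, where `P_p` projects onto `F^p` along
`G_{p-1}`.

The heart of the proof is that `G` is flat (`IsLocalVariation.oppFil_eq`). Since `W` and the
conjugation are flat, it is enough to treat the conjugate `∑_q F^q ∩ W_{p+q}`. Differentiation moves
`F^q` into `F^{q-1}` by horizontality and lowers the weight by one by unipotence, so it sends the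
term of index `q` into `F^{q-1} ∩ W_{p+q-1}`, again a term of the same sum. An induction on the
weight concludes.

In a flat frame only `F` now varies, and it varies holomorphically, so the `P_p` are holomorphic
with constant kernel; this gives `∂̄ = ∇^{0,1}`. Differentiating the relations among the `P_p` and
using horizontality, `dP_p` kills `F^{p+1}` and `G_{p-1}` and takes values in `𝓤^{p-1}`. Let `Y =
∑_{a<p≤b} P_p`, with `a, b` beyond the range of the Hodge filtration: it acts on `𝓤^q` as `q - a`.
Then `θ = dY` (`VGPMHS.frame_θ`). Hence `θ` is smooth and `∇`-closed, and it lowers `W`.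
Differentiating `[dY, Y] = dY` once more, the symmetry of `d²Y` makes the values of `θ` commute
(`fderiv_gradingOp_commute`). So `∇ - θ` is flat, `θ` is closed for it as well, and `dΠ_p = [θ,
Π_p]` says that `𝓤^p` is parallel.

For the last assertion, `Φ` is constant in flat frames and carries `dY` to `dY'`. Hence `Φ Y - Y' Φ`
is constant on a ball, and it vanishes if `Φ` is an isomorphism of mixed Hodge structures at one
point of the ball. Then `Φ` matches eigenspaces and so Hodge filtrations; the rational structure,
the weights and the polarizations follow by parallel transport. Being an isomorphism is thus a
locally constant property of the point. -/

noncomputable section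

/-! ### Mixed Hodge structures on a complex vector space with a conjugation -/

section MixedHodge

variable {V : Type*} [AddCommGroup V] [Module ℂ V]

/-- `(W, F)` is a mixed Hodge structure on the complex vector space `V` with conjugation `c`. The
last two fields say that `F` and its conjugate are opposed on each `W k / W (k - 1)`. -/
structure IsMixedHodge (c : V →ₛₗ[starRingEnd ℂ] V) (W F : ℤ → Submodule ℂ V) : Prop where
  conj_conj : ∀ v, c (c v) = v
  weight_mono : Monotone W
  weight_bot : ∃ k, W k = ⊥
  weight_top : ∃ k, W k = ⊤
  conj_mem : ∀ k, ∀ v ∈ W k, c v ∈ W k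
  hodge_anti : Antitone F
  hodge_bot : ∃ p, F p = ⊥
  hodge_top : ∃ p, F p = ⊤
  graded_sup : ∀ k p, ∀ v ∈ W k, ∃ f ∈ F p ⊓ W k, ∃ g ∈ F (k - p + 1) ⊓ W k,
    v - f - c g ∈ W (k - 1)
  graded_inf : ∀ k p, ∀ f ∈ F p ⊓ W k, ∀ g ∈ F (k - p + 1) ⊓ W k,
    f - c g ∈ W (k - 1) → f ∈ W (k - 1)

/-- The increasing filtration `G_p = ∑_q conj(F^q) ∩ W_{p+q}`, which is opposed to `F`. -/
def oppFil (c : V →ₛₗ[starRingEnd ℂ] V) (W F : ℤ → Submodule ℂ V) (p : ℤ) : Submodule ℂ V :=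
  ⨆ q, (F q ⊓ W (p + q)).map c

/-- The sum of the terms of weight at most `k` in the definition of `oppFil`. -/
def oppTrunc (c : V →ₛₗ[starRingEnd ℂ] V) (W F : ℤ → Submodule ℂ V) (p k : ℤ) : Submodule ℂ V :=
  ⨆ (q : ℤ) (_ : p + q ≤ k), (F q ⊓ W (p + q)).map c

/-- A finite filtration is trivial below some index, so inductions over the weight may start there.
-/
theorem int_induction_of_le {P : ℤ → Prop} (k₀ : ℤ) (h₀ : ∀ k ≤ k₀, P k)
    (h : ∀ k, P (k - 1) → P k) (k : ℤ) : P k := by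
  rcases le_total k k₀ with hk | hk
  · exact h₀ k hk
  · induction k, hk using Int.leInduction with
    | base => exact h₀ _ le_rfl
    | succ n _ ih => exact h _ (by simpa using ih)

theorem map_oppTrunc_step (c : V →ₛₗ[starRingEnd ℂ] V) (W F : ℤ → Submodule ℂ V) (p k : ℤ) :
    oppTrunc c W F p k = (F (k - p) ⊓ W k).map c ⊔ oppTrunc c W F p (k - 1) := by
  apply le_antisymm
  · refine iSup₂_le fun q hq => ?_
    rcases eq_or_lt_of_le hq with h | h
    · have : q = k - p := by omega
      subst this
      rw [h]
      exact le_sup_left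
    · refine le_sup_of_le_right ?_
      exact le_iSup₂_of_le q (by omega) le_rfl
  · refine sup_le ?_ ?_
    · refine le_iSup₂_of_le (k - p) (by omega) ?_
      rw [show p + (k - p) = k by ring]
    · refine iSup₂_le fun q hq => le_iSup₂_of_le q (by omega) le_rfl

theorem oppTrunc_le_oppFil (c : V →ₛₗ[starRingEnd ℂ] V) (W F : ℤ → Submodule ℂ V) (p k : ℤ) :
    oppTrunc c W F p k ≤ oppFil c W F p :=
  iSup₂_le fun q _ => le_iSup_of_le q le_rfl

namespace IsMixedHodge

variable {c : V →ₛₗ[starRingEnd ℂ] V} {W F : ℤ → Submodule ℂ V} (h : IsMixedHodge c W F)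

include h

theorem weight_eq_bot_of_le : ∃ k₀, ∀ k ≤ k₀, W k = ⊥ :=
  let ⟨k₀, hk₀⟩ := h.weight_bot
  ⟨k₀, fun _ hk => eq_bot_iff.2 (hk₀ ▸ h.weight_mono hk)⟩

theorem oppTrunc_le_weight (p k : ℤ) : oppTrunc c W F p k ≤ W k := by
  refine iSup₂_le fun q hq => ?_
  rintro _ ⟨v, hv, rfl⟩
  exact h.conj_mem _ _ (h.weight_mono hq hv.2)

theorem exists_oppFil_eq (p : ℤ) : ∃ m₀, ∀ m ≥ m₀, oppFil c W F p = oppTrunc c W F p m := by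
  obtain ⟨q₀, hq₀⟩ := h.hodge_bot
  refine ⟨p + q₀, fun m hm => le_antisymm (iSup_le fun q => ?_) (oppTrunc_le_oppFil ..)⟩
  rcases le_total (p + q) m with hq | hq
  · exact le_iSup₂_of_le q hq le_rfl
  · have : F q = ⊥ := eq_bot_iff.2 (hq₀ ▸ h.hodge_anti (by omega : q₀ ≤ q))
    simp [this]

/-- The terms of highest weight can be stripped off one at a time: if `c f + g` and `g` lie in
`W_{m-1}`, with `f ∈ F^{m-p} ∩ W_m`, then `f` lies in `W_{m-1}` and a fortiori in `F^{m-1-p}`, so `c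
f` is already a term of weight `m - 1`. -/
theorem oppFil_inf_weight (p k : ℤ) : oppFil c W F p ⊓ W k = oppTrunc c W F p k := by
  apply le_antisymm
  · rintro v ⟨hv, hvk⟩
    obtain ⟨m₀, hm₀⟩ := h.exists_oppFil_eq p
    have key : ∀ n : ℕ, v ∈ oppTrunc c W F p (k + n) → v ∈ oppTrunc c W F p k := by
      intro n
      induction n with
      | zero => simp
      | succ n ih =>
        intro hn
        refine ih ?_
        rw [map_oppTrunc_step, Submodule.mem_sup] at hn
        obtain ⟨_, ⟨f, hf, rfl⟩, g, hg, rfl⟩ := hn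
        have e : k + ((n + 1 : ℕ) : ℤ) - 1 = k + n := by push_cast; ring
        rw [e] at hg
        have h1 : c f ∈ W (k + n) := by
          have := Submodule.sub_mem _ (h.weight_mono (by omega : k ≤ k + n) hvk)
            (h.oppTrunc_le_weight _ _ hg)
          simpa using this
        have h2 : f ∈ W (k + n) := h.conj_conj f ▸ h.conj_mem _ _ h1
        refine Submodule.add_mem _ ?_ hg
        rw [map_oppTrunc_step]
        refine Submodule.mem_sup_left (Submodule.mem_map_of_mem ⟨?_, h2⟩)
        exact h.hodge_anti (by omega) hf.1
    obtain ⟨n, hn⟩ := Int.eq_ofNat_of_zero_le (le_max_right (m₀ - k) 0)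
    refine key n ?_
    rwa [← hm₀]
    omega
  · exact le_inf (oppTrunc_le_oppFil ..) (h.oppTrunc_le_weight _ _)

theorem oppFil_mono : Monotone (oppFil c W F) := fun p p' hp =>
  iSup_mono fun q => Submodule.map_mono (inf_le_inf_left _ (h.weight_mono (by omega)))

theorem map_conj_le_oppFil (p q k : ℤ) (hk : k ≤ p + q) : (F q ⊓ W k).map c ≤ oppFil c W F p :=
  le_iSup_of_le q (Submodule.map_mono (inf_le_inf_left _ (h.weight_mono hk)))

/-- Modulo `W_{k-1}` an element of `G_{p-1} ∩ W_k` is conjugate to one of `F^{k-p+1}`, which is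
opposed to `F^p` on `Gr_k`. So an element of the intersection falls through all the weights. -/
theorem disjoint_oppFil (p : ℤ) : Disjoint (F p) (oppFil c W F (p - 1)) := by
  rw [Submodule.disjoint_def]
  intro v hF hG
  obtain ⟨k₀, hk₀⟩ := h.weight_eq_bot_of_le
  obtain ⟨m, hm⟩ := h.weight_top
  have key : ∀ k, v ∈ W k → v = 0 := by
    refine int_induction_of_le k₀ (fun k hk hv => ?_) fun k ih hv => ih ?_
    · simpa [hk₀ k hk] using hv
    · have hv' : v ∈ oppTrunc c W F (p - 1) k := h.oppFil_inf_weight _ _ ▸ ⟨hG, hv⟩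
      rw [map_oppTrunc_step, Submodule.mem_sup] at hv'
      obtain ⟨_, ⟨f, hf, rfl⟩, g, hg, rfl⟩ := hv'
      rw [show k - (p - 1) = k - p + 1 by ring] at hf
      exact h.graded_inf k p _ ⟨hF, hv⟩ f hf (by simpa using h.oppTrunc_le_weight _ _ hg)
  exact key m (hm ▸ Submodule.mem_top)

/-- The splitting of each `Gr_k` lifts, by induction on the weight, to one strictly compatible with
`W`. This form is stronger than being complementary and is what the perturbation lemmas need. -/
theorem weight_le (p k : ℤ) : W k ≤ (F p ⊓ W k) ⊔ (oppFil c W F (p - 1) ⊓ W k) := by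
  obtain ⟨k₀, hk₀⟩ := h.weight_eq_bot_of_le
  induction k using int_induction_of_le k₀ with
  | h₀ k hk => simp [hk₀ k hk]
  | h k ih =>
    intro v hv
    obtain ⟨f, hf, g, hg, hw⟩ := h.graded_sup k p v hv
    have h1 : v - f - c g ∈ (F p ⊓ W k) ⊔ (oppFil c W F (p - 1) ⊓ W k) :=
      sup_le_sup (inf_le_inf_left _ (h.weight_mono (by omega)))
        (inf_le_inf_left _ (h.weight_mono (by omega))) (ih hw)
    have h2 : c g ∈ oppFil c W F (p - 1) ⊓ W k :=
      ⟨h.map_conj_le_oppFil _ _ k (by omega) (Submodule.mem_map_of_mem hg), h.conj_mem _ _ hg.2⟩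
    have := Submodule.add_mem _ (Submodule.add_mem _ h1 (Submodule.mem_sup_right h2))
      (Submodule.mem_sup_left hf)
    simpa using this

theorem isCompl_oppFil (p : ℤ) : IsCompl (F p) (oppFil c W F (p - 1)) := by
  refine ⟨h.disjoint_oppFil p, codisjoint_iff.2 (top_le_iff.1 ?_)⟩
  obtain ⟨m, hm⟩ := h.weight_top
  simpa [hm] using h.weight_le p m

/-- By modularity, a complement cannot be enlarged and stay disjoint. -/
theorem oppFil_eq_of_le {p : ℤ} {G : Submodule ℂ V} (hG : oppFil c W F (p - 1) ≤ G)
    (hd : Disjoint (F p) G) : oppFil c W F (p - 1) = G := by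
  refine eq_of_le_of_inf_le_of_sup_le (z := F p) hG ?_ ?_
  · rw [inf_comm, hd.eq_bot]
    exact bot_le
  · rw [sup_comm (oppFil c W F (p - 1)), (h.isCompl_oppFil p).sup_eq_top]
    exact le_top

end IsMixedHodge

/-! ### The Deligne bigrading -/

/-- Deligne's explicit bigrading of a mixed Hodge structure. -/
def bigrading (c : V →ₛₗ[starRingEnd ℂ] V) (W F : ℤ → Submodule ℂ V) (p q : ℤ) : Submodule ℂ V :=
  F p ⊓ W (p + q) ⊓
    ((F q ⊓ W (p + q)).map c ⊔ (oppFil c W F (p - 1) ⊓ W (p + q - 2)))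

/-- In a vanishing finite sum the term of largest index lies in the span of the earlier summands, so
it is zero and can be removed. -/
theorem iSupIndep_of_disjoint_lt {ι R N : Type*} [LinearOrder ι] [Ring R] [AddCommGroup N]
    [Module R N] {f : ι → Submodule R N} (h : ∀ i, Disjoint (f i) (⨆ (j) (_ : j < i), f j)) :
    iSupIndep f := by
  classical
  rw [iSupIndep_iff_finsetSum_eq_zero_imp_eq_zero]
  intro s
  induction s using Finset.induction_on_max with
  | empty => simp
  | insert a s hs ih =>
    intro v hv h0
    have ha : a ∉ s := fun h => lt_irrefl _ (hs a h)
    rw [Finset.sum_insert ha] at h0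
    have h1 : ∑ i ∈ s, v i ∈ ⨆ (j) (_ : j < a), f j := Submodule.sum_mem _ fun i hi =>
      (le_iSup₂_of_le (f := fun j (_ : j < a) => f j) i (hs i hi) le_rfl)
        (hv i (Finset.mem_insert_of_mem hi))
    have h2 : v a = 0 := by
      refine (Submodule.disjoint_def.1 (h a)) _ (hv a (Finset.mem_insert_self _ _)) ?_
      rw [eq_neg_of_add_eq_zero_left h0]
      exact Submodule.neg_mem _ h1
    intro i hi
    rcases Finset.mem_insert.1 hi with rfl | hi
    · exact h2
    · refine ih v (fun j hj => hv j (Finset.mem_insert_of_mem hj)) ?_ i hi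
      simpa [h2] using h0

/-- Sums of independent subspaces form a distributive lattice. Split `A` into `A ∩ B` and `A \ B`
and apply the modular law. -/
theorem iSupIndep.biSup_inf_biSup {ι R N : Type*} [Ring R] [AddCommGroup N]
    [Module R N] {f : ι → Submodule R N} (h : iSupIndep f) (A B : Set ι) :
    (⨆ i ∈ A, f i) ⊓ (⨆ i ∈ B, f i) = ⨆ i ∈ A ∩ B, f i := by
  have h1 : (⨆ i ∈ A, f i) = (⨆ i ∈ A ∩ B, f i) ⊔ ⨆ i ∈ A \ B, f i := by
    rw [← iSup_union, Set.inter_union_sdiff]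
  have h2 : (⨆ i ∈ A ∩ B, f i) ≤ ⨆ i ∈ B, f i := biSup_mono fun i hi => hi.2
  rw [h1, sup_inf_assoc_of_le _ h2,
    (h.disjoint_biSup_biSup (Set.disjoint_sdiff_left (s := B) (t := A))).eq_bot, sup_bot_eq]

theorem iSup_pair_eq (I : ℤ → ℤ → Submodule ℂ V) (P : ℤ → ℤ → Prop) :
    (⨆ (r : ℤ) (s : ℤ) (_ : P r s), I r s) =
      ⨆ i ∈ {i : ℤ × ℤ | P i.1 i.2}, I i.1 i.2 := by
  rw [iSup_prod]
  rfl

namespace IsMixedHodge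

variable {c : V →ₛₗ[starRingEnd ℂ] V} {W F : ℤ → Submodule ℂ V} (h : IsMixedHodge c W F)

include h

theorem bigrading_le_conj (p q : ℤ) :
    (F q ⊓ W (p + q)).map c ⊔ (oppFil c W F (p - 1) ⊓ W (p + q - 2)) ≤ oppFil c W F p :=
  sup_le (h.map_conj_le_oppFil _ _ _ le_rfl) (inf_le_left.trans (h.oppFil_mono (by omega)))

theorem bigrading_le_oppFil (p q : ℤ) : bigrading c W F p q ≤ oppFil c W F p :=
  inf_le_right.trans (h.bigrading_le_conj p q)

/-- An element of `conj(F^q) ∩ W_{p+q} + G_{p-1} ∩ W_{p+q-2}` in `W_{p+q-1}` lies in `G_{p-1}`. -/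
theorem mem_oppFil_of_mem_weight {p q : ℤ} {v : V} (hW : v ∈ W (p + q - 1))
    (hv : v ∈ (F q ⊓ W (p + q)).map c ⊔ (oppFil c W F (p - 1) ⊓ W (p + q - 2))) :
    v ∈ oppFil c W F (p - 1) := by
  rw [Submodule.mem_sup] at hv
  obtain ⟨_, ⟨f, hf, rfl⟩, g, hg, rfl⟩ := hv
  refine Submodule.add_mem _ ?_ hg.1
  have h1 : c f ∈ W (p + q - 1) := by
    have := Submodule.sub_mem _ hW (h.weight_mono (by omega : p + q - 2 ≤ p + q - 1) hg.2)
    simpa using this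
  exact h.map_conj_le_oppFil _ q (p + q - 1) (by omega)
    (Submodule.mem_map_of_mem ⟨hf.1, h.conj_conj f ▸ h.conj_mem _ _ h1⟩)

theorem bigrading_inf_weight {p q : ℤ} {v : V} (hv : v ∈ bigrading c W F p q)
    (hW : v ∈ W (p + q - 1)) : v = 0 :=
  (Submodule.disjoint_def.1 (h.disjoint_oppFil p)) v hv.1.1 (h.mem_oppFil_of_mem_weight hW hv.2)

/-- A class of type `(p, q)` in `Gr_N` lifts to the bigrading. The discrepancy `f - c g` splits in
`W_{N-1}` along `F^p` and `G_{p-1}`; its first part corrects `f`, and the part of weight `N - 1` of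
the second corrects `g`, which leaves an error in `G_{p-1} ∩ W_{N-2}`. -/
theorem exists_bigrading_lift {p q N : ℤ} (hN : p + q = N) {f g : V} (hf : f ∈ F p ⊓ W N)
    (hg : g ∈ F q ⊓ W N) (hfg : f - c g ∈ W (N - 1)) :
    ∃ i ∈ bigrading c W F p q, f - i ∈ W (N - 1) := by
  subst hN
  obtain ⟨f₁, hf₁, l, hl, hs⟩ := Submodule.mem_sup.1 (h.weight_le p _ hfg)
  rw [h.oppFil_inf_weight, map_oppTrunc_step, Submodule.mem_sup] at hl
  obtain ⟨_, ⟨g₁, hg₁, rfl⟩, l, hl, rfl⟩ := hl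
  rw [← h.oppFil_inf_weight, show p + q - 1 - 1 = p + q - 2 by ring] at hl
  rw [show p + q - 1 - (p - 1) = q by ring] at hg₁
  have hle : W (p + q - 1) ≤ W (p + q) := h.weight_mono (by omega)
  refine ⟨f - f₁, ⟨⟨Submodule.sub_mem _ hf.1 hf₁.1, Submodule.sub_mem _ hf.2 (hle hf₁.2)⟩, ?_⟩, ?_⟩
  · have : f - f₁ = c (g + g₁) + l := by
      rw [map_add, sub_eq_iff_eq_add.1 hs.symm]
      abel
    rw [this]
    exact Submodule.add_mem _ (Submodule.mem_sup_left (Submodule.mem_map_of_mem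
      ⟨Submodule.add_mem _ hg.1 hg₁.1, Submodule.add_mem _ hg.2 (hle hg₁.2)⟩))
      (Submodule.mem_sup_right hl)
  · simpa using hf₁.2

/-- Modulo `F^{p+1}`, an element of `F^p ∩ W_N` has type `(p, N - p)` on `Gr_N`, so it lifts to the
bigrading up to an element of `F^p ∩ W_{N-1}`. The induction is upward in `N` and, inside it,
downward in `p`. -/
theorem hodge_inf_weight_le (p N : ℤ) :
    F p ⊓ W N ≤ ⨆ (r : ℤ) (s : ℤ) (_ : p ≤ r ∧ r + s ≤ N), bigrading c W F r s := by
  obtain ⟨k₀, hk₀⟩ := h.weight_eq_bot_of_le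
  obtain ⟨p₀, hp₀⟩ := h.hodge_bot
  have hmono : ∀ {p p' N N' : ℤ}, p' ≤ p → N ≤ N' →
      (⨆ (r : ℤ) (s : ℤ) (_ : p ≤ r ∧ r + s ≤ N), bigrading c W F r s) ≤
        ⨆ (r : ℤ) (s : ℤ) (_ : p' ≤ r ∧ r + s ≤ N'), bigrading c W F r s := by
    intro p p' N N' h₁ h₂
    refine iSup₂_mono fun r s => iSup_mono' fun hrs => ⟨⟨by omega, by omega⟩, le_rfl⟩
  induction N using int_induction_of_le k₀ generalizing p with
  | h₀ k hk => simp [hk₀ k hk]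
  | h N ihN =>
    -- The sign change turns the descending induction on `p` into an ascending one.
    obtain ⟨n, rfl⟩ : ∃ n, p = -n := ⟨-p, by ring⟩
    induction n using int_induction_of_le (-p₀) with
    | h₀ n hn =>
      have : F (-n) = ⊥ := eq_bot_iff.2 (hp₀ ▸ h.hodge_anti (by omega : p₀ ≤ -n))
      simp [this]
    | h n ihn =>
      set p := -n with hp
      rw [show -(n - 1) = p + 1 by omega] at ihn
      intro f hf
      obtain ⟨f₁, hf₁, g, hg, hw⟩ := h.graded_sup N (p + 1) f hf.2
      have hf' : f - f₁ ∈ F p ⊓ W N := Submodule.sub_mem _ hf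
        ⟨h.hodge_anti (by omega : p ≤ p + 1) hf₁.1, hf₁.2⟩
      rw [show N - (p + 1) + 1 = N - p by ring] at hg
      obtain ⟨i, hi, hiw⟩ := h.exists_bigrading_lift (by ring) hf' hg hw
      have h1 := hmono (le_refl p) (by omega : N - 1 ≤ N)
        (ihN p ⟨Submodule.sub_mem _ hf'.1 hi.1.1, hiw⟩)
      have h2 := hmono (by omega : p ≤ p + 1) (le_refl N) (ihn hf₁)
      have h3 : i ∈ ⨆ (r : ℤ) (s : ℤ) (_ : p ≤ r ∧ r + s ≤ N), bigrading c W F r s :=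
        (le_iSup₂_of_le (f := fun r s => ⨆ (_ : p ≤ r ∧ r + s ≤ N), bigrading c W F r s)
          p (N - p) (le_iSup_of_le ⟨le_rfl, by omega⟩ le_rfl)) hi
      have := Submodule.add_mem _ (Submodule.add_mem _ h1 h3) h2
      simpa using this

theorem hodge_inf_weight_eq (p N : ℤ) :
    F p ⊓ W N = ⨆ (r : ℤ) (s : ℤ) (_ : p ≤ r ∧ r + s ≤ N), bigrading c W F r s := by
  refine le_antisymm (h.hodge_inf_weight_le p N) (iSup₂_le fun r s => iSup_le fun hrs => ?_)
  exact fun v hv => ⟨h.hodge_anti hrs.1 hv.1.1, h.weight_mono hrs.2 hv.1.2⟩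

theorem hodge_eq_iSup_bigrading (p : ℤ) :
    F p = ⨆ (r : ℤ) (s : ℤ) (_ : p ≤ r), bigrading c W F r s := by
  refine le_antisymm ?_ (iSup₂_le fun r s => iSup_le fun hr v hv => h.hodge_anti hr hv.1.1)
  obtain ⟨m, hm⟩ := h.weight_top
  have := h.hodge_inf_weight_le p m
  rw [hm, inf_top_eq] at this
  exact this.trans (iSup₂_mono fun r s => iSup_mono' fun hrs => ⟨hrs.1, le_rfl⟩)

theorem weight_eq_iSup_bigrading (N : ℤ) :
    W N = ⨆ (r : ℤ) (s : ℤ) (_ : r + s ≤ N), bigrading c W F r s := by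
  refine le_antisymm ?_ (iSup₂_le fun r s => iSup_le fun hr v hv => h.weight_mono hr hv.1.2)
  obtain ⟨m, hm⟩ := h.hodge_top
  have := h.hodge_inf_weight_le m N
  rw [hm, top_inf_eq] at this
  exact this.trans (iSup₂_mono fun r s => iSup_mono' fun hrs => ⟨hrs.2, le_rfl⟩)

/-- In the lexicographic order, the summands before `(p, q)` lie in `G_{p-1}` when their first index
is smaller, and in `F^p ∩ W_{p+q-1}` otherwise. The first space is disjoint from `F^p`, and the
second meets `I^{p,q}` trivially. -/
theorem iSupIndep_bigrading : iSupIndep fun i : ℤ × ℤ => bigrading c W F i.1 i.2 := by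
  have key : iSupIndep fun i : ℤ ×ₗ ℤ => bigrading c W F (ofLex i).1 (ofLex i).2 := by
    refine iSupIndep_of_disjoint_lt fun i => ?_
    obtain ⟨p, q⟩ := i
    rw [Submodule.disjoint_def]
    intro v hv hs
    change v ∈ bigrading c W F p q at hv
    have hle : (⨆ (j : ℤ ×ₗ ℤ) (_ : j < toLex (p, q)), bigrading c W F (ofLex j).1 (ofLex j).2) ≤
        oppFil c W F (p - 1) ⊔ (F p ⊓ W (p + q - 1)) := by
      refine iSup₂_le fun j hj => ?_
      rw [Prod.Lex.lt_iff] at hj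
      rcases hj with hj | ⟨hj, hj'⟩
      · exact le_sup_of_le_left ((h.bigrading_le_oppFil _ _).trans
          (h.oppFil_mono (by simp at hj; omega)))
      · refine le_sup_of_le_right fun w hw => ⟨?_, ?_⟩
        · exact h.hodge_anti (by simp at hj; omega) hw.1.1
        · exact h.weight_mono (by simp at hj hj'; omega) hw.1.2
    obtain ⟨g, hg, w, hw, rfl⟩ := Submodule.mem_sup.1 (hle hs)
    have hg0 : g = 0 := by
      refine Submodule.disjoint_def.1 (h.disjoint_oppFil p) g ?_ hg
      simpa using Submodule.sub_mem _ hv.1.1 hw.1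
    subst hg0
    rw [zero_add] at hv ⊢
    exact h.bigrading_inf_weight hv hw.2
  exact key.comp (f := toLex) toLex.injective

theorem oppFil_eq_iSup_bigrading (p : ℤ) :
    oppFil c W F (p - 1) = ⨆ (r : ℤ) (s : ℤ) (_ : r < p), bigrading c W F r s := by
  refine (le_antisymm (iSup₂_le fun r s => iSup_le fun hr => ?_) ?_).symm
  · exact (h.bigrading_le_oppFil r s).trans (h.oppFil_mono (by omega))
  · have hle : (⨆ (r : ℤ) (s : ℤ) (_ : r < p), bigrading c W F r s) ≤ oppFil c W F (p - 1) :=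
      iSup₂_le fun r s => iSup_le fun hr =>
        (h.bigrading_le_oppFil r s).trans (h.oppFil_mono (by omega))
    have htop : F p ⊔ (⨆ (r : ℤ) (s : ℤ) (_ : r < p), bigrading c W F r s) = ⊤ := by
      obtain ⟨m, hm⟩ := h.hodge_top
      rw [eq_top_iff, ← hm, h.hodge_eq_iSup_bigrading m]
      refine iSup₂_le fun r s => iSup_le fun _ => ?_
      rcases le_or_gt p r with hr | hr
      · exact le_sup_of_le_left fun v hv => h.hodge_anti hr hv.1.1
      · exact le_sup_of_le_right (le_iSup₂_of_le r s (le_iSup_of_le hr le_rfl))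
    refine (eq_of_le_of_inf_le_of_sup_le (z := F p) hle ?_ ?_).ge
    · rw [inf_comm, (h.disjoint_oppFil p).eq_bot]
      exact bot_le
    · rw [sup_comm _ (F p), sup_comm _ (F p), htop]
      exact le_top

/-- As `c` is an involution, the left side is `∑_p F^p ∩ W_{q-1+p}`. The bounds `r ≥ p` and `r + s ≤
q - 1 + p` on the summands of each term amount to `s < q`. -/
theorem map_conj_oppFil (q : ℤ) :
    (oppFil c W F (q - 1)).map c = ⨆ (r : ℤ) (s : ℤ) (_ : s < q), bigrading c W F r s := by
  have h0 : (oppFil c W F (q - 1)).map c = ⨆ p, F p ⊓ W (q - 1 + p) := by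
    rw [oppFil, Submodule.map_iSup]
    refine iSup_congr fun p => ?_
    ext v
    constructor
    · rintro ⟨_, ⟨w, hw, rfl⟩, rfl⟩
      rwa [h.conj_conj]
    · exact fun hv => ⟨c v, ⟨v, hv, rfl⟩, h.conj_conj v⟩
  rw [h0]
  apply le_antisymm
  · refine iSup_le fun p => ?_
    rw [h.hodge_inf_weight_eq]
    exact iSup₂_mono fun r s => iSup_mono' fun hrs => ⟨by omega, le_rfl⟩
  · refine iSup₂_le fun r s => iSup_le fun hs => le_iSup_of_le r fun v hv => ⟨hv.1.1, ?_⟩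
    exact h.weight_mono (by omega) hv.1.2

/-- The difference lies in `G_{p-1}`, which bounds the first index, and by symmetry in
`conj(G_{q-1})`, which bounds the second. Independence of the bigrading lets the two bounds be
imposed at once. -/
theorem sub_conj_mem {p q : ℤ} {x y : V} (hx : x ∈ bigrading c W F p q)
    (hy : y ∈ bigrading c W F q p) (hxy : x - c y ∈ W (p + q - 1)) :
    x - c y ∈ ⨆ (r : ℤ) (s : ℤ) (_ : r < p ∧ s < q), bigrading c W F r s := by
  have hqp : q + p = p + q := add_comm _ _
  have h1 : x - c y ∈ oppFil c W F (p - 1) := by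
    refine h.mem_oppFil_of_mem_weight hxy (Submodule.sub_mem _ hx.2 ?_)
    exact Submodule.mem_sup_left (Submodule.mem_map_of_mem ⟨hy.1.1, hqp ▸ hy.1.2⟩)
  have h2 : x - c y ∈ (oppFil c W F (q - 1)).map c := by
    refine ⟨c x - y, ?_, by simp [h.conj_conj]⟩
    refine h.mem_oppFil_of_mem_weight ?_ (Submodule.sub_mem _ ?_ hy.2)
    · rw [hqp]
      simpa [h.conj_conj] using h.conj_mem _ _ hxy
    · exact Submodule.mem_sup_left (Submodule.mem_map_of_mem ⟨hx.1.1, hqp ▸ hx.1.2⟩)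
  rw [h.oppFil_eq_iSup_bigrading, iSup_pair_eq (bigrading c W F) fun r _ => r < p] at h1
  rw [h.map_conj_oppFil, iSup_pair_eq (bigrading c W F) fun _ s => s < q] at h2
  rw [iSup_pair_eq (bigrading c W F) fun r s => r < p ∧ s < q]
  have := h.iSupIndep_bigrading.biSup_inf_biSup {i : ℤ × ℤ | i.1 < p} {i : ℤ × ℤ | i.2 < q}
  exact this.le ⟨h1, h2⟩

/-- Conjugation exchanges the types `(p, q)` and `(q, p)` on `Gr_{p+q}`. Lifting a conjugate back to
the bigrading leaves an error of lower weight, which `sub_conj_mem` improves to the error allowed.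
-/
theorem bigrading_conj (p q : ℤ) :
    bigrading c W F p q ⊔
        (⨆ (r : ℤ) (s : ℤ) (_ : r < p ∧ s < q), bigrading c W F r s) =
      (bigrading c W F q p).map c ⊔
        (⨆ (r : ℤ) (s : ℤ) (_ : r < p ∧ s < q), bigrading c W F r s) := by
  have lift : ∀ {p q : ℤ} {y : V}, y ∈ bigrading c W F q p →
      ∃ x ∈ bigrading c W F p q, x - c y ∈ W (p + q - 1) := by
    intro p q y hy
    have hqp : q + p = p + q := add_comm _ _
    obtain ⟨⟨hy1, hy2⟩, hy3⟩ := hy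
    obtain ⟨_, ⟨f, hf, rfl⟩, l, hl, rfl⟩ := Submodule.mem_sup.1 hy3
    rw [hqp] at hf hl hy2
    have hcl : c l ∈ W (p + q - 1) := h.conj_mem _ _ (h.weight_mono (by omega) hl.2)
    obtain ⟨i, hi, hi'⟩ := h.exists_bigrading_lift (rfl : p + q = p + q) hf ⟨hy1, hy2⟩
      (by rw [map_add, h.conj_conj]; simpa using Submodule.neg_mem _ hcl)
    refine ⟨i, hi, ?_⟩
    rw [map_add, h.conj_conj]
    have := Submodule.neg_mem _ (Submodule.add_mem _ hi' hcl)
    convert this using 1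
    abel
  apply le_antisymm
  · refine sup_le (fun x hx => ?_) le_sup_right
    obtain ⟨y, hy, hxy⟩ := lift (p := q) (q := p) hx
    have hxy' : x - c y ∈ W (p + q - 1) := by
      have := Submodule.neg_mem _ (h.conj_mem _ _ hxy)
      rw [add_comm q p] at this
      simpa [h.conj_conj] using this
    have := Submodule.add_mem _ (Submodule.mem_sup_right (h.sub_conj_mem hx hy hxy'))
      (Submodule.mem_sup_left (Submodule.mem_map_of_mem (f := c) hy))
    simpa using this
  · refine sup_le ?_ le_sup_right
    rintro _ ⟨y, hy, rfl⟩
    obtain ⟨x, hx, hxy⟩ := lift (p := p) (q := q) hy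
    have := Submodule.sub_mem _ (Submodule.mem_sup_left hx)
      (Submodule.mem_sup_right (h.sub_conj_mem hx hy hxy))
    simpa using this

end IsMixedHodge

end MixedHodge

/-! ### Complexified rational structures, and uniqueness of `𝓤^p` -/

section Rational

variable {M M' : Type*} [AddCommGroup M] [Module ℚ M] [AddCommGroup M'] [Module ℚ M']

theorem conjC_tmul (z : ℂ) (m : M) : conjC M (z ⊗ₜ m) = (starRingEnd ℂ) z ⊗ₜ[ℚ] m := rfl

theorem conjC_conjC (v : ℂ ⊗[ℚ] M) : conjC M (conjC M v) = v := by
  induction v using TensorProduct.induction_on with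
  | zero => simp
  | tmul z m => simp [conjC_tmul]
  | add a b ha hb => simp only [map_add, ha, hb]

theorem conjC_baseChange (f : M →ₗ[ℚ] M') (v : ℂ ⊗[ℚ] M) :
    conjC M' (f.baseChange ℂ v) = f.baseChange ℂ (conjC M v) := by
  induction v using TensorProduct.induction_on with
  | zero => simp
  | tmul z m => simp [conjC_tmul]
  | add a b ha hb => simp only [map_add, ha, hb]

theorem conjC_mem_baseChange (A : Submodule ℚ M) {v : ℂ ⊗[ℚ] M} (hv : v ∈ A.baseChange ℂ) :
    conjC M v ∈ A.baseChange ℂ := by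
  obtain ⟨a, rfl⟩ := hv
  exact ⟨conjC A a, (conjC_baseChange _ _).symm⟩

theorem subtype_baseChange_injective (A : Submodule ℚ M) :
    Function.Injective (A.subtype.baseChange ℂ) :=
  Module.Flat.lTensor_preserves_injective_linearMap _ A.injective_subtype

/-- Flatness of `ℂ` over `ℚ` identifies the kernel; with it, opposedness on the complexified
quotient becomes the elementwise conditions of `IsMixedHodge`. -/
theorem mkQ_baseChange_eq_zero_iff {A B : Submodule ℚ M} (h : B ≤ A) (b : ℂ ⊗[ℚ] A) :
    (B.submoduleOf A).mkQ.baseChange ℂ b = 0 ↔ A.subtype.baseChange ℂ b ∈ B.baseChange ℂ := by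
  have hex : Function.Exact (((B.submoduleOf A).subtype).lTensor ℂ)
      (((B.submoduleOf A).mkQ).lTensor ℂ) :=
    Module.Flat.lTensor_exact ℂ (LinearMap.exact_subtype_mkQ _)
  have hcomp : A.subtype.baseChange ℂ ∘ₗ (B.submoduleOf A).subtype.baseChange ℂ =
      B.subtype.baseChange ℂ ∘ₗ (Submodule.submoduleOfEquivOfLe h).toLinearMap.baseChange ℂ := by
    rw [← LinearMap.baseChange_comp, ← LinearMap.baseChange_comp]
    rfl
  constructor
  · intro hb
    obtain ⟨a, rfl⟩ := (hex b).1 hb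
    exact ⟨_, (LinearMap.congr_fun hcomp a).symm⟩
  · rintro ⟨a, ha⟩
    refine (hex b).2 ⟨(Submodule.submoduleOfEquivOfLe h).symm.toLinearMap.baseChange ℂ a, ?_⟩
    apply subtype_baseChange_injective A
    have hs : (Submodule.submoduleOfEquivOfLe h).toLinearMap.baseChange ℂ
        ((Submodule.submoduleOfEquivOfLe h).symm.toLinearMap.baseChange ℂ a) = a := by
      rw [← LinearMap.comp_apply, ← LinearMap.baseChange_comp, LinearEquiv.comp_coe,
        LinearEquiv.symm_trans_self]
      simp
    exact (LinearMap.congr_fun hcomp _).trans ((congrArg _ hs).trans ha)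

theorem graded_sup_of_isPure {A B : Submodule ℚ M} (h : B ≤ A) {k : ℤ}
    {F : ℤ → Submodule ℂ (ℂ ⊗[ℚ] M)}
    (hF : IsPureHodgeStructure k fun p => inducedOnQuotient A B (F p)) (p : ℤ)
    (v : ℂ ⊗[ℚ] M) (hv : v ∈ A.baseChange ℂ) :
    ∃ f ∈ F p ⊓ A.baseChange ℂ, ∃ g ∈ F (k - p + 1) ⊓ A.baseChange ℂ,
      v - f - conjC M g ∈ B.baseChange ℂ := by
  obtain ⟨a, rfl⟩ := hv
  have htop := (hF.opposed p).sup_eq_top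
  obtain ⟨_, ⟨b, hb, rfl⟩, _, ⟨_, ⟨b', hb', rfl⟩, rfl⟩, hs⟩ := Submodule.mem_sup.1
    (htop ▸ Submodule.mem_top : (B.submoduleOf A).mkQ.baseChange ℂ a ∈ _)
  refine ⟨_, ⟨hb, b, rfl⟩, _, ⟨hb', b', rfl⟩, ?_⟩
  rw [conjC_baseChange, ← map_sub, ← map_sub, ← mkQ_baseChange_eq_zero_iff h, map_sub, map_sub,
    ← hs, conjC_baseChange]
  abel

theorem graded_inf_of_isPure {A B : Submodule ℚ M} (h : B ≤ A) {k : ℤ}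
    {F : ℤ → Submodule ℂ (ℂ ⊗[ℚ] M)}
    (hF : IsPureHodgeStructure k fun p => inducedOnQuotient A B (F p)) (p : ℤ)
    (f : ℂ ⊗[ℚ] M) (hf : f ∈ F p ⊓ A.baseChange ℂ) (g : ℂ ⊗[ℚ] M)
    (hg : g ∈ F (k - p + 1) ⊓ A.baseChange ℂ) (hfg : f - conjC M g ∈ B.baseChange ℂ) :
    f ∈ B.baseChange ℂ := by
  obtain ⟨hf, b, rfl⟩ := hf
  obtain ⟨hg, b', rfl⟩ := hg
  rw [conjC_baseChange, ← map_sub, ← mkQ_baseChange_eq_zero_iff h, map_sub, sub_eq_zero] at hfg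
  rw [← mkQ_baseChange_eq_zero_iff h]
  refine Submodule.disjoint_def.1 (hF.opposed p).disjoint _ ⟨b, hf, rfl⟩ ?_
  rw [hfg, ← conjC_baseChange]
  exact Submodule.mem_map_of_mem ⟨b', hg, rfl⟩

theorem isMixedHodge_of_graded {W : ℤ → Submodule ℚ M} {F : ℤ → Submodule ℂ (ℂ ⊗[ℚ] M)}
    (hW : Monotone W) (hWb : ∃ k, W k = ⊥) (hWt : ∃ k, W k = ⊤) (hF : Antitone F)
    (hFb : ∃ p, F p = ⊥) (hFt : ∃ p, F p = ⊤)
    (hgr : ∀ k, IsPureHodgeStructure k fun p => inducedOnQuotient (W k) (W (k - 1)) (F p)) :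
    IsMixedHodge (conjC M) (fun k => (W k).baseChange ℂ) F where
  conj_conj := conjC_conjC
  weight_mono _ _ hkl := Submodule.baseChange_mono _ (hW hkl)
  weight_bot := hWb.imp fun k hk => by simp [hk]
  weight_top := hWt.imp fun k hk => by simp [hk]
  conj_mem _ _ hv := conjC_mem_baseChange _ hv
  hodge_anti := hF
  hodge_bot := hFb
  hodge_top := hFt
  graded_sup k p := graded_sup_of_isPure (hW (by omega)) (hgr k) p
  graded_inf k p := graded_inf_of_isPure (hW (by omega)) (hgr k) p

variable {W : ℤ → Submodule ℚ M} {F : ℤ → Submodule ℂ (ℂ ⊗[ℚ] M)}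

theorem IsMixedHodge.isDeligneBigrading
    (h : IsMixedHodge (conjC M) (fun k => (W k).baseChange ℂ) F) :
    IsDeligneBigrading W F (bigrading (conjC M) (fun k => (W k).baseChange ℂ) F) where
  internal := by
    refine DirectSum.isInternal_submodule_of_iSupIndep_of_iSup_eq_top h.iSupIndep_bigrading ?_
    obtain ⟨m, hm⟩ := h.hodge_top
    rw [eq_top_iff, ← hm, h.hodge_eq_iSup_bigrading m, iSup_prod]
    exact iSup₂_mono fun r s => iSup_le fun _ => le_rfl
  hodge := h.hodge_eq_iSup_bigrading
  weight := h.weight_eq_iSup_bigrading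
  conj := h.bigrading_conj

section AnyBigrading

variable {I : ℤ → ℤ → Submodule ℂ (ℂ ⊗[ℚ] M)} (hI : IsDeligneBigrading W F I)

include hI

theorem IsDeligneBigrading.biSup_inf_biSup (A B : Set (ℤ × ℤ)) :
    (⨆ i ∈ A, I i.1 i.2) ⊓ (⨆ i ∈ B, I i.1 i.2) = ⨆ i ∈ A ∩ B, I i.1 i.2 :=
  hI.internal.submodule_iSupIndep.biSup_inf_biSup A B

theorem IsDeligneBigrading.hodge_eq (p : ℤ) : F p = ⨆ i ∈ {i : ℤ × ℤ | p ≤ i.1}, I i.1 i.2 := by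
  rw [hI.hodge p, iSup_pair_eq I fun r _ => p ≤ r]

theorem IsDeligneBigrading.weight_eq (k : ℤ) :
    (W k).baseChange ℂ = ⨆ i ∈ {i : ℤ × ℤ | i.1 + i.2 ≤ k}, I i.1 i.2 := by
  rw [hI.weight k, iSup_pair_eq I fun r s => r + s ≤ k]

/-- This makes `𝓤^p` independent of the bigrading chosen. A summand `I^{i,j}` of `F^q ∩ W_{p-1+q}`
has `i ≥ q` and so `j < p`; its conjugate lies in `I^{j,i}` plus summands of first index below `j`.
This gives one inclusion, and both sides are disjoint from `F^p`, so equality follows. -/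
theorem IsDeligneBigrading.oppFil_eq
    (h : IsMixedHodge (conjC M) (fun k => (W k).baseChange ℂ) F) (p : ℤ) :
    oppFil (conjC M) (fun k => (W k).baseChange ℂ) F (p - 1) =
      ⨆ i ∈ {i : ℤ × ℤ | i.1 < p}, I i.1 i.2 := by
  apply h.oppFil_eq_of_le
  · refine iSup_le fun q => ?_
    beta_reduce
    rw [hI.hodge_eq, hI.weight_eq, hI.biSup_inf_biSup, Submodule.map_iSup]
    refine iSup_le fun i => ?_
    rw [Submodule.map_iSup]
    refine iSup_le fun hi => ?_
    obtain ⟨hi1, hi2⟩ := hi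
    simp only [Set.mem_ofPred_eq] at hi1 hi2
    have h1 := (hI.conj i.2 i.1).ge
    refine (le_sup_left.trans h1).trans (sup_le ?_ ?_)
    · exact le_iSup₂_of_le (f := fun (i : ℤ × ℤ) (_ : i ∈ {i : ℤ × ℤ | i.1 < p}) => I i.1 i.2)
        (i.2, i.1) (by simp only [Set.mem_ofPred_eq]; omega) le_rfl
    · refine iSup₂_le fun r s => iSup_le fun hrs => ?_
      exact le_iSup₂_of_le (f := fun (i : ℤ × ℤ) (_ : i ∈ {i : ℤ × ℤ | i.1 < p}) => I i.1 i.2)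
        (r, s) (by simp only [Set.mem_ofPred_eq]; omega) le_rfl
  · rw [hI.hodge_eq]
    refine hI.internal.submodule_iSupIndep.disjoint_biSup_biSup ?_
    rw [Set.disjoint_left]
    intro i hi hi'
    simp only [Set.mem_ofPred_eq] at hi hi'
    omega

end AnyBigrading

/-- `deligneI` is an arbitrary choice with a default value; the explicit bigrading shows that the
default does not occur. -/
theorem deligneU_eq_biSup
    (h : IsMixedHodge (conjC M) (fun k => (W k).baseChange ℂ) F) :
    ∃ I : ℤ → ℤ → Submodule ℂ (ℂ ⊗[ℚ] M), IsDeligneBigrading W F I ∧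
      ∀ p, deligneU W F p = ⨆ i ∈ {i : ℤ × ℤ | i.1 = p}, I i.1 i.2 := by
  have hex : ∃ I, IsDeligneBigrading W F I := ⟨_, h.isDeligneBigrading⟩
  refine ⟨deligneI W F, ?_, fun p => ?_⟩
  · rw [deligneI, dif_pos hex]
    exact hex.choose_spec
  · rw [deligneU]
    apply le_antisymm
    · exact iSup_le fun q => le_iSup₂_of_le
        (f := fun (i : ℤ × ℤ) (_ : i ∈ {i : ℤ × ℤ | i.1 = p}) => deligneI W F i.1 i.2)
        (p, q) rfl le_rfl
    · refine iSup₂_le fun i hi => ?_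
      rw [Set.mem_ofPred_eq] at hi
      exact le_iSup_of_le i.2 (hi ▸ le_rfl)

/-- `U^p = F^p ∩ G_p`. -/
theorem deligneU_eq_inf
    (h : IsMixedHodge (conjC M) (fun k => (W k).baseChange ℂ) F) (p : ℤ) :
    deligneU W F p = F p ⊓ oppFil (conjC M) (fun k => (W k).baseChange ℂ) F p := by
  obtain ⟨I, hI, hU⟩ := deligneU_eq_biSup h
  have := hI.oppFil_eq h (p + 1)
  rw [add_sub_cancel_right] at this
  have hset : {i : ℤ × ℤ | p ≤ i.1} ∩ {i : ℤ × ℤ | i.1 < p + 1} = {i : ℤ × ℤ | i.1 = p} := by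
    ext i
    simp only [Set.mem_inter_iff, Set.mem_ofPred_eq]
    omega
  rw [hU, this, hI.hodge_eq, hI.biSup_inf_biSup, hset]

theorem isCompl_deligneU
    (h : IsMixedHodge (conjC M) (fun k => (W k).baseChange ℂ) F) (p : ℤ) :
    IsCompl (deligneU W F p) (⨆ (r : ℤ) (_ : r ≠ p), deligneU W F r) ∧
      F (p + 1) ≤ (⨆ (r : ℤ) (_ : r ≠ p), deligneU W F r) ∧
      oppFil (conjC M) (fun k => (W k).baseChange ℂ) F (p - 1) ≤
        ⨆ (r : ℤ) (_ : r ≠ p), deligneU W F r := by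
  obtain ⟨I, hI, hU⟩ := deligneU_eq_biSup h
  have hne : (⨆ (r : ℤ) (_ : r ≠ p), deligneU W F r) =
      ⨆ i ∈ {i : ℤ × ℤ | i.1 ≠ p}, I i.1 i.2 := by
    apply le_antisymm
    · refine iSup₂_le fun r hr => ?_
      rw [hU]
      refine biSup_mono fun i hi => ?_
      rw [Set.mem_ofPred_eq] at hi ⊢
      exact hi ▸ hr
    · refine iSup₂_le fun i hi => le_iSup₂_of_le i.1 hi ?_
      rw [hU]
      exact le_iSup₂_of_le (f := fun (j : ℤ × ℤ) (_ : j ∈ {j : ℤ × ℤ | j.1 = i.1}) => I j.1 j.2)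
        i rfl le_rfl
  rw [hne]
  refine ⟨⟨?_, ?_⟩, ?_, ?_⟩
  · rw [hU]
    refine hI.internal.submodule_iSupIndep.disjoint_biSup_biSup ?_
    rw [Set.disjoint_left]
    exact fun i hi hi' => hi' hi
  · rw [hU, codisjoint_iff, ← iSup_union, eq_top_iff, ← hI.internal.submodule_iSup_eq_top]
    exact iSup_le fun i => le_iSup₂_of_le
      (f := fun (i : ℤ × ℤ) (_ : i ∈ {i : ℤ × ℤ | i.1 = p} ∪ {i : ℤ × ℤ | i.1 ≠ p}) => I i.1 i.2)
      i (em _) le_rfl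
  · rw [hI.hodge_eq]
    refine biSup_mono fun i hi => ?_
    rw [Set.mem_ofPred_eq] at hi ⊢
    omega
  · rw [hI.oppFil_eq h]
    refine biSup_mono fun i hi => ?_
    rw [Set.mem_ofPred_eq] at hi ⊢
    omega

/-- The projection onto `U^p` is the difference of the projections onto `F^p` along `G_{p-1}` and
onto `F^{p+1}` along `G_p`. -/
theorem gradedProj_deligneU
    (h : IsMixedHodge (conjC M) (fun k => (W k).baseChange ℂ) F) (p : ℤ) {v f f' : ℂ ⊗[ℚ] M}
    (hf : f ∈ F p) (hvf : v - f ∈ oppFil (conjC M) (fun k => (W k).baseChange ℂ) F (p - 1))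
    (hf' : f' ∈ F (p + 1)) (hvf' : v - f' ∈ oppFil (conjC M) (fun k => (W k).baseChange ℂ) F p) :
    gradedProj (deligneU W F) p v = f - f' := by
  obtain ⟨hc, h1, h2⟩ := isCompl_deligneU h p
  rw [gradedProj, dif_pos hc]
  change (deligneU W F p).projection _ hc v = f - f'
  have hmem : f - f' ∈ deligneU W F p := by
    rw [deligneU_eq_inf h]
    refine ⟨Submodule.sub_mem _ hf (h.hodge_anti (by omega) hf'), ?_⟩
    have := Submodule.sub_mem _ hvf' (h.oppFil_mono (by omega : p - 1 ≤ p) hvf)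
    simpa using this
  have hv : v = (f - f') + (f' + (v - f)) := by abel
  rw [hv, map_add, Submodule.projection_apply_of_mem_left hc hmem,
    Submodule.projection_apply_of_mem_right hc (Submodule.add_mem _ (h1 hf') (h2 hvf)), add_zero]
end Rational

/-! ### Transport of structure, and subspaces with the same graded pieces -/

section Perturbation

variable {V V' : Type*} [AddCommGroup V] [Module ℂ V] [AddCommGroup V'] [Module ℂ V']

theorem map_inf_equiv (e : V ≃ₗ[ℂ] V') (A B : Submodule ℂ V) :
    (A ⊓ B).map e.toLinearMap = A.map e.toLinearMap ⊓ B.map e.toLinearMap :=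
  Submodule.map_inf _ e.injective

theorem oppFil_map (e : V ≃ₗ[ℂ] V') {c : V →ₛₗ[starRingEnd ℂ] V} {c' : V' →ₛₗ[starRingEnd ℂ] V'}
    (hc : ∀ v, c' (e v) = e (c v)) (W F : ℤ → Submodule ℂ V) (p : ℤ) :
    oppFil c' (fun k => (W k).map e.toLinearMap) (fun r => (F r).map e.toLinearMap) p =
      (oppFil c W F p).map e.toLinearMap := by
  rw [oppFil, oppFil, Submodule.map_iSup]
  refine iSup_congr fun q => ?_
  rw [← map_inf_equiv]
  ext v
  constructor
  · rintro ⟨_, ⟨w, hw, rfl⟩, rfl⟩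
    exact ⟨c w, ⟨w, hw, rfl⟩, (hc w).symm⟩
  · rintro ⟨_, ⟨w, hw, rfl⟩, rfl⟩
    exact ⟨e w, ⟨w, hw, rfl⟩, hc w⟩

theorem mem_map_equiv_iff (e : V ≃ₗ[ℂ] V') (A : Submodule ℂ V) (v : V) :
    e v ∈ A.map e.toLinearMap ↔ v ∈ A :=
  ⟨fun ⟨_, hw, hwv⟩ => e.injective hwv ▸ hw, fun hv => ⟨v, hv, rfl⟩⟩

theorem IsMixedHodge.map (e : V ≃ₗ[ℂ] V') {c : V →ₛₗ[starRingEnd ℂ] V}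
    {c' : V' →ₛₗ[starRingEnd ℂ] V'} (hc : ∀ v, c' (e v) = e (c v)) {W F : ℤ → Submodule ℂ V}
    (h : IsMixedHodge c W F) :
    IsMixedHodge c' (fun k => (W k).map e.toLinearMap) (fun r => (F r).map e.toLinearMap) where
  conj_conj v := by
    obtain ⟨v, rfl⟩ := e.surjective v
    rw [hc, hc, h.conj_conj]
  weight_mono _ _ hkl := Submodule.map_mono (h.weight_mono hkl)
  weight_bot := h.weight_bot.imp fun k hk => by simp [hk]
  weight_top := h.weight_top.imp fun k hk => by simp [hk]
  conj_mem k v hv := by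
    obtain ⟨v, hv, rfl⟩ := hv
    exact ⟨c v, h.conj_mem _ _ hv, (hc v).symm⟩
  hodge_anti _ _ hkl := Submodule.map_mono (h.hodge_anti hkl)
  hodge_bot := h.hodge_bot.imp fun k hk => by simp [hk]
  hodge_top := h.hodge_top.imp fun k hk => by simp [hk]
  graded_sup k p v hv := by
    obtain ⟨v, hv, rfl⟩ := hv
    obtain ⟨f, hf, g, hg, hs⟩ := h.graded_sup k p v hv
    refine ⟨e f, ⟨⟨f, hf.1, rfl⟩, ⟨f, hf.2, rfl⟩⟩, e g, ⟨⟨g, hg.1, rfl⟩, ⟨g, hg.2, rfl⟩⟩, ?_⟩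
    rw [hc]
    exact ⟨_, hs, by simp⟩
  graded_inf k p f hf g hg hs := by
    rw [← map_inf_equiv] at hf hg
    obtain ⟨f, hf, rfl⟩ := hf
    obtain ⟨g, hg, rfl⟩ := hg
    refine ⟨f, h.graded_inf k p f hf g hg ?_, rfl⟩
    rw [← mem_map_equiv_iff e, map_sub, ← hc]
    exact hs

variable {W : ℤ → Submodule ℂ V} {F F' B : Submodule ℂ V}

/-- A vector `v` of `F' ∩ B ∩ W_k` is some `f ∈ F` up to an error in `W_{k-1}`. Splitting the error
as `f₁ + b` gives `f + f₁ = v - b ∈ F ∩ B = 0`, so `v = b` has dropped to `W_{k-1}`. -/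
theorem disjoint_of_graded_eq (hWb : ∃ k₀, ∀ k ≤ k₀, W k = ⊥) (hWt : ∃ k, W k = ⊤)
    (hFB : Disjoint F B) (hdec : ∀ k, W k ≤ (F ⊓ W k) ⊔ (B ⊓ W k))
    (h : ∀ k, ∀ f' ∈ F' ⊓ W k, ∃ f ∈ F ⊓ W k, f' - f ∈ W (k - 1)) : Disjoint F' B := by
  rw [Submodule.disjoint_def]
  intro v hF hB
  obtain ⟨k₀, hk₀⟩ := hWb
  obtain ⟨m, hm⟩ := hWt
  have key : ∀ k, v ∈ W k → v = 0 := by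
    refine int_induction_of_le k₀ (fun k hk hv => ?_) fun k ih hv => ih ?_
    · simpa [hk₀ k hk] using hv
    · obtain ⟨f, hf, hw⟩ := h k v ⟨hF, hv⟩
      obtain ⟨f₁, hf₁, b, hb, hs⟩ := Submodule.mem_sup.1 (hdec _ hw)
      have h0 : f + f₁ = 0 := by
        refine Submodule.disjoint_def.1 hFB _ (Submodule.add_mem _ hf.1 hf₁.1) ?_
        have : f + f₁ = v - b := by
          rw [eq_sub_iff_add_eq, add_assoc, hs]
          abel
        rw [this]
        exact Submodule.sub_mem _ hB hb.1
      have : v = b := by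
        have h1 : v = (f + f₁) + b := by
          rw [add_assoc, hs]
          abel
        rwa [h0, zero_add] at h1
      exact this ▸ hb.2
  exact key m (hm ▸ Submodule.mem_top)

/-- Replacing the `F`-component by an element of `F'` costs an error in `W_{k-1}`, which is
decomposed along `F'` and `B` by induction. Recording both components shows that the two projections
along `B` agree on `Gr^W`. -/
theorem exists_decomposition_of_graded_eq (hWb : ∃ k₀, ∀ k ≤ k₀, W k = ⊥) (hWm : Monotone W)
    (hdec : ∀ k, W k ≤ (F ⊓ W k) ⊔ (B ⊓ W k))
    (h : ∀ k, ∀ f ∈ F ⊓ W k, ∃ f' ∈ F' ⊓ W k, f - f' ∈ W (k - 1)) (k : ℤ) :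
    ∀ w ∈ W k, ∃ f ∈ F ⊓ W k, ∃ f' ∈ F' ⊓ W k, w - f ∈ B ∧ w - f' ∈ B ∧ f - f' ∈ W (k - 1) := by
  obtain ⟨k₀, hk₀⟩ := hWb
  induction k using int_induction_of_le k₀ with
  | h₀ k hk =>
    intro w hw
    rw [hk₀ k hk, Submodule.mem_bot] at hw
    subst hw
    exact ⟨0, Submodule.zero_mem _, 0, Submodule.zero_mem _, by simp⟩
  | h k ih =>
    intro w hw
    obtain ⟨f, hf, b, hb, rfl⟩ := Submodule.mem_sup.1 (hdec k hw)
    obtain ⟨f', hf', hd⟩ := h k f hf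
    obtain ⟨-, -, g', hg', -, hgB, -⟩ := ih _ hd
    refine ⟨f, hf, f' + g', Submodule.add_mem _ hf' ⟨hg'.1, hWm (by omega) hg'.2⟩, ?_, ?_, ?_⟩
    · simpa using hb.1
    · have := Submodule.add_mem _ hb.1 hgB
      convert this using 1
      abel
    · have := Submodule.sub_mem _ hd hg'.2
      convert this using 1
      abel

end Perturbation

/-! ### Derivatives and fixed subspaces; holomorphy of projections -/

section Calculus

variable {E N : Type*} [NormedAddCommGroup E] [NormedSpace ℂ E]
  [NormedAddCommGroup N] [NormedSpace ℂ N] [FiniteDimensional ℂ N]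

/-- It turns membership in a fixed subspace into the vanishing of a linear map, to which derivatives
apply. -/
theorem exists_clm_eq_zero_iff_mem (M : Submodule ℂ N) :
    ∃ ℓ : N →L[ℂ] N, ∀ v, ℓ v = 0 ↔ v ∈ M := by
  obtain ⟨C, hC⟩ := M.exists_isCompl
  exact ⟨LinearMap.toContinuousLinearMap (C.projection M hC.symm), fun v =>
    Submodule.projection_apply_eq_zero_iff hC.symm⟩

theorem fderiv_mem_of_sub_mem {f : E → N} {z : E} (M : Submodule ℂ N) (hf : DifferentiableAt ℂ f z)
    (h : ∀ᶠ y in 𝓝 z, f y - f z ∈ M) (v : E) : fderiv ℂ f z v ∈ M := by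
  obtain ⟨ℓ, hℓ⟩ := exists_clm_eq_zero_iff_mem M
  have h1 : (fun y => ℓ (f y)) =ᶠ[𝓝 z] fun _ => ℓ (f z) := by
    filter_upwards [h] with y hy
    rwa [← sub_eq_zero, ← map_sub, hℓ]
  have h2 : HasFDerivAt (fun y => ℓ (f y)) (ℓ ∘L fderiv ℂ f z) z :=
    ℓ.hasFDerivAt.comp z hf.hasFDerivAt
  have h3 := h1.fderiv_eq (𝕜 := ℂ)
  rw [h2.fderiv, fderiv_fun_const] at h3
  rw [← hℓ]
  exact congrArg (fun L => L v) h3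

theorem sub_mem_of_fderiv_mem {f : E → N} {Ω : Set E} (hΩ : IsOpen Ω) (hc : IsPreconnected Ω)
    (M : Submodule ℂ N) (hf : ∀ y ∈ Ω, DifferentiableAt ℂ f y)
    (h : ∀ y ∈ Ω, ∀ v, fderiv ℂ f y v ∈ M) {z z' : E} (hz : z ∈ Ω) (hz' : z' ∈ Ω) :
    f z - f z' ∈ M := by
  obtain ⟨ℓ, hℓ⟩ := exists_clm_eq_zero_iff_mem M
  have h1 : ∀ y ∈ Ω, HasFDerivAt (fun y => ℓ (f y)) (ℓ ∘L fderiv ℂ f y) y := fun y hy =>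
    ℓ.hasFDerivAt.comp y (hf y hy).hasFDerivAt
  have h2 := hΩ.is_const_of_fderiv_eq_zero (𝕜 := ℂ) hc
    (fun y hy => (h1 y hy).differentiableAt.differentiableWithinAt)
    (fun y hy => by
      rw [(h1 y hy).fderiv]
      ext v
      exact (hℓ _).2 (h y hy v)) hz hz'
  rw [← hℓ, map_sub, h2, sub_self]

/-- The projection onto a holomorphically varying subspace along a fixed one is holomorphic. -/
theorem contDiffAt_projection {m : ℕ} {f : Fin m → E → N} {K : E → Submodule ℂ N}
    {B : Submodule ℂ N} {P : E → N →L[ℂ] N} {z : E}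
    (h : ∀ᶠ y in 𝓝 z, (∀ i, ContDiffAt ℂ ω (f i) y) ∧ LinearIndependent ℂ (fun i => f i y) ∧
      Submodule.span ℂ (Set.range fun i => f i y) = K y)
    (hP : ∀ᶠ y in 𝓝 z, Disjoint (K y) B ∧ ∀ w, P y w ∈ K y ∧ w - P y w ∈ B) :
    ContDiffAt ℂ ω P z := by
  -- `A y` assembles the moving frame of `K y` with the fixed space `B`. It is holomorphic in `y`
  -- and invertible, and the projection is the identity minus the `B`-component of its inverse.
  let A : E → ((Fin m → ℂ) × B) →L[ℂ] N := fun y =>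
    (∑ i, ((ContinuousLinearMap.proj (R := ℂ) (φ := fun _ : Fin m => ℂ) i).comp
      (ContinuousLinearMap.fst ℂ (Fin m → ℂ) B)).smulRight (f i y)) +
      B.subtypeL.comp (ContinuousLinearMap.snd ℂ (Fin m → ℂ) B)
  have hA : ∀ y x, A y x = (∑ i, x.1 i • f i y) + x.2 := fun y x => by
    simp [A, sum_apply]
  have hAc : ContDiffAt ℂ ω A z := by
    refine ContDiffAt.add (ContDiffAt.sum fun i _ => ?_) contDiffAt_const
    exact contDiffAt_const.smulRight (h.self_of_nhds.1 i)
  have hmain : ∀ᶠ y in 𝓝 z, (A y).IsInvertible ∧ P y = ContinuousLinearMap.id ℂ N -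
      (B.subtypeL.comp (ContinuousLinearMap.snd ℂ (Fin m → ℂ) B)).comp (A y).inverse := by
    filter_upwards [h, hP] with y hy₁ hy₂
    obtain ⟨-, hli, hsp⟩ := hy₁
    obtain ⟨hd, hPy⟩ := hy₂
    have hK : ∀ a : Fin m → ℂ, ∑ i, a i • f i y ∈ K y := fun a => by
      rw [← hsp]
      exact (Submodule.mem_span_range_iff_exists_fun ℂ).2 ⟨a, rfl⟩
    have hinj : Function.Injective (A y) := by
      rw [injective_iff_map_eq_zero]
      rintro ⟨a, b⟩ hab
      rw [hA] at hab
      have h1 : ∑ i, a i • f i y = 0 := by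
        refine Submodule.disjoint_def.1 hd _ (hK a) ?_
        rw [eq_neg_of_add_eq_zero_left hab]
        exact B.neg_mem b.2
      have h2 := Fintype.linearIndependent_iff.1 hli a h1
      simp only [h1, zero_add] at hab
      exact Prod.ext (funext h2) (Subtype.ext hab)
    have hsol : ∀ w, ∃ x, A y x = w ∧ (x.2 : N) = w - P y w := fun w => by
      obtain ⟨a, ha⟩ := (Submodule.mem_span_range_iff_exists_fun ℂ).1 (hsp ▸ (hPy w).1)
      refine ⟨(a, ⟨_, (hPy w).2⟩), ?_, rfl⟩
      rw [hA, ha]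
      simp
    have hsurj : Function.Surjective (A y) := fun w => (hsol w).imp fun x hx => hx.1
    let e : ((Fin m → ℂ) × B) ≃L[ℂ] N :=
      (LinearEquiv.ofBijective (A y).toLinearMap ⟨hinj, hsurj⟩).toContinuousLinearEquiv
    have he : (e : ((Fin m → ℂ) × B) →L[ℂ] N) = A y := by
      ext x <;> rfl
    refine ⟨⟨e, he⟩, ?_⟩
    ext w
    obtain ⟨x, hx, hx2⟩ := hsol w
    have hinv : (A y).inverse w = x := by
      rw [← he, ContinuousLinearMap.inverse_equiv]
      exact (e.symm_apply_eq).2 hx.symm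
    simp [hinv, hx2]
  refine ContDiffAt.congr_of_eventuallyEq ?_ (hmain.mono fun y hy => hy.2)
  refine contDiffAt_const.sub (contDiffAt_const.clm_comp ?_)
  exact (ContinuousLinearMap.IsInvertible.contDiffAt_map_inverse hmain.self_of_nhds.1).comp z hAc

end Calculus

/-! ### Unipotent variations in a flat frame over a convex open set -/

section LocalModel

variable {E N : Type*} [NormedAddCommGroup E] [NormedSpace ℂ E]
  [NormedAddCommGroup N] [NormedSpace ℂ N] [FiniteDimensional ℂ N]

/-- A unipotent variation of mixed Hodge structure on a convex open subset `Ω` of a vector space,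
written in a flat frame: the weight filtration `W` and the conjugation `c` are constant. -/
structure IsLocalVariation (Ω : Set E) (c : N →ₛₗ[starRingEnd ℂ] N) (W : ℤ → Submodule ℂ N)
    (K : ℤ → E → Submodule ℂ N) : Prop where
  isOpen : IsOpen Ω
  convex : Convex ℝ Ω
  mixedHodge : ∀ z ∈ Ω, IsMixedHodge c W fun p => K p z
  graded_eq : ∀ z ∈ Ω, ∀ z' ∈ Ω, ∀ p k, ∀ f ∈ K p z ⊓ W k, ∃ f' ∈ K p z' ⊓ W k, f - f' ∈ W (k - 1)
  exists_frame : ∀ p, ∀ z ∈ Ω, ∃ (m : ℕ) (f : Fin m → E → N), ∀ᶠ y in 𝓝 z,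
    (∀ i, ContDiffAt ℂ ω (f i) y) ∧ LinearIndependent ℂ (fun i => f i y) ∧
      Submodule.span ℂ (Set.range fun i => f i y) = K p y
  horizontal : ∀ p, ∀ z ∈ Ω, ∀ f : E → N, (∀ᶠ y in 𝓝 z, ContDiffAt ℂ ω f y ∧ f y ∈ K p y) →
    ∀ v, fderiv ℂ f z v ∈ K (p - 1) z

open Classical in
/-- The projection onto `K p z` along the term of index `p - 1` of the filtration opposed to
`K · z₀`. -/
def hodgeProj (c : N →ₛₗ[starRingEnd ℂ] N) (W : ℤ → Submodule ℂ N) (K : ℤ → E → Submodule ℂ N)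
    (z₀ : E) (p : ℤ) (z : E) : N →L[ℂ] N :=
  if h : IsCompl (K p z) (oppFil c W (fun r => K r z₀) (p - 1)) then
    LinearMap.toContinuousLinearMap ((K p z).projection _ h) else 0

/-- The projection onto the summand of index `p` of the grading by the `𝓤^p`. -/
def summandProj (c : N →ₛₗ[starRingEnd ℂ] N) (W : ℤ → Submodule ℂ N) (K : ℤ → E → Submodule ℂ N)
    (z₀ : E) (p : ℤ) (z : E) : N →L[ℂ] N :=
  hodgeProj c W K z₀ p z - hodgeProj c W K z₀ (p + 1) z

/-- The sum `∑_{a < p ≤ b}` of the projections onto the steps of the Hodge filtration. Up to an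
additive constant it is the endomorphism with eigenvalue `p` on `𝓤^p`. -/
def gradingOp (c : N →ₛₗ[starRingEnd ℂ] N) (W : ℤ → Submodule ℂ N) (K : ℤ → E → Submodule ℂ N)
    (z₀ : E) (a b : ℤ) (z : E) : N →L[ℂ] N :=
  ∑ p ∈ Finset.Ioc a b, hodgeProj c W K z₀ p z

namespace IsLocalVariation

variable {Ω : Set E} {c : N →ₛₗ[starRingEnd ℂ] N} {W : ℤ → Submodule ℂ N}
  {K : ℤ → E → Submodule ℂ N} (h : IsLocalVariation Ω c W K) {z₀ : E} (hz₀ : z₀ ∈ Ω)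

include h hz₀

theorem exists_decomposition {z : E} (hz : z ∈ Ω) (p k : ℤ) (w : N) (hw : w ∈ W k) :
    ∃ f ∈ K p z₀ ⊓ W k, ∃ f' ∈ K p z ⊓ W k,
      w - f ∈ oppFil c W (fun r => K r z₀) (p - 1) ∧
      w - f' ∈ oppFil c W (fun r => K r z₀) (p - 1) ∧ f - f' ∈ W (k - 1) :=
  exists_decomposition_of_graded_eq (h.mixedHodge z₀ hz₀).weight_eq_bot_of_le
    (h.mixedHodge z₀ hz₀).weight_mono ((h.mixedHodge z₀ hz₀).weight_le p)
    (h.graded_eq z₀ hz₀ z hz p) k w hw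

/-- The space `G_{p-1}` is taken at the base point, before it is known to be flat. It remains
complementary to `F^p` at `z` because `F^p` has the same graded pieces at both points. -/
theorem isCompl_base {z : E} (hz : z ∈ Ω) (p : ℤ) :
    IsCompl (K p z) (oppFil c W (fun r => K r z₀) (p - 1)) := by
  have h₀ := h.mixedHodge z₀ hz₀
  refine ⟨disjoint_of_graded_eq h₀.weight_eq_bot_of_le h₀.weight_top (h₀.disjoint_oppFil p)
    (h₀.weight_le p) (h.graded_eq z hz z₀ hz₀ p), codisjoint_iff.2 (eq_top_iff.2 fun w _ => ?_)⟩
  obtain ⟨m, hm⟩ := h₀.weight_top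
  obtain ⟨-, -, f', hf', -, hB, -⟩ :=
    h.exists_decomposition hz₀ hz p m w (hm ▸ Submodule.mem_top)
  exact Submodule.mem_sup.2 ⟨f', hf'.1, _, hB, by abel⟩

theorem hodgeProj_eq {z : E} (hz : z ∈ Ω) (p : ℤ) {w f : N} (hf : f ∈ K p z)
    (hwf : w - f ∈ oppFil c W (fun r => K r z₀) (p - 1)) : hodgeProj c W K z₀ p z w = f := by
  have hc := h.isCompl_base hz₀ hz p
  rw [hodgeProj, dif_pos hc]
  change (K p z).projection _ hc w = f
  have hw : w = f + (w - f) := by abel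
  rw [hw, map_add, Submodule.projection_apply_of_mem_left hc hf,
    Submodule.projection_apply_of_mem_right hc hwf, add_zero]

theorem hodgeProj_spec {z : E} (hz : z ∈ Ω) (p : ℤ) (w : N) :
    hodgeProj c W K z₀ p z w ∈ K p z ∧
      w - hodgeProj c W K z₀ p z w ∈ oppFil c W (fun r => K r z₀) (p - 1) := by
  have hc := h.isCompl_base hz₀ hz p
  rw [hodgeProj, dif_pos hc]
  exact ⟨Submodule.projection_apply_mem hc w, Submodule.sub_projection_mem hc w⟩

theorem hodgeProj_of_mem {z : E} (hz : z ∈ Ω) {p : ℤ} {w : N} (hw : w ∈ K p z) :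
    hodgeProj c W K z₀ p z w = w :=
  h.hodgeProj_eq hz₀ hz p hw (by simp)

theorem hodgeProj_of_mem_oppFil {z : E} (hz : z ∈ Ω) {p : ℤ} {w : N}
    (hw : w ∈ oppFil c W (fun r => K r z₀) (p - 1)) : hodgeProj c W K z₀ p z w = 0 :=
  h.hodgeProj_eq hz₀ hz p (Submodule.zero_mem _) (by simpa using hw)

theorem hodgeProj_mem_weight {z : E} (hz : z ∈ Ω) (p k : ℤ) {w : N} (hw : w ∈ W k) :
    hodgeProj c W K z₀ p z w ∈ W k := by
  obtain ⟨-, -, f', hf', -, hB, -⟩ := h.exists_decomposition hz₀ hz p k w hw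
  rw [h.hodgeProj_eq hz₀ hz p hf'.1 hB]
  exact hf'.2

/-- On `Gr^W` the Hodge filtration does not move, so all the projections induce the same map there.
-/
theorem hodgeProj_sub_mem_weight {z z' : E} (hz : z ∈ Ω) (hz' : z' ∈ Ω) (p k : ℤ) {w : N}
    (hw : w ∈ W k) :
    hodgeProj c W K z₀ p z w - hodgeProj c W K z₀ p z' w ∈ W (k - 1) := by
  have key : ∀ y ∈ Ω, hodgeProj c W K z₀ p z₀ w - hodgeProj c W K z₀ p y w ∈ W (k - 1) := by
    intro y hy
    obtain ⟨f, hf, f', hf', hA, hB, hd⟩ := h.exists_decomposition hz₀ hy p k w hw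
    rwa [h.hodgeProj_eq hz₀ hy p hf'.1 hB, h.hodgeProj_eq hz₀ hz₀ p hf.1 hA]
  have := Submodule.sub_mem _ (key z' hz') (key z hz)
  simpa using this

theorem contDiffAt_hodgeProj {z : E} (hz : z ∈ Ω) (p : ℤ) :
    ContDiffAt ℂ ω (hodgeProj c W K z₀ p) z := by
  obtain ⟨m, f, hf⟩ := h.exists_frame p z hz
  refine contDiffAt_projection hf ?_ (B := oppFil c W (fun r => K r z₀) (p - 1))
  filter_upwards [h.isOpen.mem_nhds hz] with y hy
  exact ⟨(h.isCompl_base hz₀ hy p).disjoint, h.hodgeProj_spec hz₀ hy p⟩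

theorem differentiableAt_hodgeProj {z : E} (hz : z ∈ Ω) (p : ℤ) :
    DifferentiableAt ℂ (hodgeProj c W K z₀ p) z :=
  (h.contDiffAt_hodgeProj hz₀ hz p).differentiableAt (by simp)

theorem fderiv_hodgeProj_apply {z : E} (hz : z ∈ Ω) (p : ℤ) (v : E) (w : N) :
    fderiv ℂ (fun y => hodgeProj c W K z₀ p y w) z v = fderiv ℂ (hodgeProj c W K z₀ p) z v w := by
  have := (h.differentiableAt_hodgeProj hz₀ hz p).hasFDerivAt.clm_apply (hasFDerivAt_const w z)
  rw [this.fderiv]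
  simp

/-- For a constant vector `w`, the function `y ↦ P_p(y) w` is a holomorphic section of `F^p`, to
which horizontality applies. -/
theorem fderiv_hodgeProj_mem_hodge {z : E} (hz : z ∈ Ω) (p : ℤ) (v : E) (w : N) :
    fderiv ℂ (hodgeProj c W K z₀ p) z v w ∈ K (p - 1) z := by
  rw [← h.fderiv_hodgeProj_apply hz₀ hz]
  refine h.horizontal p z hz _ ?_ v
  filter_upwards [h.isOpen.mem_nhds hz] with y hy
  exact ⟨(h.contDiffAt_hodgeProj hz₀ hy p).clm_apply contDiffAt_const,
    (h.hodgeProj_spec hz₀ hy p w).1⟩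

theorem fderiv_hodgeProj_mem_weight {z : E} (hz : z ∈ Ω) (p k : ℤ) (v : E) {w : N} (hw : w ∈ W k) :
    fderiv ℂ (hodgeProj c W K z₀ p) z v w ∈ W (k - 1) := by
  rw [← h.fderiv_hodgeProj_apply hz₀ hz]
  refine fderiv_mem_of_sub_mem _
    ((h.differentiableAt_hodgeProj hz₀ hz p).clm_apply (differentiableAt_const w)) ?_ v
  filter_upwards [h.isOpen.mem_nhds hz] with y hy
  exact h.hodgeProj_sub_mem_weight hz₀ hy hz p k hw

omit hz₀ in
-- These truncated sums are conjugate to those of `oppTrunc`. For `w` in the term of index `q` at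
-- `z`, the derivative of `y ↦ P_q(y) w` lies in the term of index `q - 1` and weight one less,
-- which by induction lies in a subspace independent of `y`. So `P_q(y) w` is constant modulo that
-- subspace.
theorem trunc_le (p k : ℤ) : ∀ z ∈ Ω, ∀ z' ∈ Ω,
    (⨆ (q : ℤ) (_ : p + q ≤ k), K q z ⊓ W (p + q)) ≤
      ⨆ (q : ℤ) (_ : p + q ≤ k), K q z' ⊓ W (p + q) := by
  rcases Ω.eq_empty_or_nonempty with rfl | ⟨z₀, hz₀⟩
  · simp
  obtain ⟨k₀, hk₀⟩ := (h.mixedHodge z₀ hz₀).weight_eq_bot_of_le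
  induction k using int_induction_of_le k₀ with
  | h₀ k hk =>
    intro z hz z' hz'
    refine iSup₂_le fun q hq => ?_
    simp [hk₀ (p + q) (by omega)]
  | h k ih =>
    intro z hz z' hz'
    have hmono : ∀ y, (⨆ (q : ℤ) (_ : p + q ≤ k - 1), K q y ⊓ W (p + q)) ≤
        ⨆ (q : ℤ) (_ : p + q ≤ k), K q y ⊓ W (p + q) := fun y =>
      iSup_mono fun q => iSup_mono' fun hq => ⟨by omega, le_rfl⟩
    refine iSup₂_le fun q hq => ?_
    rcases hq.lt_or_eq with hq | hq
    · exact (le_iSup₂_of_le (f := fun q (_ : p + q ≤ k - 1) => K q z ⊓ W (p + q)) q (by omega)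
        le_rfl).trans ((ih z hz z' hz').trans (hmono z'))
    · intro w hw
      -- The base point of the projections is `z` itself, so that `P_q(z)` fixes `w`.
      have h1 : hodgeProj c W K z q z w - hodgeProj c W K z q z' w ∈
          ⨆ (q : ℤ) (_ : p + q ≤ k - 1), K q z' ⊓ W (p + q) := by
        refine sub_mem_of_fderiv_mem h.isOpen h.convex.isPreconnected _
          (f := fun y => hodgeProj c W K z q y w) (fun y hy =>
          (h.differentiableAt_hodgeProj hz hy q).clm_apply (differentiableAt_const w))
          (fun y hy v => ih y hy z' hz' ?_) hz hz'
        rw [h.fderiv_hodgeProj_apply hz hy]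
        refine (le_iSup₂_of_le (f := fun q (_ : p + q ≤ k - 1) => K q y ⊓ W (p + q)) (q - 1)
          (by omega) le_rfl) ⟨h.fderiv_hodgeProj_mem_hodge hz hy q v w, ?_⟩
        rw [show p + (q - 1) = p + q - 1 by ring]
        exact h.fderiv_hodgeProj_mem_weight hz hy q _ v hw.2
      rw [h.hodgeProj_of_mem hz hz hw.1] at h1
      have h2 : hodgeProj c W K z q z' w ∈
          ⨆ (q : ℤ) (_ : p + q ≤ k), K q z' ⊓ W (p + q) :=
        (le_iSup₂_of_le (f := fun q (_ : p + q ≤ k) => K q z' ⊓ W (p + q)) q hq.le le_rfl)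
          ⟨(h.hodgeProj_spec hz hz' q w).1, h.hodgeProj_mem_weight hz hz' q _ hw.2⟩
      have := Submodule.add_mem _ (hmono z' h1) h2
      simpa using this

omit hz₀ in
/-- The filtration opposed to the Hodge filtration is flat. -/
theorem oppFil_eq {z z' : E} (hz : z ∈ Ω) (hz' : z' ∈ Ω) (p : ℤ) :
    oppFil c W (fun r => K r z) p = oppFil c W (fun r => K r z') p := by
  have key : ∀ z ∈ Ω, ∀ z' ∈ Ω,
      oppFil c W (fun r => K r z) p ≤ oppFil c W (fun r => K r z') p := by
    intro z hz z' hz'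
    rw [oppFil, oppFil, ← Submodule.map_iSup, ← Submodule.map_iSup]
    refine Submodule.map_mono (iSup_le fun q => ?_)
    refine (le_iSup₂_of_le (f := fun r (_ : p + r ≤ p + q) => K r z ⊓ W (p + r)) q le_rfl
      le_rfl).trans ((h.trunc_le p (p + q) z hz z' hz').trans ?_)
    exact iSup_mono fun r => iSup_le fun _ => le_rfl
  exact le_antisymm (key z hz z' hz') (key z' hz' z hz)

/-! #### Products of the projections and of their derivatives -/

/-- The kernel of `P_r(z)` does not depend on `z` and contains the values of `1 - P_p(z')`. Allowing
two different points permits differentiating in one of them. -/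
theorem hodgeProj_mul_of_le {z z' : E} (hz : z ∈ Ω) (hz' : z' ∈ Ω) {p r : ℤ} (hpr : p ≤ r) :
    hodgeProj c W K z₀ r z * hodgeProj c W K z₀ p z' = hodgeProj c W K z₀ r z := by
  ext w
  have h1 := h.hodgeProj_of_mem_oppFil hz₀ hz (p := r) ((h.mixedHodge z₀ hz₀).oppFil_mono
    (by omega : p - 1 ≤ r - 1) (h.hodgeProj_spec hz₀ hz' p w).2)
  rw [map_sub, sub_eq_zero] at h1
  exact h1.symm

theorem hodgeProj_mul_of_ge {z : E} (hz : z ∈ Ω) {p r : ℤ} (hpr : p ≤ r) :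
    hodgeProj c W K z₀ p z * hodgeProj c W K z₀ r z = hodgeProj c W K z₀ r z := by
  ext w
  exact h.hodgeProj_of_mem hz₀ hz ((h.mixedHodge z hz).hodge_anti hpr
    (h.hodgeProj_spec hz₀ hz r w).1)

/-- For `r ≤ p` one differentiates `P_p P_r(z) = P_p` with the second factor frozen. For `r > p` one
differentiates `P_p P_r = P_r`; by horizontality `dP_r` has values in `F^{r-1} ⊆ F^p`, which `P_p`
fixes, and so `dP_p P_r = 0`. -/
theorem fderiv_hodgeProj_mul {z : E} (hz : z ∈ Ω) (v : E) (p r : ℤ) :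
    fderiv ℂ (hodgeProj c W K z₀ p) z v * hodgeProj c W K z₀ r z =
      if r ≤ p then fderiv ℂ (hodgeProj c W K z₀ p) z v else 0 := by
  have hmem := h.isOpen.mem_nhds hz
  split_ifs with hrp
  · have h1 := (h.differentiableAt_hodgeProj hz₀ hz p).hasFDerivAt.mul_const'
      (hodgeProj c W K z₀ r z)
    have h2 : (fun y => hodgeProj c W K z₀ p y * hodgeProj c W K z₀ r z) =ᶠ[𝓝 z]
        hodgeProj c W K z₀ p := by
      filter_upwards [hmem] with y hy using h.hodgeProj_mul_of_le hz₀ hy hz hrp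
    have h3 := h2.fderiv_eq (𝕜 := ℂ)
    rw [h1.fderiv] at h3
    exact congrArg (fun L => L v) h3
  · have h1 := (h.differentiableAt_hodgeProj hz₀ hz p).hasFDerivAt.mul'
      (h.differentiableAt_hodgeProj hz₀ hz r).hasFDerivAt
    have h2 : hodgeProj c W K z₀ p * hodgeProj c W K z₀ r =ᶠ[𝓝 z] hodgeProj c W K z₀ r := by
      filter_upwards [hmem] with y hy using h.hodgeProj_mul_of_ge hz₀ hy (by omega)
    have h3 := h2.fderiv_eq (𝕜 := ℂ)
    rw [h1.fderiv] at h3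
    have h4 : hodgeProj c W K z₀ p z * fderiv ℂ (hodgeProj c W K z₀ r) z v +
        fderiv ℂ (hodgeProj c W K z₀ p) z v * hodgeProj c W K z₀ r z =
        fderiv ℂ (hodgeProj c W K z₀ r) z v := congrArg (fun L => L v) h3
    have h5 : hodgeProj c W K z₀ p z * fderiv ℂ (hodgeProj c W K z₀ r) z v =
        fderiv ℂ (hodgeProj c W K z₀ r) z v := by
      ext w
      exact h.hodgeProj_of_mem hz₀ hz ((h.mixedHodge z hz).hodge_anti (by omega : p ≤ r - 1)
        (h.fderiv_hodgeProj_mem_hodge hz₀ hz r v w))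
    rw [h5] at h4
    simpa using h4

theorem hodgeProj_mul_fderiv {z : E} (hz : z ∈ Ω) (v : E) (p r : ℤ) :
    hodgeProj c W K z₀ r z * fderiv ℂ (hodgeProj c W K z₀ p) z v =
      if r < p then fderiv ℂ (hodgeProj c W K z₀ p) z v else 0 := by
  split_ifs with hrp
  · ext w
    exact h.hodgeProj_of_mem hz₀ hz ((h.mixedHodge z hz).hodge_anti (by omega : r ≤ p - 1)
      (h.fderiv_hodgeProj_mem_hodge hz₀ hz p v w))
  · have h1 := (h.differentiableAt_hodgeProj hz₀ hz p).hasFDerivAt.const_mul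
      (hodgeProj c W K z₀ r z)
    have h2 : (fun y => hodgeProj c W K z₀ r z * hodgeProj c W K z₀ p y) =ᶠ[𝓝 z]
        fun _ => hodgeProj c W K z₀ r z := by
      filter_upwards [h.isOpen.mem_nhds hz] with y hy
      exact h.hodgeProj_mul_of_le hz₀ hz hy (by omega)
    have h3 := h2.fderiv_eq (𝕜 := ℂ)
    rw [h1.fderiv, fderiv_fun_const] at h3
    exact congrArg (fun L => L v) h3

theorem summandProj_mul {z : E} (hz : z ∈ Ω) (p q : ℤ) :
    summandProj c W K z₀ p z * summandProj c W K z₀ q z =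
      if p = q then summandProj c W K z₀ p z else 0 := by
  rw [summandProj, summandProj, sub_mul, mul_sub, mul_sub]
  rcases lt_trichotomy p q with hpq | rfl | hpq
  · rw [h.hodgeProj_mul_of_ge hz₀ hz (by omega : p ≤ q),
      h.hodgeProj_mul_of_ge hz₀ hz (by omega : p ≤ q + 1),
      h.hodgeProj_mul_of_ge hz₀ hz (by omega : p + 1 ≤ q),
      h.hodgeProj_mul_of_ge hz₀ hz (by omega : p + 1 ≤ q + 1), if_neg hpq.ne, sub_self]
  · rw [h.hodgeProj_mul_of_ge hz₀ hz le_rfl, h.hodgeProj_mul_of_ge hz₀ hz (by omega : p ≤ p + 1),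
      h.hodgeProj_mul_of_le hz₀ hz hz (by omega : p ≤ p + 1),
      h.hodgeProj_mul_of_ge hz₀ hz le_rfl, if_pos rfl]
    abel
  · rw [h.hodgeProj_mul_of_le hz₀ hz hz (by omega : q ≤ p),
      h.hodgeProj_mul_of_le hz₀ hz hz (by omega : q + 1 ≤ p),
      h.hodgeProj_mul_of_le hz₀ hz hz (by omega : q ≤ p + 1),
      h.hodgeProj_mul_of_le hz₀ hz hz (by omega : q + 1 ≤ p + 1), if_neg hpq.ne', sub_self,
      sub_self, sub_self]

/-- Where `F^p` is everything or zero at the base point, `G_{p-1}` is zero or everything. As this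
kernel is constant, the bounds hold on all of `Ω`. -/
theorem exists_bounds : ∃ a b : ℤ, ∀ a' ≤ a, ∀ b' ≥ b, a' ≤ b' ∧ ∀ z ∈ Ω,
    (∀ p ≤ a', hodgeProj c W K z₀ p z = 1) ∧ (∀ p > b', hodgeProj c W K z₀ p z = 0) := by
  have h₀ := h.mixedHodge z₀ hz₀
  obtain ⟨a, ha⟩ := h₀.hodge_top
  obtain ⟨b, hb⟩ := h₀.hodge_bot
  refine ⟨min a b, b, fun a' ha' b' hb' => ⟨by omega, fun z hz => ⟨fun p hp => ?_, fun p hp => ?_⟩⟩⟩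
  · have h1 : K p z₀ = ⊤ := eq_top_iff.2 (ha ▸ h₀.hodge_anti (by omega : p ≤ a))
    have h2 : oppFil c W (fun r => K r z₀) (p - 1) = ⊥ := by
      have := h₀.disjoint_oppFil p
      rwa [h1, disjoint_comm, disjoint_top] at this
    ext w
    have := (h.hodgeProj_spec hz₀ hz p w).2
    rw [h2, Submodule.mem_bot, sub_eq_zero] at this
    exact this.symm
  · have h1 : K p z₀ = ⊥ := eq_bot_iff.2 (hb ▸ h₀.hodge_anti (by omega : b ≤ p))
    have h2 : oppFil c W (fun r => K r z₀) (p - 1) = ⊤ := by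
      have := (h₀.isCompl_oppFil p).codisjoint
      rwa [h1, codisjoint_comm, codisjoint_bot] at this
    ext w
    exact h.hodgeProj_of_mem_oppFil hz₀ hz (h2 ▸ Submodule.mem_top)

end IsLocalVariation

end LocalModel

/-! ### The grading operator as a primitive of the Higgs field -/

section LocalModel

variable {E N : Type*} [NormedAddCommGroup E] [NormedSpace ℂ E]
  [NormedAddCommGroup N] [NormedSpace ℂ N] [FiniteDimensional ℂ N]

namespace IsLocalVariation

variable {Ω : Set E} {c : N →ₛₗ[starRingEnd ℂ] N} {W : ℤ → Submodule ℂ N}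
  {K : ℤ → E → Submodule ℂ N} (h : IsLocalVariation Ω c W K) {z₀ : E} (hz₀ : z₀ ∈ Ω)

include h hz₀

theorem contDiffAt_summandProj {z : E} (hz : z ∈ Ω) (p : ℤ) :
    ContDiffAt ℂ ω (summandProj c W K z₀ p) z :=
  (h.contDiffAt_hodgeProj hz₀ hz p).sub (h.contDiffAt_hodgeProj hz₀ hz (p + 1))

theorem contDiffAt_gradingOp (a b : ℤ) {z : E} (hz : z ∈ Ω) :
    ContDiffAt ℂ ω (gradingOp c W K z₀ a b) z :=
  ContDiffAt.sum fun p _ => h.contDiffAt_hodgeProj hz₀ hz p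

theorem fderiv_gradingOp (a b : ℤ) {z : E} (hz : z ∈ Ω) (v : E) :
    fderiv ℂ (gradingOp c W K z₀ a b) z v =
      ∑ p ∈ Finset.Ioc a b, fderiv ℂ (hodgeProj c W K z₀ p) z v := by
  have : HasFDerivAt (gradingOp c W K z₀ a b)
      (∑ p ∈ Finset.Ioc a b, fderiv ℂ (hodgeProj c W K z₀ p) z) z :=
    HasFDerivAt.fun_sum fun p _ => (h.differentiableAt_hodgeProj hz₀ hz p).hasFDerivAt
  rw [this.fderiv, sum_apply]

theorem fderiv_gradingOp_mem_weight (a b k : ℤ) {z : E} (hz : z ∈ Ω) (v : E) {w : N}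
    (hw : w ∈ W k) : fderiv ℂ (gradingOp c W K z₀ a b) z v w ∈ W (k - 1) := by
  rw [h.fderiv_gradingOp hz₀ a b hz, sum_apply]
  exact Submodule.sum_mem _ fun p _ => h.fderiv_hodgeProj_mem_weight hz₀ hz p k v hw

/-- Both sides keep exactly the terms with `r < p`, that is `r + 1 ≤ p`. In terms of summands, `dY`
lowers the degree by one. -/
theorem hodgeProj_mul_fderiv_gradingOp (a b : ℤ) {z : E} (hz : z ∈ Ω) (v : E) (r : ℤ) :
    hodgeProj c W K z₀ r z * fderiv ℂ (gradingOp c W K z₀ a b) z v =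
      fderiv ℂ (gradingOp c W K z₀ a b) z v * hodgeProj c W K z₀ (r + 1) z := by
  rw [h.fderiv_gradingOp hz₀ a b hz, Finset.mul_sum, Finset.sum_mul]
  refine Finset.sum_congr rfl fun p _ => ?_
  rw [h.hodgeProj_mul_fderiv hz₀ hz, h.fderiv_hodgeProj_mul hz₀ hz]
  rfl

theorem summandProj_mul_fderiv_gradingOp (a b : ℤ) {z : E} (hz : z ∈ Ω) (v : E) (p : ℤ) :
    summandProj c W K z₀ p z * fderiv ℂ (gradingOp c W K z₀ a b) z v =
      fderiv ℂ (gradingOp c W K z₀ a b) z v * summandProj c W K z₀ (p + 1) z := by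
  rw [summandProj, summandProj, sub_mul, mul_sub, h.hodgeProj_mul_fderiv_gradingOp hz₀ a b hz,
    h.hodgeProj_mul_fderiv_gradingOp hz₀ a b hz]

variable {a b : ℤ} (hb : ∀ z ∈ Ω, (∀ p ≤ a, hodgeProj c W K z₀ p z = 1) ∧
  (∀ p > b, hodgeProj c W K z₀ p z = 0))

include hb

theorem fderiv_hodgeProj_eq_zero {z : E} (hz : z ∈ Ω) {p : ℤ} (hp : p ∉ Finset.Ioc a b) :
    fderiv ℂ (hodgeProj c W K z₀ p) z = 0 := by
  have hmem := h.isOpen.mem_nhds hz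
  rw [Finset.mem_Ioc, not_and_or, not_lt, not_le] at hp
  rcases hp with hp | hp
  · have : hodgeProj c W K z₀ p =ᶠ[𝓝 z] fun _ => 1 := by
      filter_upwards [hmem] with y hy using (hb y hy).1 p hp
    rw [this.fderiv_eq (𝕜 := ℂ), fderiv_fun_const]
    rfl
  · have : hodgeProj c W K z₀ p =ᶠ[𝓝 z] fun _ => 0 := by
      filter_upwards [hmem] with y hy using (hb y hy).2 p hp
    rw [this.fderiv_eq (𝕜 := ℂ), fderiv_fun_const]
    rfl

/-- Only the term `p = r` of `dY = ∑ dP_p` fails to commute with `P_r`, and it satisfies `[dP_r,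
P_r] = dP_r`. For `r` outside `(a, b]` no such term occurs, but `P_r` is then constant. -/
theorem commutator_hodgeProj {z : E} (hz : z ∈ Ω) (v : E) (r : ℤ) :
    fderiv ℂ (gradingOp c W K z₀ a b) z v * hodgeProj c W K z₀ r z -
      hodgeProj c W K z₀ r z * fderiv ℂ (gradingOp c W K z₀ a b) z v =
      fderiv ℂ (hodgeProj c W K z₀ r) z v := by
  have h1 : ∀ p, fderiv ℂ (hodgeProj c W K z₀ p) z v * hodgeProj c W K z₀ r z -
      hodgeProj c W K z₀ r z * fderiv ℂ (hodgeProj c W K z₀ p) z v =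
      if p = r then fderiv ℂ (hodgeProj c W K z₀ r) z v else 0 := by
    intro p
    rw [h.hodgeProj_mul_fderiv hz₀ hz, h.fderiv_hodgeProj_mul hz₀ hz]
    rcases lt_trichotomy p r with hp | rfl | hp
    · rw [if_neg (by omega), if_neg (by omega), if_neg (by omega), sub_self]
    · simp
    · rw [if_pos (by omega), if_pos (by omega), if_neg (by omega), sub_self]
  rw [h.fderiv_gradingOp hz₀ a b hz, Finset.mul_sum, Finset.sum_mul, ← Finset.sum_sub_distrib,
    Finset.sum_congr rfl fun p _ => h1 p, Finset.sum_ite_eq']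
  split_ifs with hr
  · rfl
  · rw [h.fderiv_hodgeProj_eq_zero hz₀ hb hz hr]
    rfl

theorem commutator_gradingOp {z : E} (hz : z ∈ Ω) (v : E) :
    fderiv ℂ (gradingOp c W K z₀ a b) z v * gradingOp c W K z₀ a b z -
      gradingOp c W K z₀ a b z * fderiv ℂ (gradingOp c W K z₀ a b) z v =
      fderiv ℂ (gradingOp c W K z₀ a b) z v := by
  conv_rhs => rw [h.fderiv_gradingOp hz₀ a b hz]
  conv_lhs => rw [gradingOp, Finset.mul_sum, Finset.sum_mul, ← Finset.sum_sub_distrib]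
  exact Finset.sum_congr rfl fun p _ => h.commutator_hodgeProj hz₀ hb hz v p

theorem fderiv_summandProj {z : E} (hz : z ∈ Ω) (v : E) (p : ℤ) :
    fderiv ℂ (summandProj c W K z₀ p) z v =
      fderiv ℂ (gradingOp c W K z₀ a b) z v * summandProj c W K z₀ p z -
        summandProj c W K z₀ p z * fderiv ℂ (gradingOp c W K z₀ a b) z v := by
  have h1 : HasFDerivAt (summandProj c W K z₀ p) _ z :=
    (h.differentiableAt_hodgeProj hz₀ hz p).hasFDerivAt.sub
      (h.differentiableAt_hodgeProj hz₀ hz (p + 1)).hasFDerivAt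
  rw [h1.fderiv, summandProj, sub_apply,
    ← h.commutator_hodgeProj hz₀ hb hz v, ← h.commutator_hodgeProj hz₀ hb hz v, mul_sub, sub_mul]
  abel

/-- The Higgs field has square zero: its values commute. -/
theorem fderiv_gradingOp_commute {z : E} (hz : z ∈ Ω) (v w : E) :
    fderiv ℂ (gradingOp c W K z₀ a b) z v * fderiv ℂ (gradingOp c W K z₀ a b) z w =
      fderiv ℂ (gradingOp c W K z₀ a b) z w * fderiv ℂ (gradingOp c W K z₀ a b) z v := by
  set f := gradingOp c W K z₀ a b with hf
  have hc := h.contDiffAt_gradingOp hz₀ a b hz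
  have hd : HasFDerivAt f (fderiv ℂ f z) z := (hc.differentiableAt (by simp)).hasFDerivAt
  have hd2 : ∀ w, HasFDerivAt (fun y => fderiv ℂ f y w) ((fderiv ℂ (fderiv ℂ f) z).flip w) z := by
    intro w
    have h1 : DifferentiableAt ℂ (fderiv ℂ f) z :=
      (hc.fderiv_right (m := ω) (by simp)).differentiableAt (by simp)
    refine (h1.hasFDerivAt.clm_apply (hasFDerivAt_const w z)).congr_fderiv ?_
    ext v
    simp
  -- This is `[dY(w), Y] = dY(w)` differentiated in the direction `v`.
  have key : ∀ v w, fderiv ℂ f z w * fderiv ℂ f z v + fderiv ℂ (fderiv ℂ f) z v w * f z -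
      (f z * fderiv ℂ (fderiv ℂ f) z v w + fderiv ℂ f z v * fderiv ℂ f z w) =
      fderiv ℂ (fderiv ℂ f) z v w := by
    intro v w
    have h1 := ((hd2 w).mul' hd).sub (hd.mul' (hd2 w))
    have h2 : (fun y => fderiv ℂ f y w) * f - f * (fun y => fderiv ℂ f y w) =ᶠ[𝓝 z]
        fun y => fderiv ℂ f y w := by
      filter_upwards [h.isOpen.mem_nhds hz] with y hy
      exact h.commutator_gradingOp hz₀ hb hy w
    have h3 := h2.fderiv_eq (𝕜 := ℂ)
    rw [h1.fderiv, (hd2 w).fderiv] at h3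
    exact congrArg (fun L => L v) h3
  have hsymm : fderiv ℂ (fderiv ℂ f) z v w = fderiv ℂ (fderiv ℂ f) z w v :=
    (hc.isSymmSndFDerivAt (by simp)) v w
  have h1 := key v w
  have h2 := key w v
  rw [← hsymm] at h2
  have h4 := sub_eq_zero.2 (h2.trans h1.symm)
  -- Exchanging `v` and `w` and subtracting, the second derivatives cancel by symmetry and twice the
  -- commutator remains.
  have h3 : (2 : ℂ) • (fderiv ℂ f z v * fderiv ℂ f z w - fderiv ℂ f z w * fderiv ℂ f z v) = 0 := by
    rw [two_smul, ← h4]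
    abel
  exact sub_eq_zero.1 ((smul_eq_zero.1 h3).resolve_left two_ne_zero)

omit h hz₀ in
theorem summandProj_eq_zero {z : E} (hz : z ∈ Ω) {p : ℤ} (hp : p ∉ Finset.Icc a b) :
    summandProj c W K z₀ p z = 0 := by
  rw [Finset.mem_Icc, not_and_or, not_le, not_le] at hp
  rcases hp with hp | hp
  · rw [summandProj, (hb z hz).1 p (by omega), (hb z hz).1 (p + 1) (by omega), sub_self]
  · rw [summandProj, (hb z hz).2 p (by omega), (hb z hz).2 (p + 1) (by omega), sub_self]

omit h hz₀ in
theorem sum_summandProj (hab : a ≤ b) {z : E} (hz : z ∈ Ω) :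
    ∑ p ∈ Finset.Icc a b, summandProj c W K z₀ p z = 1 := by
  -- The sum telescopes to `P_a - P_{b+1}`, and the bounds give `1 - 0`.
  have key : ∀ n : ℕ, ∑ p ∈ Finset.Icc a (a + n), summandProj c W K z₀ p z =
      hodgeProj c W K z₀ a z - hodgeProj c W K z₀ (a + n + 1) z := by
    intro n
    induction n with
    | zero => simp [summandProj]
    | succ n ih =>
      have : Finset.Icc a (a + (n + 1 : ℕ)) =
          insert (a + (n : ℤ) + 1) (Finset.Icc a (a + n)) := by
        ext p
        simp only [Finset.mem_Icc, Finset.mem_insert]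
        omega
      rw [this, Finset.sum_insert (by simp), ih, summandProj, Nat.cast_succ, ← add_assoc]
      abel
  obtain ⟨n, rfl⟩ := Int.le.dest hab
  rw [key, (hb z hz).1 a le_rfl, (hb z hz).2 _ (by omega), sub_zero]

/-- On `𝓤^q` the projection `P_r` is the identity for `r ≤ q` and zero for `r > q`; the eigenvalue
counts the `r` with `a < r ≤ q`. -/
theorem summandProj_mul_gradingOp {z : E} (hz : z ∈ Ω) {q : ℤ} (hq : q ∈ Finset.Icc a b) :
    summandProj c W K z₀ q z * gradingOp c W K z₀ a b z =
      ((q - a : ℤ) : ℂ) • summandProj c W K z₀ q z ∧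
    gradingOp c W K z₀ a b z * summandProj c W K z₀ q z =
      ((q - a : ℤ) : ℂ) • summandProj c W K z₀ q z := by
  have h1 : ∀ r, summandProj c W K z₀ q z * hodgeProj c W K z₀ r z =
      if r ≤ q then summandProj c W K z₀ q z else 0 := by
    intro r
    rw [summandProj, sub_mul]
    split_ifs with hr
    · rw [h.hodgeProj_mul_of_le hz₀ hz hz hr, h.hodgeProj_mul_of_le hz₀ hz hz (by omega)]
    · rw [h.hodgeProj_mul_of_ge hz₀ hz (by omega), h.hodgeProj_mul_of_ge hz₀ hz (by omega),
        sub_self]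
  have h2 : ∀ r, hodgeProj c W K z₀ r z * summandProj c W K z₀ q z =
      if r ≤ q then summandProj c W K z₀ q z else 0 := by
    intro r
    rw [summandProj, mul_sub]
    split_ifs with hr
    · rw [h.hodgeProj_mul_of_ge hz₀ hz hr, h.hodgeProj_mul_of_ge hz₀ hz (by omega)]
    · rw [h.hodgeProj_mul_of_le hz₀ hz hz (by omega), h.hodgeProj_mul_of_le hz₀ hz hz (by omega),
        sub_self]
  have h3 : ∑ r ∈ Finset.Ioc a b, (if r ≤ q then summandProj c W K z₀ q z else 0) =
      ((q - a : ℤ) : ℂ) • summandProj c W K z₀ q z := by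
    rw [Finset.mem_Icc] at hq
    have hset : (Finset.Ioc a b).filter (· ≤ q) = Finset.Ioc a q := by
      ext r
      simp only [Finset.mem_filter, Finset.mem_Ioc]
      omega
    rw [← Finset.sum_filter, Finset.sum_const, hset, Int.card_Ioc, ← Nat.cast_smul_eq_nsmul ℂ]
    congr 1
    rw [← Int.cast_natCast, Int.toNat_of_nonneg (by omega)]
  rw [gradingOp, Finset.mul_sum, Finset.sum_mul, ← h3]
  exact ⟨Finset.sum_congr rfl fun r _ => h1 r, Finset.sum_congr rfl fun r _ => h2 r⟩

/-- A flat map which is compatible with the Higgs fields of two local variations, and with the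
gradings at one point, is compatible with the Hodge filtrations. -/
theorem map_mem_hodge_of_commute {N' : Type*} [NormedAddCommGroup N'] [NormedSpace ℂ N']
    [FiniteDimensional ℂ N'] {c' : N' →ₛₗ[starRingEnd ℂ] N'} {W' : ℤ → Submodule ℂ N'}
    {K' : ℤ → E → Submodule ℂ N'} (h' : IsLocalVariation Ω c' W' K') {z₀' : E} (hz₀' : z₀' ∈ Ω)
    (hab : a ≤ b)
    (hb' : ∀ z ∈ Ω, (∀ p ≤ a, hodgeProj c' W' K' z₀' p z = 1) ∧
      (∀ p > b, hodgeProj c' W' K' z₀' p z = 0))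
    (C : N →L[ℂ] N')
    (hC : ∀ z ∈ Ω, ∀ v w, fderiv ℂ (gradingOp c' W' K' z₀' a b) z v (C w) =
      C (fderiv ℂ (gradingOp c W K z₀ a b) z v w))
    {z₁ : E} (hz₁ : z₁ ∈ Ω)
    (h₁ : ∀ p w, hodgeProj c' W' K' z₀' p z₁ (C w) = C (hodgeProj c W K z₀ p z₁ w))
    {z : E} (hz : z ∈ Ω) (p : ℤ) {w : N} (hw : w ∈ K p z) : C w ∈ K' p z := by
  -- The difference has zero derivative, because `C` intertwines the Higgs fields, and it vanishes
  -- at `z₁`.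
  have hcomm : ∀ w, gradingOp c' W' K' z₀' a b z (C w) = C (gradingOp c W K z₀ a b z w) := by
    intro w
    have hd : ∀ y ∈ Ω, HasFDerivAt
        (fun y => gradingOp c' W' K' z₀' a b y (C w) - C (gradingOp c W K z₀ a b y w))
        ((fderiv ℂ (gradingOp c' W' K' z₀' a b) y).flip (C w) -
          C ∘L (fderiv ℂ (gradingOp c W K z₀ a b) y).flip w) y := by
      intro y hy
      have h1 := ((h.contDiffAt_gradingOp hz₀ a b hy).differentiableAt (by simp)).hasFDerivAt
      have h2 := ((h'.contDiffAt_gradingOp hz₀' a b hy).differentiableAt (by simp)).hasFDerivAt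
      have h3 := (h2.clm_apply (hasFDerivAt_const (C w) y)).sub
        (C.hasFDerivAt.comp y (h1.clm_apply (hasFDerivAt_const w y)))
      refine h3.congr_fderiv ?_
      ext v
      simp
    have h1 := sub_mem_of_fderiv_mem h.isOpen h.convex.isPreconnected ⊥
      (fun y hy => (hd y hy).differentiableAt) (fun y hy v => by
        rw [(hd y hy).fderiv, Submodule.mem_bot]
        simp [hC y hy v w]) hz hz₁
    have h2 : gradingOp c' W' K' z₀' a b z₁ (C w) = C (gradingOp c W K z₀ a b z₁ w) := by
      simp only [gradingOp, sum_apply, map_sum, h₁]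
    rw [Submodule.mem_bot, h2, sub_self, sub_zero, sub_eq_zero] at h1
    exact h1
  -- The vector in question is an eigenvector of `Y'` with eigenvalue `r - a`, so it has no
  -- component in degree `q ≠ r`.
  have horth : ∀ q ∈ Finset.Icc a b, ∀ r ∈ Finset.Icc a b, q ≠ r →
      summandProj c' W' K' z₀' q z (C (summandProj c W K z₀ r z w)) = 0 := by
    intro q hq r hr hqr
    have h1 := congrArg (fun L => L (C (summandProj c W K z₀ r z w)))
      (h'.summandProj_mul_gradingOp hz₀' hb' hz hq).1
    have h2 := congrArg (fun L => L w) (h.summandProj_mul_gradingOp hz₀ hb hz hr).2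
    simp only [mul_apply_eq_comp, smul_apply] at h1 h2
    rw [hcomm, h2, map_smul, map_smul] at h1
    by_contra hne
    have := smul_left_injective ℂ hne h1
    have := Int.cast_injective (α := ℂ) this
    omega
  have hone : ∀ w', w' = ∑ q ∈ Finset.Icc a b, summandProj c' W' K' z₀' q z w' := by
    intro w'
    have := congrArg (fun L => L w') (sum_summandProj (c := c') (W := W') hb' hab hz)
    simp only [sum_apply] at this
    exact this.symm
  have hone' : w = ∑ q ∈ Finset.Icc a b, summandProj c W K z₀ q z w := by
    have := congrArg (fun L => L w) (sum_summandProj (c := c) (W := W) hb hab hz)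
    simp only [sum_apply] at this
    exact this.symm
  rw [hone (C w)]
  refine Submodule.sum_mem _ fun q hq => ?_
  have h1 : summandProj c' W' K' z₀' q z (C w) =
      summandProj c' W' K' z₀' q z (C (summandProj c W K z₀ q z w)) := by
    conv_lhs => rw [hone', map_sum, map_sum]
    rw [Finset.sum_eq_single q (fun r hr hrq => horth q hq r hr (Ne.symm hrq))
      (fun hq' => absurd hq hq')]
  rw [h1]
  -- As `w ∈ F^p`, its components of degree below `p` vanish; those of degree `q ≥ p` go to degree
  -- `q`, which lies in `F^p`.
  rcases lt_or_ge q p with hqp | hqp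
  · have h2 : summandProj c W K z₀ q z w = 0 := by
      rw [summandProj, sub_apply,
        h.hodgeProj_of_mem hz₀ hz ((h.mixedHodge z hz).hodge_anti hqp.le hw),
        h.hodgeProj_of_mem hz₀ hz ((h.mixedHodge z hz).hodge_anti (by omega : q + 1 ≤ p) hw),
        sub_self]
    rw [h2, map_zero, map_zero]
    exact Submodule.zero_mem _
  · refine (h'.mixedHodge z hz).hodge_anti hqp ?_
    rw [summandProj, sub_apply]
    exact Submodule.sub_mem _ (h'.hodgeProj_spec hz₀' hz q _).1
      ((h'.mixedHodge z hz).hodge_anti (by omega : q ≤ q + 1)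
        (h'.hodgeProj_spec hz₀' hz (q + 1) _).1)

end IsLocalVariation

end LocalModel

/-! ### Charts of a complex manifold -/

section Charts

variable {E : Type*} [NormedAddCommGroup E] [NormedSpace ℂ E]
  {S : Type u} [TopologicalSpace S] [ChartedSpace E S]

/-- The derivative at `s` of the chart at `x`. -/
def chartDeriv (E : Type*) [NormedAddCommGroup E] [NormedSpace ℂ E] {S : Type u}
    [TopologicalSpace S] [ChartedSpace E S] (x s : S) : E →L[ℝ] E :=
  mfderiv 𝓘(ℝ, E) 𝓘(ℝ, E) (extChartAt 𝓘(ℝ, E) x) s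

theorem contMDiffAt_iff_contDiffAt_chart {𝕜 : Type*} [NontriviallyNormedField 𝕜]
    {E F : Type*} [NormedAddCommGroup E] [NormedSpace 𝕜 E] [NormedAddCommGroup F] [NormedSpace 𝕜 F]
    {S : Type*} [TopologicalSpace S] [ChartedSpace E S] {n : ℕ∞ω} [IsManifold 𝓘(𝕜, E) n S]
    {f : S → F} {x s : S} (hs : s ∈ (chartAt E x).source) :
    ContMDiffAt 𝓘(𝕜, E) 𝓘(𝕜, F) n f s ↔
      ContDiffAt 𝕜 n (fun z => f ((chartAt E x).symm z)) (chartAt E x s) := by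
  rw [contMDiffAt_iff_source_of_mem_source hs, contMDiffWithinAt_iff_contDiffWithinAt]
  simp only [modelWithCornersSelf_coe, Set.range_id, contDiffWithinAt_univ]
  rfl

theorem contDiffAt_congr_iff {𝕜 : Type*} [NontriviallyNormedField 𝕜]
    {E F : Type*} [NormedAddCommGroup E] [NormedSpace 𝕜 E] [NormedAddCommGroup F] [NormedSpace 𝕜 F]
    {n : ℕ∞ω} {f g : E → F} {z : E} (h : f =ᶠ[𝓝 z] g) :
    ContDiffAt 𝕜 n f z ↔ ContDiffAt 𝕜 n g z :=
  ⟨fun hf => hf.congr_of_eventuallyEq h.symm, fun hg => hg.congr_of_eventuallyEq h⟩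

variable [IsManifold 𝓘(ℂ, E) ω S]

theorem hasMFDerivAt_chart {x s : S} (hs : s ∈ (chartAt E x).source) :
    HasMFDerivAt 𝓘(ℝ, E) 𝓘(ℝ, E) (chartAt E x) s (chartDeriv E x s) :=
  (mdifferentiableAt_extChartAt (I := 𝓘(ℝ, E)) hs).hasMFDerivAt

theorem chartDeriv_I_smul {x s : S} (hs : s ∈ (chartAt E x).source) (v : E) :
    chartDeriv E x s (Complex.I • v) = Complex.I • chartDeriv E x s v := by
  have : IsManifold 𝓘(ℂ, E) 1 S := IsManifold.of_le (n := ω) le_top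
  have h1 : HasMFDerivAt 𝓘(ℂ, E) 𝓘(ℂ, E) (chartAt E x) s
      (mfderiv 𝓘(ℂ, E) 𝓘(ℂ, E) (chartAt E x) s) :=
    (mdifferentiableAt_extChartAt (I := 𝓘(ℂ, E)) hs).hasMFDerivAt
  let T : E →L[ℂ] E := mfderiv 𝓘(ℂ, E) 𝓘(ℂ, E) (chartAt E x) s
  have h2 : HasMFDerivAt 𝓘(ℝ, E) 𝓘(ℝ, E) (chartAt E x) s (T.restrictScalars ℝ) :=
    ⟨h1.1, h1.2.restrictScalars ℝ⟩
  have h3 : chartDeriv E x s = T.restrictScalars ℝ := h2.mfderiv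
  rw [h3]
  exact T.map_smul Complex.I v

theorem chartDeriv_isInvertible {x s : S} (hs : s ∈ (chartAt E x).source) :
    (chartDeriv E x s).IsInvertible :=
  isInvertible_mfderiv_extChartAt (I := 𝓘(ℝ, E)) (by rwa [extChartAt_source])

theorem chartDeriv_surjective {x s : S} (hs : s ∈ (chartAt E x).source) :
    Function.Surjective (chartDeriv E x s) := by
  obtain ⟨e, he⟩ := chartDeriv_isInvertible (E := E) hs
  rw [← he]
  exact e.surjective

/-- A vector field in the chart at `x`. -/
def fieldRep (x : S) (X : ∀ s : S, TangentSpace 𝓘(ℝ, E) s) (z : E) : E :=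
  chartDeriv E x ((chartAt E x).symm z) (X ((chartAt E x).symm z))

theorem contDiffAt_fieldRep {x : S} {X : ∀ s : S, TangentSpace 𝓘(ℝ, E) s}
    (hX : RatLocalSystem.SmoothFieldAt X x) :
    ContDiffAt ℝ ∞ (fieldRep x X) (chartAt E x x) := by
  rw [RatLocalSystem.SmoothFieldAt, Bundle.contMDiffAt_section,
    contMDiffAt_iff_contDiffAt_chart (mem_chart_source E x)] at hX
  refine hX.congr_of_eventuallyEq ?_
  have h1 : ∀ᶠ z in 𝓝 (chartAt E x x), z ∈ (chartAt E x).target :=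
    (chartAt E x).open_target.mem_nhds (mem_chart_target E x)
  filter_upwards [h1] with z hz
  have hs := (chartAt E x).map_target hz
  have h2 := TangentBundle.continuousLinearMapAt_trivializationAt (I := 𝓘(ℝ, E)) hs
  have h3 := congrArg (fun T => T (X ((chartAt E x).symm z))) h2
  refine Eq.trans h3.symm ?_
  exact Bundle.Trivialization.continuousLinearMapAt_apply_of_mem (R := ℝ) _ (by simpa using hs) _

/-- The bracket on the manifold is defined by pulling both fields back along the inverse chart, and
near the base point these pullbacks are the fields `fieldRep`. -/
theorem chartDeriv_mlieBracket [CompleteSpace E] {x : S} (X Y : ∀ s : S, TangentSpace 𝓘(ℝ, E) s) :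
    chartDeriv E x x (VectorField.mlieBracket 𝓘(ℝ, E) X Y x) =
      fderiv ℝ (fieldRep x Y) (chartAt E x x) (fieldRep x X (chartAt E x x)) -
        fderiv ℝ (fieldRep x X) (chartAt E x x) (fieldRep x Y (chartAt E x x)) := by
  have hrep : ∀ X : ∀ s : S, TangentSpace 𝓘(ℝ, E) s,
      VectorField.mpullbackWithin 𝓘(ℝ, E) 𝓘(ℝ, E) (extChartAt 𝓘(ℝ, E) x).symm X
        (Set.range 𝓘(ℝ, E)) =ᶠ[𝓝 (chartAt E x x)] fieldRep x X := by
    intro X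
    have h1 : ∀ᶠ z in 𝓝 (chartAt E x x), z ∈ (extChartAt 𝓘(ℝ, E) x).target :=
      extChartAt_target_mem_nhds (I := 𝓘(ℝ, E)) x
    filter_upwards [h1] with z hz
    have hs : (extChartAt 𝓘(ℝ, E) x).symm z ∈ (chartAt E x).source := by
      simpa using (extChartAt 𝓘(ℝ, E) x).map_target hz
    have hinv := isInvertible_mfderivWithin_extChartAt_symm hz
    rw [VectorField.mpullbackWithin_apply]
    have h2 := mfderivWithin_extChartAt_symm_comp_mfderiv_extChartAt' (I := 𝓘(ℝ, E))
      ((extChartAt 𝓘(ℝ, E) x).map_target hz)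
    rw [(extChartAt 𝓘(ℝ, E) x).right_inv hz] at h2
    refine hinv.inverse_apply_eq.2 ?_
    exact (congrArg (fun T => T (X ((extChartAt 𝓘(ℝ, E) x).symm z))) h2).symm
  let X' : E → E := VectorField.mpullbackWithin 𝓘(ℝ, E) 𝓘(ℝ, E) (extChartAt 𝓘(ℝ, E) x).symm X
    (Set.range 𝓘(ℝ, E))
  let Y' : E → E := VectorField.mpullbackWithin 𝓘(ℝ, E) 𝓘(ℝ, E) (extChartAt 𝓘(ℝ, E) x).symm Y
    (Set.range 𝓘(ℝ, E))
  have hX : X' =ᶠ[𝓝 (chartAt E x x)] fieldRep x X := hrep X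
  have hY : Y' =ᶠ[𝓝 (chartAt E x x)] fieldRep x Y := hrep Y
  have hb : VectorField.mlieBracket 𝓘(ℝ, E) X Y x = (chartDeriv E x x).inverse
      (fderiv ℝ Y' (chartAt E x x) (X' (chartAt E x x)) -
        fderiv ℝ X' (chartAt E x x) (Y' (chartAt E x x))) := by
    rw [VectorField.mlieBracket, VectorField.mlieBracketWithin_apply]
    have h1 : ((extChartAt 𝓘(ℝ, E) x).symm ⁻¹' Set.univ ∩ Set.range 𝓘(ℝ, E)) = Set.univ := by
      simp
    rw [h1]
    change (chartDeriv E x x).inverse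
      (VectorField.lieBracketWithin ℝ X' Y' Set.univ (chartAt E x x)) = _
    rw [VectorField.lieBracketWithin_univ]
    rfl
  rw [hb]
  obtain ⟨e, he⟩ := chartDeriv_isInvertible (E := E) (mem_chart_source E x)
  rw [← he, ContinuousLinearMap.inverse_equiv]
  refine (e.apply_symm_apply _).trans ?_
  rw [hX.fderiv_eq, hY.fderiv_eq, hX.self_of_nhds, hY.self_of_nhds]

end Charts

/-! ### Sections and the Gauss–Manin connection in a flat frame -/

namespace RatLocalSystem

section Frames

variable {S : Type u} [TopologicalSpace S] (L : RatLocalSystem.{u, v} S)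

/-- The flat trivialization of the complexified local system. -/
def transportC (x y : S) (h : y ∈ L.nhd x) : L.VC x ≃ₗ[ℂ] L.VC y :=
  (L.transport x y h).baseChange ℚ ℂ _ _

/-- The flat coordinates at `x` of the fibre at `y`. -/
def frame (x y : S) (h : y ∈ L.nhd x) : L.VC y ≃ₗ[ℂ] (Fin (L.rk x) → ℂ) :=
  (L.transportC x y h).symm.trans (L.fibCoord x)

variable {L}

theorem transportC_apply {x y : S} (h : y ∈ L.nhd x) (w : L.VC x) :
    L.transportC x y h w = (L.transport x y h).toLinearMap.baseChange ℂ w := rfl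

theorem conjC_transportC {x y : S} (h : y ∈ L.nhd x) (w : L.VC x) :
    conjC _ (L.transportC x y h w) = L.transportC x y h (conjC _ w) :=
  conjC_baseChange _ _

theorem frameCoord_of_mem {x y : S} (h : y ∈ L.nhd x) (σ : L.Section) :
    L.frameCoord x σ y = L.frame x y h (σ y) := by
  rw [frameCoord, dif_pos h]
  rfl

/-- The transition from the trivialization at `s` to that at `x` is locally constant, and at `s`
itself `transport s s` is the identity. -/
theorem eventually_transportC {x s : S} (hs : s ∈ L.nhd x) :
    ∀ᶠ y in 𝓝 s, ∀ (k₁ : y ∈ L.nhd s) (k₂ : y ∈ L.nhd x) (w : L.VC s),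
      (L.transportC x y k₂).symm (L.transportC s y k₁ w) = (L.transportC x s hs).symm w := by
  filter_upwards [L.transition_locallyConstant s x s (L.mem_nhd s) hs] with y hy k₁ k₂ w
  have h1 : (L.transport x y k₂).symm.toLinearMap ∘ₗ (L.transport s y k₁).toLinearMap =
      (L.transport x s hs).symm.toLinearMap := by
    ext a
    have := hy k₁ k₂ a
    rwa [L.transport_self] at this
  change (L.transport x y k₂).symm.toLinearMap.baseChange ℂ
    ((L.transport s y k₁).toLinearMap.baseChange ℂ w) =
      (L.transport x s hs).symm.toLinearMap.baseChange ℂ w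
  rw [← h1, LinearMap.baseChange_comp]
  rfl

theorem eventually_frameCoord {x s : S} (hs : s ∈ L.nhd x) :
    ∀ᶠ y in 𝓝 s, ∀ σ : L.Section,
      L.frameCoord s σ y = L.fibCoord s ((L.frame x s hs).symm (L.frameCoord x σ y)) := by
  filter_upwards [eventually_transportC hs, (L.isOpen_nhd s).mem_nhds (L.mem_nhd s),
    (L.isOpen_nhd x).mem_nhds hs] with y hy k₁ k₂ σ
  rw [frameCoord_of_mem k₁, frameCoord_of_mem k₂]
  obtain ⟨w, hw⟩ := (L.transportC s y k₁).surjective (σ y)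
  have h1 : L.frame s y k₁ (σ y) = L.fibCoord s w := by
    rw [frame, LinearEquiv.trans_apply, ← hw, LinearEquiv.symm_apply_apply]
  have h2 : L.frame x y k₂ (σ y) = L.frame x s hs w := by
    rw [frame, frame, LinearEquiv.trans_apply, LinearEquiv.trans_apply, ← hw, hy]
  rw [h1, h2, LinearEquiv.symm_apply_apply]

theorem eventually_frameCoord_flatExt {x s : S} (hs : s ∈ L.nhd x) (e : L.VC s) :
    ∀ᶠ y in 𝓝 s, L.frameCoord x (L.flatExt s e) y = L.frame x s hs e := by
  filter_upwards [eventually_transportC hs, (L.isOpen_nhd s).mem_nhds (L.mem_nhd s),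
    (L.isOpen_nhd x).mem_nhds hs] with y hy k₁ k₂
  rw [frameCoord_of_mem k₂, flatExt, dif_pos k₁, ← transportC_apply, frame, frame,
    LinearEquiv.trans_apply, LinearEquiv.trans_apply, hy]

end Frames

section Smooth

variable {E : Type*} [NormedAddCommGroup E] [NormedSpace ℂ E]
  {S : Type u} [TopologicalSpace S] [ChartedSpace E S] {L : RatLocalSystem.{u, v} S}

variable (E) in
/-- A section in the chart and in the flat frame at `x`. -/
def localRep (x : S) (σ : L.Section) (z : E) : Fin (L.rk x) → ℂ :=
  L.frameCoord x σ ((chartAt E x).symm z)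

/-- The coordinate change from the flat frame at `x` to the flat frame at `s`. -/
def frameChange {x s : S} (hs : s ∈ L.nhd x) : (Fin (L.rk x) → ℂ) ≃L[ℂ] (Fin (L.rk s) → ℂ) :=
  ((L.frame x s hs).symm.trans (L.fibCoord s)).toContinuousLinearEquiv

theorem eventually_localRep {x s : S} (hs : s ∈ L.nhd x) (hs' : s ∈ (chartAt E x).source)
    (σ : L.Section) :
    (fun z => L.frameCoord s σ ((chartAt E x).symm z)) =ᶠ[𝓝 (chartAt E x s)]
      fun z => frameChange hs (localRep E x σ z) := by
  have h1 : Filter.Tendsto (chartAt E x).symm (𝓝 (chartAt E x s)) (𝓝 s) := by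
    have := (chartAt E x).continuousAt_symm ((chartAt E x).map_source hs')
    rwa [ContinuousAt, (chartAt E x).left_inv hs'] at this
  filter_upwards [h1.eventually (eventually_frameCoord hs)] with z hz
  exact hz σ

variable [IsManifold 𝓘(ℂ, E) ω S]

/-- Smoothness at `s` is defined in the frame at `s`. The constant change of frame allows all the
points of a neighbourhood to be treated in the one frame at `x`; `holomorphicAt_iff` and
`frame_nabla` serve the same purpose. -/
theorem smoothAt_iff {x s : S} (hs : s ∈ L.nhd x) (hs' : s ∈ (chartAt E x).source)
    {σ : L.Section} :
    L.SmoothAt E σ s ↔ ContDiffAt ℝ ∞ (localRep E x σ) (chartAt E x s) := by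
  rw [SmoothAt, contMDiffAt_iff_contDiffAt_chart hs',
    contDiffAt_congr_iff (eventually_localRep hs hs' σ)]
  constructor
  · intro h
    have h1 := ContDiff.comp_contDiffAt _
      (((frameChange hs).symm.contDiff (n := ∞)).restrict_scalars ℝ) h
    refine (contDiffAt_congr_iff (Filter.Eventually.of_forall fun z => ?_)).1 h1
    exact (frameChange hs).symm_apply_apply _
  · exact fun h => ContDiff.comp_contDiffAt _
      (((frameChange hs).contDiff (n := ∞)).restrict_scalars ℝ) h

theorem holomorphicAt_iff {x s : S} (hs : s ∈ L.nhd x) (hs' : s ∈ (chartAt E x).source)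
    {σ : L.Section} :
    L.HolomorphicAt E σ s ↔ ContDiffAt ℂ ω (localRep E x σ) (chartAt E x s) := by
  rw [HolomorphicAt, contMDiffAt_iff_contDiffAt_chart hs',
    contDiffAt_congr_iff (eventually_localRep hs hs' σ)]
  exact (frameChange hs).comp_contDiffAt_iff

theorem frame_nabla {x s : S} (hs : s ∈ L.nhd x) (hs' : s ∈ (chartAt E x).source)
    {σ : L.Section} (hσ : DifferentiableAt ℝ (localRep E x σ) (chartAt E x s)) (v : E) :
    L.frame x s hs (L.nabla E σ s v) =
      fderiv ℝ (localRep E x σ) (chartAt E x s) (chartDeriv E x s v) := by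
  let A : (Fin (L.rk x) → ℂ) →L[ℝ] (Fin (L.rk s) → ℂ) :=
    (frameChange hs : (Fin (L.rk x) → ℂ) →L[ℂ] (Fin (L.rk s) → ℂ)).restrictScalars ℝ
  have h1 : HasFDerivAt (fun z => A (localRep E x σ z)) (A ∘L fderiv ℝ (localRep E x σ)
      (chartAt E x s)) (chartAt E x s) := A.hasFDerivAt.comp _ hσ.hasFDerivAt
  have h2 := HasMFDerivAt.comp s h1.hasMFDerivAt (hasMFDerivAt_chart (E := E) hs')
  have h3 : L.frameCoord s σ =ᶠ[𝓝 s] (fun z => A (localRep E x σ z)) ∘ chartAt E x := by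
    filter_upwards [eventually_frameCoord hs, (chartAt E x).open_source.mem_nhds hs'] with y hy hy'
    rw [hy, Function.comp_apply, localRep, (chartAt E x).left_inv hy']
    rfl
  have h4 := (h2.congr_of_eventuallyEq h3).mfderiv
  have h5 : L.dFrameCoord E σ s v =
      A (fderiv ℝ (localRep E x σ) (chartAt E x s) (chartDeriv E x s v)) :=
    congrArg (fun T => T v) h4
  rw [nabla, h5]
  change L.frame x s hs ((L.fibCoord s).symm (L.fibCoord s ((L.frame x s hs).symm _))) = _
  rw [LinearEquiv.symm_apply_apply, LinearEquiv.apply_symm_apply]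

omit [IsManifold 𝓘(ℂ, E) ω S] in
theorem nabla10_apply (σ : L.Section) (s : S) (v : E) :
    L.nabla10 E σ s v =
      (1 / 2 : ℂ) • (L.nabla E σ s v - Complex.I • L.nabla E σ s (Complex.I • v)) := by
  change (L.fibCoord s).symm ((1 / 2 : ℂ) • (L.dFrameCoord E σ s v -
    Complex.I • L.dFrameCoord E σ s (Complex.I • v))) = _
  rw [map_smul, map_sub, map_smul]
  rfl

omit [IsManifold 𝓘(ℂ, E) ω S] in
theorem nabla01_apply (σ : L.Section) (s : S) (v : E) :
    L.nabla01 E σ s v =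
      (1 / 2 : ℂ) • (L.nabla E σ s v + Complex.I • L.nabla E σ s (Complex.I • v)) := by
  change (L.fibCoord s).symm ((1 / 2 : ℂ) • (L.dFrameCoord E σ s v +
    Complex.I • L.dFrameCoord E σ s (Complex.I • v))) = _
  rw [map_smul, map_add, map_smul]
  rfl

omit [IsManifold 𝓘(ℂ, E) ω S] in
theorem nabla10_add_nabla01 (σ : L.Section) (s : S) (v : E) :
    L.nabla10 E σ s v + L.nabla01 E σ s v = L.nabla E σ s v := by
  rw [nabla10_apply, nabla01_apply]
  module

end Smooth

end RatLocalSystem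

theorem Submodule.baseChange_map_eq {M M' : Type*} [AddCommGroup M] [Module ℚ M] [AddCommGroup M']
    [Module ℚ M'] (A : Submodule ℚ M) (f : M →ₗ[ℚ] M') :
    (A.map f).baseChange ℂ = (A.baseChange ℂ).map (f.baseChange ℂ) := by
  rw [Submodule.baseChange_eq_span, Submodule.baseChange_eq_span, Submodule.map_span]
  congr 1
  ext v
  constructor
  · rintro ⟨_, ⟨a, ha, rfl⟩, rfl⟩
    exact ⟨_, ⟨a, ha, rfl⟩, rfl⟩
  · rintro ⟨_, ⟨a, ha, rfl⟩, rfl⟩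
    exact ⟨_, ⟨a, ha, rfl⟩, rfl⟩

namespace RatLocalSystem

variable {E : Type*} [NormedAddCommGroup E] [NormedSpace ℂ E]
  {S : Type u} [TopologicalSpace S] [ChartedSpace E S] {L : RatLocalSystem.{u, v} S}

variable (E L) in
/-- The ball of radius `r` around the image of `x` in the chart at `x` is contained in the image of
the chart, and in the domain of the flat frame at `x`. -/
def IsGoodBall (x : S) (r : ℝ) : Prop :=
  0 < r ∧ ∀ z ∈ Metric.ball (chartAt E x x) r, z ∈ (chartAt E x).target ∧
    (chartAt E x).symm z ∈ L.nhd x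

variable (E L) in
theorem exists_isGoodBall (x : S) : ∃ r₀, 0 < r₀ ∧ ∀ r, 0 < r → r ≤ r₀ → L.IsGoodBall E x r := by
  have hopen : IsOpen ((chartAt E x).target ∩ (chartAt E x).symm ⁻¹' L.nhd x) :=
    (chartAt E x).isOpen_inter_preimage_symm (L.isOpen_nhd x)
  obtain ⟨r₀, hr₀, hball⟩ := Metric.isOpen_iff.1 hopen (chartAt E x x)
    ⟨mem_chart_target E x, by simpa using L.mem_nhd x⟩
  exact ⟨r₀, hr₀, fun r hr hrr => ⟨hr, fun z hz => hball (Metric.ball_subset_ball hrr hz)⟩⟩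

namespace IsGoodBall

variable {x : S} {r : ℝ} (hr : L.IsGoodBall E x r)

include hr

theorem mem_self : chartAt E x x ∈ Metric.ball (chartAt E x x) r := Metric.mem_ball_self hr.1

theorem mem_nhd {z : E} (hz : z ∈ Metric.ball (chartAt E x x) r) :
    (chartAt E x).symm z ∈ L.nhd x := (hr.2 z hz).2

theorem mem_source {z : E} (hz : z ∈ Metric.ball (chartAt E x x) r) :
    (chartAt E x).symm z ∈ (chartAt E x).source := (chartAt E x).map_target (hr.2 z hz).1

theorem chart_symm {z : E} (hz : z ∈ Metric.ball (chartAt E x x) r) :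
    chartAt E x ((chartAt E x).symm z) = z := (chartAt E x).right_inv (hr.2 z hz).1

theorem tendsto_symm {z : E} (hz : z ∈ Metric.ball (chartAt E x x) r) :
    Filter.Tendsto (chartAt E x).symm (𝓝 z) (𝓝 ((chartAt E x).symm z)) :=
  (chartAt E x).continuousAt_symm (hr.2 z hz).1

theorem eventually_ball {s : S} (hs : s ∈ (chartAt E x).source)
    (hz : chartAt E x s ∈ Metric.ball (chartAt E x x) r) :
    ∀ᶠ y in 𝓝 s, y ∈ (chartAt E x).source ∧ chartAt E x y ∈ Metric.ball (chartAt E x x) r ∧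
      y ∈ L.nhd x := by
  filter_upwards [(chartAt E x).open_source.mem_nhds hs,
    ((chartAt E x).continuousAt hs).eventually (Metric.isOpen_ball.mem_nhds hz)] with y hy hy'
  refine ⟨hy, hy', ?_⟩
  have := hr.mem_nhd hy'
  rwa [(chartAt E x).left_inv hy] at this

end IsGoodBall

open Classical in
/-- The section with a given local representation. -/
def sectionOf (x : S) (f : E → Fin (L.rk x) → ℂ) : L.Section := fun s =>
  if h : s ∈ L.nhd x then (L.frame x s h).symm (f (chartAt E x s)) else 0

theorem frame_sectionOf {x s : S} (hs : s ∈ L.nhd x) (f : E → Fin (L.rk x) → ℂ) :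
    L.frame x s hs (sectionOf x f s) = f (chartAt E x s) := by
  rw [sectionOf, dif_pos hs, LinearEquiv.apply_symm_apply]

theorem localRep_sectionOf {x : S} {r : ℝ} (hr : L.IsGoodBall E x r) (f : E → Fin (L.rk x) → ℂ)
    {z : E} (hz : z ∈ Metric.ball (chartAt E x x) r) :
    localRep E x (sectionOf (L := L) x f) z = f z := by
  rw [localRep, frameCoord_of_mem (hr.mem_nhd hz), frame_sectionOf, hr.chart_symm hz]

end RatLocalSystem

/-! ### A unipotent variation in a chart and a flat frame -/

namespace VGPMHS

open RatLocalSystem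

variable {E : Type*} [NormedAddCommGroup E] [NormedSpace ℂ E]
  {S : Type u} [TopologicalSpace S] [ChartedSpace E S] (𝒱 : VGPMHS.{u, v} E S)

theorem isMixedHodge (s : S) :
    IsMixedHodge (conjC (𝒱.L.Fib s)) (fun k => 𝒱.WC k s) fun p => 𝒱.F p s :=
  isMixedHodge_of_graded (𝒱.wt.mono s) (𝒱.wt.separated s) (𝒱.wt.exhaustive s)
    (𝒱.hodge_antitone s) (𝒱.hodge_separated s) (𝒱.hodge_exhaustive s)
    fun k => (𝒱.graded k).pure s

/-- The conjugation in flat coordinates. -/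
def localConj (x : S) : (Fin (𝒱.L.rk x) → ℂ) →ₛₗ[starRingEnd ℂ] (Fin (𝒱.L.rk x) → ℂ) :=
  ((𝒱.L.fibCoord x).toLinearMap.comp (conjC (𝒱.L.Fib x))).comp (𝒱.L.fibCoord x).symm.toLinearMap

/-- The weight filtration in flat coordinates. -/
def localW (x : S) (k : ℤ) : Submodule ℂ (Fin (𝒱.L.rk x) → ℂ) :=
  (𝒱.WC k x).map (𝒱.L.fibCoord x).toLinearMap

open Classical in
/-- The Hodge filtration in flat coordinates. -/
def localK (x : S) (p : ℤ) (z : E) : Submodule ℂ (Fin (𝒱.L.rk x) → ℂ) :=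
  if h : (chartAt E x).symm z ∈ 𝒱.L.nhd x then
    (𝒱.F p ((chartAt E x).symm z)).map (𝒱.L.frame x _ h).toLinearMap else ⊥

/-- The projection to `𝓤^p` in flat coordinates. -/
def localProj (x : S) (p : ℤ) (z : E) : (Fin (𝒱.L.rk x) → ℂ) →L[ℂ] (Fin (𝒱.L.rk x) → ℂ) :=
  summandProj (𝒱.localConj x) (𝒱.localW x) (𝒱.localK x) (chartAt E x x) p z

/-- A primitive of the Higgs field in flat coordinates. -/
def localPrim (x : S) (a b : ℤ) (z : E) : (Fin (𝒱.L.rk x) → ℂ) →L[ℂ] (Fin (𝒱.L.rk x) → ℂ) :=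
  gradingOp (𝒱.localConj x) (𝒱.localW x) (𝒱.localK x) (chartAt E x x) a b z

variable {𝒱}

theorem localConj_frame {x s : S} (hs : s ∈ 𝒱.L.nhd x) (w : 𝒱.L.VC s) :
    𝒱.localConj x (𝒱.L.frame x s hs w) = 𝒱.L.frame x s hs (conjC _ w) := by
  obtain ⟨w, rfl⟩ := (𝒱.L.transportC x s hs).surjective w
  rw [conjC_transportC, frame, LinearEquiv.trans_apply, LinearEquiv.trans_apply,
    LinearEquiv.symm_apply_apply, LinearEquiv.symm_apply_apply]
  simp [localConj]

theorem map_transportC_WC {x s : S} (hs : s ∈ 𝒱.L.nhd x) (k : ℤ) :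
    (𝒱.WC k x).map (𝒱.L.transportC x s hs).toLinearMap = 𝒱.WC k s := by
  rw [WC, WC, ← 𝒱.wt.flat k x s hs, Submodule.baseChange_map_eq]
  rfl

theorem map_frame_WC {x s : S} (hs : s ∈ 𝒱.L.nhd x) (k : ℤ) :
    (𝒱.WC k s).map (𝒱.L.frame x s hs).toLinearMap = 𝒱.localW x k := by
  rw [← map_transportC_WC hs, ← Submodule.map_comp, localW]
  congr 1
  exact LinearMap.ext fun w => by simp [frame]

theorem localK_of_mem {x s : S} (hs : s ∈ 𝒱.L.nhd x) (hs' : s ∈ (chartAt E x).source) (p : ℤ) :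
    𝒱.localK x p (chartAt E x s) = (𝒱.F p s).map (𝒱.L.frame x s hs).toLinearMap := by
  have h1 : (chartAt E x).symm (chartAt E x s) = s := (chartAt E x).left_inv hs'
  rw [localK]
  -- The type of the fibre depends on the point, so the point must be generalized before it is
  -- replaced by `s`.
  generalize (chartAt E x).symm (chartAt E x s) = s' at h1
  subst h1
  rw [dif_pos hs]

theorem isMixedHodge_local {x s : S} (hs : s ∈ 𝒱.L.nhd x) (hs' : s ∈ (chartAt E x).source) :
    IsMixedHodge (𝒱.localConj x) (𝒱.localW x) fun p => 𝒱.localK x p (chartAt E x s) := by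
  have := (𝒱.isMixedHodge s).map (𝒱.L.frame x s hs) (localConj_frame hs)
  simp only [map_frame_WC hs, ← localK_of_mem hs hs'] at this
  exact this

theorem oppFil_local {x s : S} (hs : s ∈ 𝒱.L.nhd x) (hs' : s ∈ (chartAt E x).source) (p : ℤ) :
    oppFil (𝒱.localConj x) (𝒱.localW x) (fun p => 𝒱.localK x p (chartAt E x s)) p =
      (oppFil (conjC _) (fun k => 𝒱.WC k s) (fun p => 𝒱.F p s) p).map
        (𝒱.L.frame x s hs).toLinearMap := by
  have := oppFil_map (𝒱.L.frame x s hs) (localConj_frame hs) (fun k => 𝒱.WC k s)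
    (fun p => 𝒱.F p s) p
  simp only [map_frame_WC hs, ← localK_of_mem hs hs'] at this
  exact this

/-- A flat trivialization respects the Hodge filtration on `Gr^W`. -/
theorem IsUnipotent.exists_transport (h𝒱 : 𝒱.IsUnipotent) {x s : S} (hs : s ∈ 𝒱.L.nhd x)
    (p k : ℤ) :
    (∀ f ∈ 𝒱.F p x ⊓ 𝒱.WC k x, ∃ f' ∈ 𝒱.F p s ⊓ 𝒱.WC k s,
      𝒱.L.transportC x s hs f - f' ∈ 𝒱.WC (k - 1) s) ∧
    (∀ f' ∈ 𝒱.F p s ⊓ 𝒱.WC k s, ∃ f ∈ 𝒱.F p x ⊓ 𝒱.WC k x,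
      𝒱.L.transportC x s hs f - f' ∈ 𝒱.WC (k - 1) s) := by
  have hu := h𝒱 k p x s hs
  let T : 𝒱.wt.W k x ≃ₗ[ℚ] 𝒱.wt.W k s :=
    (𝒱.L.transport x s hs).ofSubmodules _ _ (𝒱.wt.flat k x s hs)
  have hle : 𝒱.wt.W (k - 1) s ≤ 𝒱.wt.W k s := 𝒱.wt.mono s (by omega)
  have h1 : ∀ b : ℂ ⊗[ℚ] 𝒱.wt.W k x,
      (𝒱.wt.grTransport k x s hs).toLinearMap.baseChange ℂ
        ((((𝒱.wt.W (k - 1) x).submoduleOf (𝒱.wt.W k x)).mkQ).baseChange ℂ b) =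
      (((𝒱.wt.W (k - 1) s).submoduleOf (𝒱.wt.W k s)).mkQ).baseChange ℂ
        (T.toLinearMap.baseChange ℂ b) := by
    intro b
    rw [← LinearMap.comp_apply, ← LinearMap.comp_apply, ← LinearMap.baseChange_comp,
      ← LinearMap.baseChange_comp]
    rfl
  have h2 : ∀ b : ℂ ⊗[ℚ] 𝒱.wt.W k x,
      𝒱.L.transportC x s hs ((𝒱.wt.W k x).subtype.baseChange ℂ b) =
      (𝒱.wt.W k s).subtype.baseChange ℂ (T.toLinearMap.baseChange ℂ b) := by
    intro b
    rw [transportC_apply, ← LinearMap.comp_apply, ← LinearMap.comp_apply,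
      ← LinearMap.baseChange_comp, ← LinearMap.baseChange_comp]
    rfl
  constructor
  · rintro _ ⟨hf, b, rfl⟩
    have h3 : (((𝒱.wt.W (k - 1) s).submoduleOf (𝒱.wt.W k s)).mkQ).baseChange ℂ
        (T.toLinearMap.baseChange ℂ b) ∈ 𝒱.wt.grHodge 𝒱.F k p s := by
      rw [← h1]
      exact hu.le (Submodule.mem_map_of_mem (⟨b, hf, rfl⟩ :
        (((𝒱.wt.W (k - 1) x).submoduleOf (𝒱.wt.W k x)).mkQ).baseChange ℂ b ∈
          𝒱.wt.grHodge 𝒱.F k p x))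
    obtain ⟨b', hb', hbb⟩ := h3
    refine ⟨_, ⟨hb', b', rfl⟩, ?_⟩
    rw [h2, ← map_sub, WC, ← mkQ_baseChange_eq_zero_iff hle, map_sub, hbb, sub_self]
  · rintro _ ⟨hf, b', rfl⟩
    have h3 := hu.ge (⟨b', hf, rfl⟩ :
      (((𝒱.wt.W (k - 1) s).submoduleOf (𝒱.wt.W k s)).mkQ).baseChange ℂ b' ∈
        𝒱.wt.grHodge 𝒱.F k p s)
    obtain ⟨_, ⟨b, hb, rfl⟩, hbb⟩ := h3
    replace hbb := (h1 b).symm.trans hbb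
    refine ⟨_, ⟨hb, b, rfl⟩, ?_⟩
    rw [h2, ← map_sub, WC, ← mkQ_baseChange_eq_zero_iff hle, map_sub, hbb, sub_self]

variable [IsManifold 𝓘(ℂ, E) ω S]

omit [IsManifold 𝓘(ℂ, E) ω S] in
theorem IsUnipotent.graded_eq_local (h𝒱 : 𝒱.IsUnipotent) {x s s' : S} (hs : s ∈ 𝒱.L.nhd x)
    (hs' : s' ∈ 𝒱.L.nhd x) (p k : ℤ) :
    ∀ f ∈ (𝒱.F p s).map (𝒱.L.frame x s hs).toLinearMap ⊓ 𝒱.localW x k,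
      ∃ f' ∈ (𝒱.F p s').map (𝒱.L.frame x s' hs').toLinearMap ⊓ 𝒱.localW x k,
        f - f' ∈ 𝒱.localW x (k - 1) := by
  intro f hf
  rw [← map_frame_WC hs, ← map_inf_equiv] at hf
  obtain ⟨w, hw, rfl⟩ := hf
  obtain ⟨f₀, hf₀, h₀⟩ := (h𝒱.exists_transport hs p k).2 w hw
  obtain ⟨w', hw', h₁⟩ := (h𝒱.exists_transport hs' p k).1 f₀ hf₀
  refine ⟨𝒱.L.frame x s' hs' w', ?_, ?_⟩
  · rw [← map_frame_WC hs', ← map_inf_equiv]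
    exact Submodule.mem_map_of_mem hw'
  · have h₂ : 𝒱.L.frame x s hs (𝒱.L.transportC x s hs f₀ - w) ∈ 𝒱.localW x (k - 1) := by
      rw [← map_frame_WC hs]
      exact Submodule.mem_map_of_mem h₀
    have h₃ : 𝒱.L.frame x s' hs' (𝒱.L.transportC x s' hs' f₀ - w') ∈ 𝒱.localW x (k - 1) := by
      rw [← map_frame_WC hs']
      exact Submodule.mem_map_of_mem h₁
    have h₄ := Submodule.sub_mem _ h₃ h₂
    rw [map_sub, map_sub] at h₄
    have h₅ : 𝒱.L.frame x s hs (𝒱.L.transportC x s hs f₀) =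
        𝒱.L.frame x s' hs' (𝒱.L.transportC x s' hs' f₀) := by simp [frame]
    rw [h₅] at h₄
    convert h₄ using 1
    change 𝒱.L.frame x s hs w - _ = _
    abel

/-- The bridge to the local model: flatness of the rational structure and of `W` makes `c` and `W`
constant, and unipotence gives `graded_eq`. -/
theorem isLocalVariation (h𝒱 : 𝒱.IsUnipotent) {x : S} {r : ℝ} (hr : 𝒱.L.IsGoodBall E x r) :
    IsLocalVariation (Metric.ball (chartAt E x x) r) (𝒱.localConj x) (𝒱.localW x)
      (𝒱.localK x) where
  isOpen := Metric.isOpen_ball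
  convex := convex_ball _ _
  mixedHodge z hz := by
    have := isMixedHodge_local (𝒱 := 𝒱) (hr.mem_nhd hz) (hr.mem_source hz)
    rwa [hr.chart_symm hz] at this
  graded_eq z hz z' hz' p k := by
    have := h𝒱.graded_eq_local (hr.mem_nhd hz) (hr.mem_nhd hz') p k
    rwa [← localK_of_mem (hr.mem_nhd hz) (hr.mem_source hz), hr.chart_symm hz,
      ← localK_of_mem (hr.mem_nhd hz') (hr.mem_source hz'), hr.chart_symm hz'] at this
  exists_frame p z hz := by
    obtain ⟨m, f, hf⟩ := 𝒱.hodge_holomorphic p ((chartAt E x).symm z)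
    refine ⟨m, fun i => localRep E x (f i), ?_⟩
    filter_upwards [(hr.tendsto_symm hz).eventually hf, Metric.isOpen_ball.mem_nhds hz] with y hy hyb
    obtain ⟨h1, h2, h3⟩ := hy
    have h4 : ∀ i, localRep E x (f i) y =
        𝒱.L.frame x _ (hr.mem_nhd hyb) (f i ((chartAt E x).symm y)) := fun i =>
      frameCoord_of_mem _ _
    refine ⟨fun i => ?_, ?_, ?_⟩
    · have := (holomorphicAt_iff (hr.mem_nhd hyb) (hr.mem_source hyb)).1 (h1 i)
      rwa [hr.chart_symm hyb] at this
    · simp only [h4]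
      exact h2.map' (𝒱.L.frame x _ (hr.mem_nhd hyb)).toLinearMap (LinearEquiv.ker _)
    · have := localK_of_mem (𝒱 := 𝒱) (hr.mem_nhd hyb) (hr.mem_source hyb) p
      rw [hr.chart_symm hyb] at this
      rw [this, ← h3, Submodule.map_span, ← Set.range_comp]
      simp only [h4]
      rfl
  horizontal p z hz f hf v := by
    -- A vector function in the chart is made into a section, so that the horizontality of the
    -- variation applies to it.
    let σ : 𝒱.L.Section := sectionOf x f
    set s := (chartAt E x).symm z with hs
    have hsn := hr.mem_nhd hz
    have hss := hr.mem_source hz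
    have hz' : chartAt E x s = z := hr.chart_symm hz
    have hrep : ∀ y ∈ Metric.ball (chartAt E x x) r, localRep E x σ y = f y := fun y hy =>
      localRep_sectionOf hr f hy
    have hev : ∀ y ∈ Metric.ball (chartAt E x x) r, localRep E x σ =ᶠ[𝓝 y] f := fun y hy => by
      filter_upwards [Metric.isOpen_ball.mem_nhds hy] with y' hy' using hrep y' hy'
    have hσ : ∀ᶠ y in 𝓝 s, 𝒱.L.HolomorphicAt E σ y ∧ σ y ∈ 𝒱.F p y := by
      have h1 : Filter.Tendsto (chartAt E x) (𝓝 s) (𝓝 z) := by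
        have := (chartAt E x).continuousAt hss
        rwa [ContinuousAt, hz'] at this
      filter_upwards [h1.eventually hf, hr.eventually_ball hss (by rwa [hz'])] with y hy hyb
      obtain ⟨hy1, hy2⟩ := hy
      obtain ⟨hyb1, hyb2, hyb3⟩ := hyb
      constructor
      · rw [holomorphicAt_iff hyb3 hyb1, contDiffAt_congr_iff (hev _ hyb2)]
        exact hy1
      · rw [localK_of_mem hyb3 hyb1, ← frame_sectionOf hyb3 f] at hy2
        exact (mem_map_equiv_iff _ _ _).1 hy2
    obtain ⟨u, hu⟩ := chartDeriv_surjective (E := E) hss v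
    have h2 := 𝒱.horizontal p σ s hσ u
    have hd : DifferentiableAt ℂ f z := hf.self_of_nhds.1.differentiableAt (by simp)
    have h3 : fderiv ℝ (localRep E x σ) z = (fderiv ℂ f z).restrictScalars ℝ := by
      rw [(hev z hz).fderiv_eq]
      exact hd.fderiv_restrictScalars ℝ
    have h4 := frame_nabla (E := E) hsn hss (σ := σ) (by
      rw [hz', (hev z hz).differentiableAt_iff]
      exact hd.restrictScalars ℝ) u
    rw [hz', h3, hu] at h4
    have h5 : fderiv ℂ f z v = 𝒱.L.frame x s hsn (𝒱.L.nabla E σ s u) := h4.symm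
    rw [h5, ← hz', localK_of_mem hsn hss]
    exact Submodule.mem_map_of_mem h2

/-! ### The projections and the Higgs field in flat coordinates -/

/-- Here the flatness of `G` is decisive: `proj` is defined by the mixed Hodge structure at `s`,
whereas `localProj` projects along `G` at the centre of the ball. -/
theorem frame_proj (h𝒱 : 𝒱.IsUnipotent) {x : S} {r : ℝ} (hr : 𝒱.L.IsGoodBall E x r) {s : S}
    (hs : s ∈ 𝒱.L.nhd x) (hs' : s ∈ (chartAt E x).source)
    (hz : chartAt E x s ∈ Metric.ball (chartAt E x x) r) (p : ℤ) (e : 𝒱.L.VC s) :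
    𝒱.L.frame x s hs (𝒱.proj p s e) =
      𝒱.localProj x p (chartAt E x s) (𝒱.L.frame x s hs e) := by
  have h := isLocalVariation h𝒱 hr
  have hP : ∀ q, ∃ f ∈ 𝒱.F q s,
      e - f ∈ oppFil (conjC _) (fun k => 𝒱.WC k s) (fun p => 𝒱.F p s) (q - 1) ∧
      hodgeProj (𝒱.localConj x) (𝒱.localW x) (𝒱.localK x) (chartAt E x x) q (chartAt E x s)
        (𝒱.L.frame x s hs e) = 𝒱.L.frame x s hs f := by
    intro q
    obtain ⟨h1, h2⟩ := h.hodgeProj_spec hr.mem_self hz q (𝒱.L.frame x s hs e)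
    rw [h.oppFil_eq hr.mem_self hz, oppFil_local hs hs'] at h2
    rw [localK_of_mem hs hs'] at h1
    obtain ⟨f, hf, hfe⟩ := h1
    refine ⟨f, hf, ?_, hfe.symm⟩
    rw [← hfe] at h2
    rw [← mem_map_equiv_iff (𝒱.L.frame x s hs), map_sub]
    exact h2
  obtain ⟨f, hf, hef, hPf⟩ := hP p
  obtain ⟨f', hf', hef', hPf'⟩ := hP (p + 1)
  rw [add_sub_cancel_right] at hef'
  have h3 : 𝒱.proj p s e = f - f' := gradedProj_deligneU (𝒱.isMixedHodge s) p hf hef hf' hef'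
  rw [h3, map_sub, localProj, summandProj, sub_apply, hPf, hPf']

end VGPMHS

/-! ### Real derivatives of complex linear operators applied to vectors -/

section ClmApply

variable {E F G : Type*} [NormedAddCommGroup E] [NormedSpace ℂ E]
  [NormedAddCommGroup F] [NormedSpace ℂ F] [NormedAddCommGroup G] [NormedSpace ℂ G]

theorem hasFDerivAt_complexClm_apply {A : E → F →L[ℂ] G} {A' : E →L[ℝ] F →L[ℂ] G} {X : E → F}
    {X' : E →L[ℝ] F} {z : E} (hA : HasFDerivAt A A' z) (hX : HasFDerivAt X X' z) :
    HasFDerivAt (fun y => A y (X y)) (((A z).restrictScalars ℝ) ∘L X' +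
      ((ContinuousLinearMap.restrictScalarsL ℂ F G ℝ ℝ) ∘L A').flip (X z)) z :=
  (((ContinuousLinearMap.restrictScalarsL ℂ F G ℝ ℝ).hasFDerivAt.comp z hA).clm_apply hX)

theorem ContDiffAt.complexClm_apply {n : ℕ∞ω} {A : E → F →L[ℂ] G} {X : E → F} {z : E}
    (hA : ContDiffAt ℝ n A z) (hX : ContDiffAt ℝ n X z) :
    ContDiffAt ℝ n (fun y => A y (X y)) z :=
  (((ContinuousLinearMap.restrictScalarsL ℂ F G ℝ ℝ).contDiff.comp_contDiffAt _ hA).clm_apply hX)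

end ClmApply

namespace IsLocalVariation

variable {E N : Type*} [NormedAddCommGroup E] [NormedSpace ℂ E]
  [NormedAddCommGroup N] [NormedSpace ℂ N] [FiniteDimensional ℂ N]
  {Ω : Set E} {c : N →ₛₗ[starRingEnd ℂ] N} {W : ℤ → Submodule ℂ N}
  {K : ℤ → E → Submodule ℂ N} (h : IsLocalVariation Ω c W K) {z₀ : E} (hz₀ : z₀ ∈ Ω)
  {a b : ℤ} (hb : ∀ z ∈ Ω, (∀ p ≤ a, hodgeProj c W K z₀ p z = 1) ∧
    (∀ p > b, hodgeProj c W K z₀ p z = 0))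

include h hz₀ hb

/-- This and `summandProj_mul_fderiv` extract from `dΠ_p = [dY, Π_p]` the two pieces that enter `θ`
and `∂`, since `dY` lowers the degree by one. -/
theorem summandProj_sub_one_mul_fderiv {z : E} (hz : z ∈ Ω) (v : E) (p : ℤ) :
    summandProj c W K z₀ (p - 1) z * fderiv ℂ (summandProj c W K z₀ p) z v =
      fderiv ℂ (gradingOp c W K z₀ a b) z v * summandProj c W K z₀ p z := by
  rw [h.fderiv_summandProj hz₀ hb hz, mul_sub, ← mul_assoc, ← mul_assoc,
    h.summandProj_mul_fderiv_gradingOp hz₀ a b hz, sub_add_cancel, mul_assoc,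
    h.summandProj_mul hz₀ hz, h.summandProj_mul hz₀ hz, if_pos rfl, if_neg (by omega), zero_mul,
    sub_zero]

theorem summandProj_mul_fderiv {z : E} (hz : z ∈ Ω) (v : E) (p : ℤ) :
    summandProj c W K z₀ p z * fderiv ℂ (summandProj c W K z₀ p) z v =
      -(summandProj c W K z₀ p z * fderiv ℂ (gradingOp c W K z₀ a b) z v) := by
  rw [h.fderiv_summandProj hz₀ hb hz, mul_sub, ← mul_assoc, ← mul_assoc,
    h.summandProj_mul_fderiv_gradingOp hz₀ a b hz, mul_assoc, h.summandProj_mul hz₀ hz,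
    h.summandProj_mul hz₀ hz, if_neg (by omega), if_pos rfl, mul_zero, zero_sub,
    h.summandProj_mul_fderiv_gradingOp hz₀ a b hz]

end IsLocalVariation

/-! ### The operators `∂̄`, `∂` and `θ` in a flat frame -/

namespace VGPMHS

open RatLocalSystem

variable {E : Type*} [NormedAddCommGroup E] [NormedSpace ℂ E]
  {S : Type u} [TopologicalSpace S] [ChartedSpace E S] (𝒱 : VGPMHS.{u, v} E S)

/-- On the ball of radius `r` around `x`, the flat frame is defined and the Hodge filtration is
trivial outside `[a, b]`. -/
structure IsAdapted (x : S) (r : ℝ) (a b : ℤ) : Prop where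
  good : 𝒱.L.IsGoodBall E x r
  le : a ≤ b
  bounds : ∀ z ∈ Metric.ball (chartAt E x x) r,
    (∀ p ≤ a, hodgeProj (𝒱.localConj x) (𝒱.localW x) (𝒱.localK x) (chartAt E x x) p z = 1) ∧
    (∀ p > b, hodgeProj (𝒱.localConj x) (𝒱.localW x) (𝒱.localK x) (chartAt E x x) p z = 0)

/-- The Higgs field in flat coordinates. -/
def localHiggs (x : S) (a b : ℤ) (z : E) :
    E →L[ℂ] (Fin (𝒱.L.rk x) → ℂ) →L[ℂ] (Fin (𝒱.L.rk x) → ℂ) :=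
  fderiv ℂ (𝒱.localPrim x a b) z

variable {𝒱}
variable [IsManifold 𝓘(ℂ, E) ω S]

/-- All smaller `a` and larger `b` are allowed, so that two variations can share the same bounds. -/
theorem IsUnipotent.exists_isAdapted (h𝒱 : 𝒱.IsUnipotent) {x : S} {r : ℝ}
    (hr : 𝒱.L.IsGoodBall E x r) :
    ∃ a₀ b₀ : ℤ, ∀ a ≤ a₀, ∀ b ≥ b₀, 𝒱.IsAdapted x r a b := by
  obtain ⟨a₀, b₀, h⟩ := (isLocalVariation h𝒱 hr).exists_bounds hr.mem_self
  exact ⟨a₀, b₀, fun a ha b hb => ⟨hr, (h a ha b hb).1, (h a ha b hb).2⟩⟩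

theorem IsUnipotent.exists_isAdapted' (h𝒱 : 𝒱.IsUnipotent) (x : S) :
    ∃ r a b, 𝒱.IsAdapted x r a b := by
  obtain ⟨r, hr, h⟩ := exists_isGoodBall E 𝒱.L x
  obtain ⟨a, b, h⟩ := h𝒱.exists_isAdapted (h r hr le_rfl)
  exact ⟨r, a, b, h a le_rfl b le_rfl⟩

variable (h𝒱 : 𝒱.IsUnipotent) {x : S} {r : ℝ} {a b : ℤ} (hA : 𝒱.IsAdapted x r a b)

include h𝒱 hA

theorem contDiffAt_localProj {z : E} (hz : z ∈ Metric.ball (chartAt E x x) r) (p : ℤ) :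
    ContDiffAt ℂ ω (𝒱.localProj x p) z :=
  (isLocalVariation h𝒱 hA.good).contDiffAt_summandProj hA.good.mem_self hz p

theorem contDiffAt_localHiggs {z : E} (hz : z ∈ Metric.ball (chartAt E x x) r) :
    ContDiffAt ℂ ω (𝒱.localHiggs x a b) z :=
  ((isLocalVariation h𝒱 hA.good).contDiffAt_gradingOp hA.good.mem_self a b hz).fderiv_right le_rfl

theorem localHiggs_commute {z : E} (hz : z ∈ Metric.ball (chartAt E x x) r) (v w : E) :
    𝒱.localHiggs x a b z v * 𝒱.localHiggs x a b z w =
      𝒱.localHiggs x a b z w * 𝒱.localHiggs x a b z v :=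
  (isLocalVariation h𝒱 hA.good).fderiv_gradingOp_commute hA.good.mem_self hA.bounds hz v w

theorem fderiv_localHiggs_symm {z : E} (hz : z ∈ Metric.ball (chartAt E x x) r) (v w : E) :
    fderiv ℂ (𝒱.localHiggs x a b) z v w = fderiv ℂ (𝒱.localHiggs x a b) z w v := by
  have h := (isLocalVariation h𝒱 hA.good).contDiffAt_gradingOp hA.good.mem_self a b hz
  exact (h.isSymmSndFDerivAt (by simp)) v w

theorem localRep_comp (σ : 𝒱.L.Section) (p : ℤ) {z : E}
    (hz : z ∈ Metric.ball (chartAt E x x) r) :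
    localRep E x (𝒱.comp p σ) z = 𝒱.localProj x p z (localRep E x σ z) := by
  have h1 := frame_proj h𝒱 hA.good (hA.good.mem_nhd hz) (hA.good.mem_source hz)
    (by rwa [hA.good.chart_symm hz]) p (σ ((chartAt E x).symm z))
  rw [hA.good.chart_symm hz] at h1
  rw [localRep, localRep, frameCoord_of_mem (hA.good.mem_nhd hz),
    frameCoord_of_mem (hA.good.mem_nhd hz)]
  exact h1

theorem frame_nabla_comp {s : S} (hs : s ∈ 𝒱.L.nhd x) (hs' : s ∈ (chartAt E x).source)
    (hz : chartAt E x s ∈ Metric.ball (chartAt E x x) r) {σ : 𝒱.L.Section}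
    (hσ : DifferentiableAt ℝ (localRep E x σ) (chartAt E x s)) (p : ℤ) (v : E) :
    𝒱.L.frame x s hs (𝒱.L.nabla E (𝒱.comp p σ) s v) =
      fderiv ℂ (𝒱.localProj x p) (chartAt E x s) (chartDeriv E x s v)
        (𝒱.L.frame x s hs (σ s)) +
      𝒱.localProj x p (chartAt E x s) (𝒱.L.frame x s hs (𝒱.L.nabla E σ s v)) := by
  have h1 := ((contDiffAt_localProj h𝒱 hA hz p).differentiableAt (by simp)).hasFDerivAt
  have h2 := hasFDerivAt_complexClm_apply (h1.restrictScalars ℝ) hσ.hasFDerivAt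
  have h3 : localRep E x (𝒱.comp p σ) =ᶠ[𝓝 (chartAt E x s)]
      fun y => 𝒱.localProj x p y (localRep E x σ y) := by
    filter_upwards [Metric.isOpen_ball.mem_nhds hz] with y hy using localRep_comp h𝒱 hA σ p hy
  have h4 := h2.congr_of_eventuallyEq h3
  rw [frame_nabla hs hs' h4.differentiableAt, frame_nabla hs hs' hσ, h4.fderiv]
  have h5 : localRep E x σ (chartAt E x s) = 𝒱.L.frame x s hs (σ s) := by
    rw [localRep, (chartAt E x).left_inv hs', frameCoord_of_mem hs]
  rw [← h5, add_comm]
  rfl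

variable {s : S} (hs : s ∈ 𝒱.L.nhd x) (hs' : s ∈ (chartAt E x).source)
  (hz : chartAt E x s ∈ Metric.ball (chartAt E x x) r) {σ : 𝒱.L.Section}
  (hσ : DifferentiableAt ℝ (localRep E x σ) (chartAt E x s))

include hs' hz hσ

/-- `Π_p` is holomorphic, so its derivative is complex linear and contributes only here, not to the
`(0,1)`-part. -/
theorem frame_nabla10_comp (p : ℤ) (v : E) :
    𝒱.L.frame x s hs (𝒱.L.nabla10 E (𝒱.comp p σ) s v) =
      fderiv ℂ (𝒱.localProj x p) (chartAt E x s) (chartDeriv E x s v)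
        (𝒱.L.frame x s hs (σ s)) +
      𝒱.localProj x p (chartAt E x s) (𝒱.L.frame x s hs (𝒱.L.nabla10 E σ s v)) := by
  rw [nabla10_apply, nabla10_apply]
  simp only [map_smul, map_sub, frame_nabla_comp h𝒱 hA hs hs' hz hσ, chartDeriv_I_smul hs',
    smul_apply]
  have hI : Complex.I * Complex.I = -1 := Complex.I_mul_I
  match_scalars
  · linear_combination (-1 / 2 : ℂ) * hI
  · ring
  · ring

theorem frame_nabla01_comp (p : ℤ) (v : E) :
    𝒱.L.frame x s hs (𝒱.L.nabla01 E (𝒱.comp p σ) s v) =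
      𝒱.localProj x p (chartAt E x s) (𝒱.L.frame x s hs (𝒱.L.nabla01 E σ s v)) := by
  rw [nabla01_apply, nabla01_apply]
  simp only [map_smul, map_add, frame_nabla_comp h𝒱 hA hs hs' hz hσ, chartDeriv_I_smul hs',
    smul_apply]
  have hI : Complex.I * Complex.I = -1 := Complex.I_mul_I
  match_scalars
  · linear_combination (1 / 2 : ℂ) * hI
  · ring
  · ring

theorem frame_delbar (v : E) :
    𝒱.L.frame x s hs (𝒱.delbar σ s v) = 𝒱.L.frame x s hs (𝒱.L.nabla01 E σ s v) := by
  have h := isLocalVariation h𝒱 hA.good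
  have h1 : ∀ p v, 𝒱.L.frame x s hs ((𝒱.proj p s).comp (𝒱.L.nabla01 E (𝒱.comp p σ) s) v) =
      𝒱.localProj x p (chartAt E x s) (𝒱.L.frame x s hs (𝒱.L.nabla01 E σ s v)) := by
    intro p v
    rw [LinearMap.comp_apply, frame_proj h𝒱 hA.good hs hs' hz,
      frame_nabla01_comp h𝒱 hA hs hs' hz hσ, ← mul_apply_eq_comp, localProj,
      h.summandProj_mul hA.good.mem_self hz, if_pos rfl]
  rw [delbar, finsum_eq_sum_of_support_subset (s := Finset.Icc a b), LinearMap.sum_apply, map_sum]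
  · simp only [h1]
    rw [← sum_apply]
    simp only [localProj]
    rw [IsLocalVariation.sum_summandProj hA.bounds hA.le hz]
    rfl
  -- The sum over `ℤ` is finite because `Π_p = 0` outside `[a, b]`.
  · intro p hp
    by_contra hp'
    refine hp (LinearMap.ext fun v => (𝒱.L.frame x s hs).injective ?_)
    rw [h1, localProj,
      IsLocalVariation.summandProj_eq_zero hA.bounds hz (by simpa using hp'),
      LinearMap.zero_apply, map_zero]
    rfl

/-- Each term is `Π_p(∇^{1,0}σ) + Π_p (dΠ_p) σ`, where `Π_p dΠ_p = -Π_p dY`; summing over `p` gives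
`∇^{1,0}σ - dY σ`. -/
theorem frame_del (v : E) :
    𝒱.L.frame x s hs (𝒱.del σ s v) = 𝒱.L.frame x s hs (𝒱.L.nabla10 E σ s v) -
      𝒱.localHiggs x a b (chartAt E x s) (chartDeriv E x s v) (𝒱.L.frame x s hs (σ s)) := by
  have h := isLocalVariation h𝒱 hA.good
  have h1 : ∀ p v, 𝒱.L.frame x s hs ((𝒱.proj p s) ((𝒱.L.nabla10 E (𝒱.comp p σ) s) v)) =
      𝒱.localProj x p (chartAt E x s) (𝒱.L.frame x s hs (𝒱.L.nabla10 E σ s v) -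
        𝒱.localHiggs x a b (chartAt E x s) (chartDeriv E x s v) (𝒱.L.frame x s hs (σ s))) := by
    intro p v
    rw [frame_proj h𝒱 hA.good hs hs' hz, frame_nabla10_comp h𝒱 hA hs hs' hz hσ, map_add,
      map_sub, add_comm, sub_eq_add_neg]
    congr 1
    · rw [← mul_apply_eq_comp, localProj, h.summandProj_mul hA.good.mem_self hz, if_pos rfl]
    · exact congrArg (fun T => T (𝒱.L.frame x s hs (σ s)))
        (h.summandProj_mul_fderiv hA.good.mem_self hA.bounds hz (chartDeriv E x s v) p)
  rw [del, finsum_eq_sum_of_support_subset (s := Finset.Icc a b), LinearMap.sum_apply, map_sum]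
  · simp only [LinearMap.comp_apply, h1]
    rw [← sum_apply]
    simp only [localProj]
    rw [IsLocalVariation.sum_summandProj hA.bounds hA.le hz]
    rfl
  · intro p hp
    by_contra hp'
    refine hp (LinearMap.ext fun v => (𝒱.L.frame x s hs).injective ?_)
    rw [LinearMap.comp_apply, h1, localProj,
      IsLocalVariation.summandProj_eq_zero hA.bounds hz (by simpa using hp'), LinearMap.zero_apply, map_zero]
    rfl

/-- In `Π_{p-1} ∇^{1,0}(Π_p σ)` the term that differentiates `σ` vanishes by orthogonality. This is
the tensoriality of `θ`, and `Π_{p-1} dΠ_p = dY Π_p` sums to `dY`. -/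
theorem frame_higgsOp (v : E) :
    𝒱.L.frame x s hs (𝒱.higgsOp σ s v) =
      𝒱.localHiggs x a b (chartAt E x s) (chartDeriv E x s v) (𝒱.L.frame x s hs (σ s)) := by
  have h := isLocalVariation h𝒱 hA.good
  have h1 : ∀ p v, 𝒱.L.frame x s hs ((𝒱.proj (p - 1) s) ((𝒱.L.nabla10 E (𝒱.comp p σ) s) v)) =
      𝒱.localHiggs x a b (chartAt E x s) (chartDeriv E x s v)
        (𝒱.localProj x p (chartAt E x s) (𝒱.L.frame x s hs (σ s))) := by
    intro p v
    rw [frame_proj h𝒱 hA.good hs hs' hz, frame_nabla10_comp h𝒱 hA hs hs' hz hσ, map_add,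
      ← mul_apply_eq_comp, ← mul_apply_eq_comp, localProj, localProj,
      h.summandProj_mul hA.good.mem_self hz, if_neg (by omega), zero_apply, add_zero]
    exact congrArg (fun T => T (𝒱.L.frame x s hs (σ s)))
      (h.summandProj_sub_one_mul_fderiv hA.good.mem_self hA.bounds hz (chartDeriv E x s v) p)
  rw [higgsOp, finsum_eq_sum_of_support_subset (s := Finset.Icc a b), LinearMap.sum_apply, map_sum]
  · simp only [LinearMap.comp_apply, h1]
    rw [← map_sum, ← sum_apply]
    simp only [localProj]
    rw [IsLocalVariation.sum_summandProj hA.bounds hA.le hz]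
    rfl
  · intro p hp
    by_contra hp'
    refine hp (LinearMap.ext fun v => (𝒱.L.frame x s hs).injective ?_)
    rw [LinearMap.comp_apply, h1, localProj,
      IsLocalVariation.summandProj_eq_zero hA.bounds hz (by simpa using hp'), LinearMap.zero_apply, map_zero,
      zero_apply, map_zero]

omit hσ in
-- `θ` is defined through flat extensions of a basis, whose representatives in the frame at `x` are
-- locally constant, hence differentiable, so `frame_higgsOp` applies to them.
theorem frame_θ (v : E) (e : 𝒱.L.VC s) :
    𝒱.L.frame x s hs (𝒱.θ s v e) =
      𝒱.localHiggs x a b (chartAt E x s) (chartDeriv E x s v) (𝒱.L.frame x s hs e) := by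
  let T : 𝒱.L.VC s →ₗ[ℂ] 𝒱.L.VC s := (𝒱.L.frame x s hs).symm.toLinearMap ∘ₗ
    (𝒱.localHiggs x a b (chartAt E x s) (chartDeriv E x s v)).toLinearMap ∘ₗ
      (𝒱.L.frame x s hs).toLinearMap
  have h1 : 𝒱.θ s v = T := by
    refine (Module.finBasis ℂ (𝒱.L.VC s)).ext fun i => (𝒱.L.frame x s hs).injective ?_
    set σ := 𝒱.L.flatExt s (Module.finBasis ℂ (𝒱.L.VC s) i) with hσdef
    have h2 : 𝒱.θ s v (Module.finBasis ℂ (𝒱.L.VC s) i) = 𝒱.higgsOp σ s v := by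
      rw [θ, LinearMap.flip_apply, Module.Basis.constr_basis]
    have h3 := eventually_frameCoord_flatExt hs (Module.finBasis ℂ (𝒱.L.VC s) i)
    have h4 : σ s = Module.finBasis ℂ (𝒱.L.VC s) i := by
      have := h3.self_of_nhds
      rw [frameCoord_of_mem hs] at this
      exact (𝒱.L.frame x s hs).injective this
    have h5 : localRep E x σ =ᶠ[𝓝 (chartAt E x s)]
        fun _ => 𝒱.L.frame x s hs (Module.finBasis ℂ (𝒱.L.VC s) i) := by
      have h6 := hA.good.tendsto_symm hz
      rw [(chartAt E x).left_inv hs'] at h6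
      exact h6.eventually h3
    have h7 : DifferentiableAt ℝ (localRep E x σ) (chartAt E x s) :=
      h5.differentiableAt_iff.2 (differentiableAt_const _)
    rw [h2, frame_higgsOp h𝒱 hA hs hs' hz h7, h4]
    exact ((𝒱.L.frame x s hs).apply_symm_apply _).symm
  rw [h1]
  exact (𝒱.L.frame x s hs).apply_symm_apply _

end VGPMHS

section ClmApply

variable {E F : Type*} [NormedAddCommGroup E] [NormedSpace ℂ E]
  [NormedAddCommGroup F] [NormedSpace ℂ F]

theorem hasFDerivAt_fderiv_apply {σ : E → F} {Y : E → E} {z : E} (hσ : ContDiffAt ℝ ∞ σ z)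
    (hY : ContDiffAt ℝ ∞ Y z) :
    HasFDerivAt (fun y => fderiv ℝ σ y (Y y)) (fderiv ℝ σ z ∘L fderiv ℝ Y z +
      (fderiv ℝ (fderiv ℝ σ) z).flip (Y z)) z :=
  (((hσ.fderiv_right (m := 1) (by norm_cast)).differentiableAt (by simp)).hasFDerivAt).clm_apply
    (hY.differentiableAt (by simp)).hasFDerivAt

theorem ContDiffAt.hasFDerivAt_form_apply {Θ : E → E →L[ℂ] F →L[ℂ] F} {σ : E → F} {Y : E → E}
    {z : E} (hΘ : ContDiffAt ℂ ω Θ z) (hσ : DifferentiableAt ℝ σ z)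
    (hY : DifferentiableAt ℝ Y z) :
    ∃ L : E →L[ℝ] F, HasFDerivAt (fun y => Θ y (Y y) (σ y)) L z ∧
      ∀ v, L v = fderiv ℂ Θ z v (Y z) (σ z) + Θ z (fderiv ℝ Y z v) (σ z) +
        Θ z (Y z) (fderiv ℝ σ z v) := by
  have h1 := (hΘ.differentiableAt (by simp)).hasFDerivAt.restrictScalars ℝ
  have h2 := hasFDerivAt_complexClm_apply (hasFDerivAt_complexClm_apply h1 hY.hasFDerivAt)
    hσ.hasFDerivAt
  refine ⟨_, h2, fun v => ?_⟩
  change Θ z (Y z) (fderiv ℝ σ z v) + (Θ z (fderiv ℝ Y z v) + fderiv ℂ Θ z v (Y z)) (σ z) = _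
  rw [add_apply]
  abel

end ClmApply

namespace RatLocalSystem

variable {E : Type*} [NormedAddCommGroup E] [NormedSpace ℂ E]
  {S : Type u} [TopologicalSpace S] [ChartedSpace E S] {L : RatLocalSystem.{u, v} S}

theorem localRep_of_mem {x s : S} (hs : s ∈ L.nhd x) (hs' : s ∈ (chartAt E x).source)
    (σ : L.Section) : localRep E x σ (chartAt E x s) = L.frame x s hs (σ s) := by
  rw [localRep, (chartAt E x).left_inv hs', frameCoord_of_mem hs]

theorem fieldRep_chart {x s : S} (hs' : s ∈ (chartAt E x).source)
    (X : ∀ s : S, TangentSpace 𝓘(ℝ, E) s) :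
    fieldRep x X (chartAt E x s) = chartDeriv E x s (X s) := by
  have h1 : (chartAt E x).symm (chartAt E x s) = s := (chartAt E x).left_inv hs'
  rw [fieldRep]
  generalize (chartAt E x).symm (chartAt E x s) = s' at h1
  subst h1
  rfl

variable [IsManifold 𝓘(ℂ, E) ω S]

theorem localRep_nabla {x : S} {r : ℝ} (hr : L.IsGoodBall E x r)
    {σ : L.Section} (Y : ∀ s : S, TangentSpace 𝓘(ℝ, E) s) {z : E}
    (hz : z ∈ Metric.ball (chartAt E x x) r) (hσ : DifferentiableAt ℝ (localRep E x σ) z) :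
    localRep E x (fun s => L.nabla E σ s (Y s)) z =
      fderiv ℝ (localRep E x σ) z (fieldRep x Y z) := by
  obtain ⟨s, rfl, hs, hs'⟩ : ∃ s, chartAt E x s = z ∧ s ∈ L.nhd x ∧ s ∈ (chartAt E x).source :=
    ⟨_, hr.chart_symm hz, hr.mem_nhd hz, hr.mem_source hz⟩
  rw [localRep_of_mem hs hs', fieldRep_chart hs']
  exact frame_nabla hs hs' hσ (Y s)

end RatLocalSystem

namespace VGPMHS

open RatLocalSystem

variable {E : Type*} [NormedAddCommGroup E] [NormedSpace ℂ E]
  {S : Type u} [TopologicalSpace S] [ChartedSpace E S] {𝒱 : VGPMHS.{u, v} E S}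
  [IsManifold 𝓘(ℂ, E) ω S]

theorem localRep_θ (h𝒱 : 𝒱.IsUnipotent) {x : S} {r : ℝ} {a b : ℤ} (hA : 𝒱.IsAdapted x r a b)
    (Y : ∀ s : S, TangentSpace 𝓘(ℝ, E) s) (σ : 𝒱.L.Section) {z : E}
    (hz : z ∈ Metric.ball (chartAt E x x) r) :
    localRep E x (fun s => 𝒱.θ s (Y s) (σ s)) z =
      𝒱.localHiggs x a b z (fieldRep x Y z) (localRep E x σ z) := by
  obtain ⟨s, rfl, hs, hs'⟩ : ∃ s, chartAt E x s = z ∧ s ∈ 𝒱.L.nhd x ∧ s ∈ (chartAt E x).source :=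
    ⟨_, hA.good.chart_symm hz, hA.good.mem_nhd hz, hA.good.mem_source hz⟩
  rw [localRep_of_mem hs hs', localRep_of_mem hs hs', fieldRep_chart hs']
  exact frame_θ h𝒱 hA hs hs' hz (Y s) (σ s)

theorem localRep_nablaSubθ (h𝒱 : 𝒱.IsUnipotent) {x : S} {r : ℝ} {a b : ℤ}
    (hA : 𝒱.IsAdapted x r a b) (Y : ∀ s : S, TangentSpace 𝓘(ℝ, E) s) {σ : 𝒱.L.Section} {z : E}
    (hz : z ∈ Metric.ball (chartAt E x x) r) (hσ : DifferentiableAt ℝ (localRep E x σ) z) :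
    localRep E x (fun s => 𝒱.nablaSubθ σ s (Y s)) z =
      fderiv ℝ (localRep E x σ) z (fieldRep x Y z) -
        𝒱.localHiggs x a b z (fieldRep x Y z) (localRep E x σ z) := by
  rw [← localRep_nabla hA.good Y hz hσ, ← localRep_θ h𝒱 hA Y σ hz]
  simp only [localRep, frameCoord_of_mem (hA.good.mem_nhd hz), nablaSubθ, map_sub]

theorem frame_nablaSubθ (h𝒱 : 𝒱.IsUnipotent) {x : S} {r : ℝ} {a b : ℤ}
    (hA : 𝒱.IsAdapted x r a b) {s : S} (hs : s ∈ 𝒱.L.nhd x) (hs' : s ∈ (chartAt E x).source)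
    (hz : chartAt E x s ∈ Metric.ball (chartAt E x x) r) {σ : 𝒱.L.Section}
    (hσ : DifferentiableAt ℝ (localRep E x σ) (chartAt E x s)) (v : E) :
    𝒱.L.frame x s hs (𝒱.nablaSubθ σ s v) =
      fderiv ℝ (localRep E x σ) (chartAt E x s) (chartDeriv E x s v) -
        𝒱.localHiggs x a b (chartAt E x s) (chartDeriv E x s v)
          (localRep E x σ (chartAt E x s)) := by
  rw [nablaSubθ, map_sub, frame_nabla hs hs' hσ, frame_θ h𝒱 hA hs hs' hz, localRep_of_mem hs hs']

theorem isSmoothForm_θ (h𝒱 : 𝒱.IsUnipotent) : 𝒱.L.IsSmoothForm 𝒱.θ := by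
  intro X σ x hX hσ
  obtain ⟨r, a, b, hA⟩ := h𝒱.exists_isAdapted' x
  rw [smoothAt_iff (𝒱.L.mem_nhd x) (mem_chart_source E x)] at hσ ⊢
  have h1 : localRep E x (fun s => 𝒱.θ s (X s) (σ s)) =ᶠ[𝓝 (chartAt E x x)]
      fun z => 𝒱.localHiggs x a b z (fieldRep x X z) (localRep E x σ z) := by
    filter_upwards [Metric.isOpen_ball.mem_nhds hA.good.mem_self] with z hz
    exact localRep_θ h𝒱 hA X σ hz
  refine (contDiffAt_congr_iff h1).2 ?_
  have h2 := (contDiffAt_localHiggs h𝒱 hA hA.good.mem_self).restrict_scalars ℝ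
  exact ((h2.of_le le_top).complexClm_apply (contDiffAt_fieldRep hX)).complexClm_apply hσ

theorem map_θ_WC_le (h𝒱 : 𝒱.IsUnipotent) (k : ℤ) (x : S) (ξ : E) :
    (𝒱.WC k x).map (𝒱.θ x ξ) ≤ 𝒱.WC (k - 1) x := by
  obtain ⟨r, a, b, hA⟩ := h𝒱.exists_isAdapted' x
  rintro _ ⟨w, hw, rfl⟩
  have hx := 𝒱.L.mem_nhd x
  rw [← mem_map_equiv_iff (𝒱.L.frame x x hx), map_frame_WC,
    frame_θ h𝒱 hA hx (mem_chart_source E x) hA.good.mem_self]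
  refine (isLocalVariation h𝒱 hA.good).fderiv_gradingOp_mem_weight hA.good.mem_self a b k
    hA.good.mem_self _ ?_
  rw [← map_frame_WC hx]
  exact Submodule.mem_map_of_mem hw

theorem delbar_eq_nabla01 (h𝒱 : 𝒱.IsUnipotent) {σ : 𝒱.L.Section} {x : S}
    (hσ : 𝒱.L.SmoothAt E σ x) : 𝒱.delbar σ x = 𝒱.L.nabla01 E σ x := by
  obtain ⟨r, a, b, hA⟩ := h𝒱.exists_isAdapted' x
  rw [smoothAt_iff (𝒱.L.mem_nhd x) (mem_chart_source E x)] at hσ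
  ext v
  exact (𝒱.L.frame x x (𝒱.L.mem_nhd x)).injective (frame_delbar h𝒱 hA _ (mem_chart_source E x)
    hA.good.mem_self (hσ.differentiableAt (by simp)) v)

theorem delbarAddDel_eq_nablaSubθ (h𝒱 : 𝒱.IsUnipotent) {σ : 𝒱.L.Section} {x : S}
    (hσ : 𝒱.L.SmoothAt E σ x) : 𝒱.delbarAddDel σ x = 𝒱.nablaSubθ σ x := by
  obtain ⟨r, a, b, hA⟩ := h𝒱.exists_isAdapted' x
  rw [smoothAt_iff (𝒱.L.mem_nhd x) (mem_chart_source E x)] at hσ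
  have hd := hσ.differentiableAt (by simp)
  have hx := 𝒱.L.mem_nhd x
  have hx' := mem_chart_source E x
  ext v
  apply (𝒱.L.frame x x hx).injective
  rw [delbarAddDel, nablaSubθ, map_add, map_sub, frame_delbar h𝒱 hA hx hx' hA.good.mem_self hd,
    frame_del h𝒱 hA hx hx' hA.good.mem_self hd, frame_θ h𝒱 hA hx hx' hA.good.mem_self,
    ← nabla10_add_nabla01, map_add]
  abel

/-! ### Flatness of `∇ - θ` and of the Higgs field -/

section Curvature

variable [CompleteSpace E] (h𝒱 : 𝒱.IsUnipotent)

include h𝒱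

/-- In the flat frame the connection is `d - dY`. Its curvature vanishes by three symmetries: of the
second derivative of `σ`, of `d²Y`, and of the products of values of `dY`. -/
theorem isFlat_nablaSubθ : 𝒱.L.IsFlat 𝒱.nablaSubθ := by
  intro X Y σ x hX hY hσ
  obtain ⟨r, a, b, hA⟩ := h𝒱.exists_isAdapted' x
  have hx := 𝒱.L.mem_nhd x
  have hx' := mem_chart_source E x
  have hz := hA.good.mem_self
  rw [smoothAt_iff hx hx'] at hσ
  have hd := hσ.differentiableAt (by simp)
  replace hX := contDiffAt_fieldRep hX
  replace hY := contDiffAt_fieldRep hY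
  have hΘ := contDiffAt_localHiggs h𝒱 hA hz
  have hev : ∀ᶠ z in 𝓝 (chartAt E x x), DifferentiableAt ℝ (localRep E x σ) z := by
    filter_upwards [(hσ.of_le (m := 1) (by norm_cast)).eventually (by simp)] with z hz
    exact hz.differentiableAt (by simp)
  have key : ∀ Y : ∀ s : S, TangentSpace 𝓘(ℝ, E) s, ContDiffAt ℝ ∞ (fieldRep x Y) (chartAt E x x) →
      ∃ T : E →L[ℝ] Fin (𝒱.L.rk x) → ℂ,
        HasFDerivAt (localRep E x fun s => 𝒱.nablaSubθ σ s (Y s)) T (chartAt E x x) ∧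
        ∀ v, T v = fderiv ℝ (fderiv ℝ (localRep E x σ)) (chartAt E x x) v
            (fieldRep x Y (chartAt E x x)) +
          fderiv ℝ (localRep E x σ) (chartAt E x x) (fderiv ℝ (fieldRep x Y) (chartAt E x x) v) -
          (fderiv ℂ (𝒱.localHiggs x a b) (chartAt E x x) v (fieldRep x Y (chartAt E x x))
              (localRep E x σ (chartAt E x x)) +
            𝒱.localHiggs x a b (chartAt E x x) (fderiv ℝ (fieldRep x Y) (chartAt E x x) v)
              (localRep E x σ (chartAt E x x)) +
            𝒱.localHiggs x a b (chartAt E x x) (fieldRep x Y (chartAt E x x))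
              (fderiv ℝ (localRep E x σ) (chartAt E x x) v)) := by
    intro Y hY
    obtain ⟨T, hT, hTv⟩ := hΘ.hasFDerivAt_form_apply hd (hY.differentiableAt (by simp))
    refine ⟨_, ((hasFDerivAt_fderiv_apply hσ hY).sub hT).congr_of_eventuallyEq ?_, fun v => ?_⟩
    · filter_upwards [hev, Metric.isOpen_ball.mem_nhds hz] with z hz1 hz2
      exact localRep_nablaSubθ h𝒱 hA Y hz2 hz1
    · rw [sub_apply, hTv, add_comm]
      rfl
  obtain ⟨TX, hTX, hTXv⟩ := key X hX
  obtain ⟨TY, hTY, hTYv⟩ := key Y hY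
  have hsymm : fderiv ℝ (fderiv ℝ (localRep E x σ)) (chartAt E x x)
        (fieldRep x X (chartAt E x x)) (fieldRep x Y (chartAt E x x)) =
      fderiv ℝ (fderiv ℝ (localRep E x σ)) (chartAt E x x)
        (fieldRep x Y (chartAt E x x)) (fieldRep x X (chartAt E x x)) :=
    (hσ.isSymmSndFDerivAt (by simp; norm_cast)) _ _
  have hsymm' := congrArg (fun T => T (localRep E x σ (chartAt E x x)))
    (fderiv_localHiggs_symm h𝒱 hA hz (fieldRep x X (chartAt E x x))
      (fieldRep x Y (chartAt E x x)))
  have hcomm := congrArg (fun T => T (localRep E x σ (chartAt E x x)))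
    (localHiggs_commute h𝒱 hA hz (fieldRep x X (chartAt E x x)) (fieldRep x Y (chartAt E x x)))
  simp only [mul_apply_eq_comp] at hcomm
  apply (𝒱.L.frame x x hx).injective
  have e₁ := frame_nablaSubθ h𝒱 hA hx hx' hz hTY.differentiableAt (X x)
  have e₂ := frame_nablaSubθ h𝒱 hA hx hx' hz hTX.differentiableAt (Y x)
  have e₃ := frame_nablaSubθ h𝒱 hA hx hx' hz hd (VectorField.mlieBracket 𝓘(ℝ, E) X Y x)
  rw [← fieldRep_chart hx' X, hTY.fderiv, hTYv, localRep_nablaSubθ h𝒱 hA Y hz hd] at e₁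
  rw [← fieldRep_chart hx' Y, hTX.fderiv, hTXv, localRep_nablaSubθ h𝒱 hA X hz hd] at e₂
  rw [chartDeriv_mlieBracket] at e₃
  rw [map_sub, map_sub, map_zero]
  refine (congrArg₂ (· - ·) (congrArg₂ (· - ·) e₁ e₂) e₃).trans ?_
  simp only [map_sub, sub_apply]
  rw [hsymm, hsymm', hcomm]
  abel

theorem isFlatForm_nabla : 𝒱.L.IsFlatForm (𝒱.L.nabla E) 𝒱.θ := by
  intro X Y σ x hX hY hσ
  obtain ⟨r, a, b, hA⟩ := h𝒱.exists_isAdapted' x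
  have hx := 𝒱.L.mem_nhd x
  have hx' := mem_chart_source E x
  have hz := hA.good.mem_self
  rw [smoothAt_iff hx hx'] at hσ
  have hd := hσ.differentiableAt (by simp)
  have hΘ := contDiffAt_localHiggs h𝒱 hA hz
  have key : ∀ Y : ∀ s : S, TangentSpace 𝓘(ℝ, E) s, SmoothFieldAt Y x →
      ∃ T : E →L[ℝ] Fin (𝒱.L.rk x) → ℂ,
        HasFDerivAt (localRep E x fun s => 𝒱.θ s (Y s) (σ s)) T (chartAt E x x) ∧
        ∀ v, T v =
          (fderiv ℂ (𝒱.localHiggs x a b) (chartAt E x x) v (fieldRep x Y (chartAt E x x))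
              (localRep E x σ (chartAt E x x)) +
            𝒱.localHiggs x a b (chartAt E x x) (fderiv ℝ (fieldRep x Y) (chartAt E x x) v)
              (localRep E x σ (chartAt E x x)) +
            𝒱.localHiggs x a b (chartAt E x x) (fieldRep x Y (chartAt E x x))
              (fderiv ℝ (localRep E x σ) (chartAt E x x) v)) := by
    intro Y hY
    obtain ⟨T, hT, hTv⟩ := hΘ.hasFDerivAt_form_apply hd
      ((contDiffAt_fieldRep hY).differentiableAt (by simp))
    refine ⟨T, hT.congr_of_eventuallyEq ?_, hTv⟩
    filter_upwards [Metric.isOpen_ball.mem_nhds hz] with z hz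
    exact localRep_θ h𝒱 hA Y σ hz
  obtain ⟨TX, hTX, hTXv⟩ := key X hX
  obtain ⟨TY, hTY, hTYv⟩ := key Y hY
  have hsymm := congrArg (fun T => T (localRep E x σ (chartAt E x x)))
    (fderiv_localHiggs_symm h𝒱 hA hz (fieldRep x X (chartAt E x x))
      (fieldRep x Y (chartAt E x x)))
  apply (𝒱.L.frame x x hx).injective
  have e₁ := frame_nabla hx hx' hTY.differentiableAt (X x)
  have e₂ := frame_θ h𝒱 hA hx hx' hz (Y x) (𝒱.L.nabla E σ x (X x))
  have e₃ := frame_nabla hx hx' hTX.differentiableAt (Y x)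
  have e₄ := frame_θ h𝒱 hA hx hx' hz (X x) (𝒱.L.nabla E σ x (Y x))
  have e₅ := frame_θ h𝒱 hA hx hx' hz (VectorField.mlieBracket 𝓘(ℝ, E) X Y x) (σ x)
  have e₆ := frame_nabla hx hx' hd (X x)
  have e₇ := frame_nabla hx hx' hd (Y x)
  rw [← fieldRep_chart hx' X] at e₆
  rw [← fieldRep_chart hx' Y] at e₇
  rw [← fieldRep_chart hx' X, hTY.fderiv, hTYv] at e₁
  rw [← fieldRep_chart hx' Y, hTX.fderiv, hTXv] at e₃
  rw [e₆, ← fieldRep_chart hx' Y] at e₂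
  rw [e₇, ← fieldRep_chart hx' X] at e₄
  rw [chartDeriv_mlieBracket, ← localRep_of_mem hx hx' σ] at e₅
  simp only [map_sub, map_zero]
  refine (congrArg₂ (· - ·) (congrArg₂ (· - ·) (congrArg₂ (· - ·) e₁ e₂)
    (congrArg₂ (· - ·) e₃ e₄)) e₅).trans ?_
  simp only [map_sub, sub_apply]
  rw [hsymm]
  abel

omit [CompleteSpace E] in
theorem θ_commute (x : S) (v w : E) (e : 𝒱.L.VC x) :
    𝒱.θ x v (𝒱.θ x w e) = 𝒱.θ x w (𝒱.θ x v e) := by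
  obtain ⟨r, a, b, hA⟩ := h𝒱.exists_isAdapted' x
  have hx := 𝒱.L.mem_nhd x
  have hx' := mem_chart_source E x
  have hz := hA.good.mem_self
  apply (𝒱.L.frame x x hx).injective
  simp only [frame_θ h𝒱 hA hx hx' hz]
  exact congrArg (fun T => T (𝒱.L.frame x x hx e)) (localHiggs_commute h𝒱 hA hz _ _)

/-- Passing from `∇` to `∇ - θ` changes the covariant derivative of `θ` only by commutators of
values of `θ`. Smoothness of `θ` is needed to replace `∂̄ + ∂` by `∇ - θ` on the sections `θ(X)σ`
and `θ(Y)σ`. -/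
theorem isFlatForm_delbarAddDel : 𝒱.L.IsFlatForm 𝒱.delbarAddDel 𝒱.θ := by
  intro X Y σ x hX hY hσ
  have h1 := isFlatForm_nabla h𝒱 X Y σ x hX hY hσ
  rw [delbarAddDel_eq_nablaSubθ h𝒱 hσ,
    delbarAddDel_eq_nablaSubθ h𝒱 (isSmoothForm_θ h𝒱 X σ x hX hσ),
    delbarAddDel_eq_nablaSubθ h𝒱 (isSmoothForm_θ h𝒱 Y σ x hY hσ)]
  simp only [nablaSubθ, map_sub]
  rw [θ_commute h𝒱 x (X x) (Y x)]
  rw [← h1]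
  abel

end Curvature

end VGPMHS

theorem RatLocalSystem.nabla_congr {E : Type*} [NormedAddCommGroup E] [NormedSpace ℂ E]
    {S : Type u} [TopologicalSpace S] [ChartedSpace E S] {L : RatLocalSystem.{u, v} S}
    {σ τ : L.Section} {x : S} (h : ∀ᶠ s in 𝓝 x, σ s = τ s) (v : E) :
    L.nabla E σ x v = L.nabla E τ x v := by
  have h1 : L.frameCoord x σ =ᶠ[𝓝 x] L.frameCoord x τ := by
    filter_upwards [h] with s hs
    simp only [frameCoord, hs]
  have h2 := h1.mfderiv_eq (I := 𝓘(ℝ, E)) (I' := 𝓘(ℝ, Fin (L.rk x) → ℂ))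
  rw [nabla, nabla, dFrameCoord, dFrameCoord]
  exact congrArg (fun T : E →L[ℝ] Fin (L.rk x) → ℂ => (L.fibCoord x).symm (T v)) h2

/-! ### The subbundles `𝓤^p` -/

namespace VGPMHS

open RatLocalSystem

variable {E : Type*} [NormedAddCommGroup E] [NormedSpace ℂ E]
  {S : Type u} [TopologicalSpace S] [ChartedSpace E S] {𝒱 : VGPMHS.{u, v} E S}

theorem mem_U_iff (p : ℤ) (s : S) (e : 𝒱.L.VC s) : e ∈ 𝒱.U p s ↔ 𝒱.proj p s e = e := by
  have h : IsCompl (𝒱.U p s) (⨆ (r : ℤ) (_ : r ≠ p), 𝒱.U r s) :=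
    (isCompl_deligneU (𝒱.isMixedHodge s) p).1
  rw [proj, gradedProj, dif_pos h]
  exact (Submodule.projection_eq_self_iff h e).symm

variable [IsManifold 𝓘(ℂ, E) ω S] (h𝒱 : 𝒱.IsUnipotent)

include h𝒱

theorem mem_U_iff_localProj {x : S} {r : ℝ} (hr : 𝒱.L.IsGoodBall E x r) {s : S}
    (hs : s ∈ 𝒱.L.nhd x) (hs' : s ∈ (chartAt E x).source)
    (hz : chartAt E x s ∈ Metric.ball (chartAt E x x) r) (p : ℤ) (e : 𝒱.L.VC s) :
    e ∈ 𝒱.U p s ↔ 𝒱.localProj x p (chartAt E x s) (𝒱.L.frame x s hs e) = 𝒱.L.frame x s hs e := by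
  rw [mem_U_iff, ← frame_proj h𝒱 hr hs hs' hz]
  exact (𝒱.L.frame x s hs).injective.eq_iff.symm

/-- Differentiating `σ = Π_p σ` and inserting `dΠ_p = [θ, Π_p]` gives `(∇ - θ)σ = Π_p (∇ - θ)σ`. -/
theorem isParallel_U (p : ℤ) : 𝒱.L.IsParallel 𝒱.nablaSubθ (𝒱.U p) := by
  intro σ x hσ hU v
  obtain ⟨r, a, b, hA⟩ := h𝒱.exists_isAdapted' x
  have hx := 𝒱.L.mem_nhd x
  have hx' := mem_chart_source E x
  have hz := hA.good.mem_self
  have h := isLocalVariation h𝒱 hA.good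
  rw [smoothAt_iff hx hx'] at hσ
  have h1 : ∀ᶠ s in 𝓝 x, σ s = 𝒱.comp p σ s := by
    filter_upwards [hU] with s hs using ((mem_U_iff p s _).1 hs).symm
  have h2 := frame_nabla_comp h𝒱 hA hx hx' hz (hσ.differentiableAt (by simp)) p v
  rw [← nabla_congr h1] at h2
  have h3 : fderiv ℂ (𝒱.localProj x p) (chartAt E x x) (chartDeriv E x x v) =
      𝒱.localHiggs x a b (chartAt E x x) (chartDeriv E x x v) *
        𝒱.localProj x p (chartAt E x x) -
      𝒱.localProj x p (chartAt E x x) *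
        𝒱.localHiggs x a b (chartAt E x x) (chartDeriv E x x v) :=
    h.fderiv_summandProj hA.good.mem_self hA.bounds hz (chartDeriv E x x v) p
  have h4 := (mem_U_iff_localProj h𝒱 hA.good hx hx' hz p _).1 hU.self_of_nhds
  rw [h3, sub_apply, mul_apply_eq_comp, mul_apply_eq_comp, h4] at h2
  rw [mem_U_iff_localProj h𝒱 hA.good hx hx' hz, nablaSubθ, map_sub, map_sub,
    frame_θ h𝒱 hA hx hx' hz]
  rw [← sub_eq_zero] at h2 ⊢
  rw [← neg_eq_zero, ← h2]
  abel

/-- The operator `T(z) = ∑_q Π_q(z) Π_q(x)` intertwines the projections at `x` with those at `z`. It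
is the identity at `x`, so it is invertible nearby, and it carries a basis of `𝓤^p` at `x` to a
frame. -/
theorem isSmoothSubbundle_U (p : ℤ) : 𝒱.L.IsSmoothSubbundle E (𝒱.U p) := by
  intro x
  obtain ⟨r, a, b, hA⟩ := h𝒱.exists_isAdapted' x
  have hx := 𝒱.L.mem_nhd x
  have hx' := mem_chart_source E x
  have hz₀ := hA.good.mem_self
  have h := isLocalVariation h𝒱 hA.good
  let T : E → (Fin (𝒱.L.rk x) → ℂ) →L[ℂ] (Fin (𝒱.L.rk x) → ℂ) := fun z =>
    ∑ q ∈ Finset.Icc a b, 𝒱.localProj x q z * 𝒱.localProj x q (chartAt E x x)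
  have hT : ∀ z ∈ Metric.ball (chartAt E x x) r, ContDiffAt ℂ ω T z := fun z hz =>
    ContDiffAt.sum fun q _ => (contDiffAt_localProj h𝒱 hA hz q).mul contDiffAt_const
  have hmul : ∀ z ∈ Metric.ball (chartAt E x x) r, ∀ q q', 𝒱.localProj x q z *
      𝒱.localProj x q' z = if q = q' then 𝒱.localProj x q z else 0 := fun z hz q q' =>
    h.summandProj_mul hz₀ hz q q'
  have hT1 : T (chartAt E x x) = 1 := by
    rw [← IsLocalVariation.sum_summandProj (c := 𝒱.localConj x) (W := 𝒱.localW x) hA.bounds hA.le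
      hz₀]
    exact Finset.sum_congr rfl fun q _ => by rw [hmul _ hz₀, if_pos rfl]; rfl
  have hTl : ∀ z ∈ Metric.ball (chartAt E x x) r, 𝒱.localProj x p z * T z =
      T z * 𝒱.localProj x p (chartAt E x x) := by
    intro z hz
    change _ * (∑ q ∈ Finset.Icc a b, _) = (∑ q ∈ Finset.Icc a b, _) * _
    rw [Finset.mul_sum, Finset.sum_mul]
    refine Finset.sum_congr rfl fun q _ => ?_
    rw [← mul_assoc, hmul z hz, mul_assoc, hmul _ hz₀]
    by_cases hpq : p = q
    · rw [if_pos hpq, if_pos hpq.symm, hpq]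
    · rw [if_neg hpq, if_neg (Ne.symm hpq), zero_mul, mul_zero]
  have hunit : ∀ᶠ z in 𝓝 (chartAt E x x), IsUnit (T z) := by
    have h1 : ContinuousAt T (chartAt E x x) := (hT _ hz₀).continuousAt
    refine h1.eventually (Units.isOpen.mem_nhds ?_)
    rw [hT1]
    exact isUnit_one
  let B := Module.finBasis ℂ (𝒱.U p x)
  refine ⟨_, fun i => sectionOf x fun z => T z (𝒱.L.frame x x hx (B i)), ?_⟩
  filter_upwards [hA.good.eventually_ball hx' hz₀,
    ((chartAt E x).continuousAt hx').eventually hunit] with s hs hu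
  obtain ⟨hs', hz, hs⟩ := hs
  set z := chartAt E x s with hzdef
  obtain ⟨u, hu⟩ := hu
  have hleft : ∀ w, (u⁻¹).1 (T z w) = w := fun w => by
    rw [← hu, ← mul_apply_eq_comp, Units.inv_mul]
    rfl
  have hright : ∀ w, T z ((u⁻¹).1 w) = w := fun w => by
    rw [← hu, ← mul_apply_eq_comp, Units.mul_inv]
    rfl
  have hTinj : Function.Injective (T z) := Function.LeftInverse.injective hleft
  let g : 𝒱.L.VC x →ₗ[ℂ] 𝒱.L.VC s := (𝒱.L.frame x s hs).symm.toLinearMap ∘ₗ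
    (T z).toLinearMap ∘ₗ (𝒱.L.frame x x hx).toLinearMap
  have hg : ∀ e, 𝒱.L.frame x s hs (g e) = T z (𝒱.L.frame x x hx e) := fun e =>
    (𝒱.L.frame x s hs).apply_symm_apply _
  have hginj : Function.Injective g := fun e e' hee => by
    have := congrArg (𝒱.L.frame x s hs) hee
    rw [hg, hg] at this
    exact (𝒱.L.frame x x hx).injective (hTinj this)
  have hf : ∀ e, sectionOf (L := 𝒱.L) x (fun z => T z (𝒱.L.frame x x hx e)) s = g e := fun e => by
    apply (𝒱.L.frame x s hs).injective
    rw [frame_sectionOf, hg]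
  have hmem : ∀ e, g e ∈ 𝒱.U p s ↔ e ∈ 𝒱.U p x := by
    intro e
    rw [mem_U_iff_localProj h𝒱 hA.good hs hs' hz, mem_U_iff_localProj h𝒱 hA.good hx hx' hz₀, hg,
      ← mul_apply_eq_comp, hTl z hz]
    exact hTinj.eq_iff
  refine ⟨fun i => ?_, ?_, ?_⟩
  · rw [smoothAt_iff hs hs']
    have h1 : localRep E x (sectionOf (L := 𝒱.L) x fun z => T z (𝒱.L.frame x x hx (B i))) =ᶠ[𝓝 z]
        fun z => T z (𝒱.L.frame x x hx (B i)) := by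
      filter_upwards [Metric.isOpen_ball.mem_nhds hz] with y hy
      exact localRep_sectionOf hA.good _ hy
    refine (contDiffAt_congr_iff h1).2 ?_
    exact (((hT z hz).clm_apply contDiffAt_const).restrict_scalars ℝ).of_le le_top
  · simp only [hf]
    exact (B.linearIndependent.map' (𝒱.U p x).subtype (Submodule.ker_subtype _)).map' g
      (LinearMap.ker_eq_bot.2 hginj)
  · simp only [hf]
    have h1 : Set.range (fun i => g (B i)) = g '' ((𝒱.U p x).subtype '' Set.range B) := by
      rw [← Set.range_comp, ← Set.range_comp]
      rfl
    rw [h1, ← Submodule.map_span, ← Submodule.map_span, B.span_eq, Submodule.map_top,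
      Submodule.range_subtype]
    refine le_antisymm ?_ fun e he => ?_
    · rintro _ ⟨e, he, rfl⟩
      exact (hmem e).2 he
    · obtain ⟨e', rfl⟩ : ∃ e', g e' = e := by
        refine ⟨(𝒱.L.frame x x hx).symm ((u⁻¹).1 (𝒱.L.frame x s hs e)),
          (𝒱.L.frame x s hs).injective ?_⟩
        rw [hg, LinearEquiv.apply_symm_apply, hright]
      exact Submodule.mem_map_of_mem ((hmem e').1 he)

end VGPMHS

/-! ### Recovery of the variation from `∇`, `θ` and one fibre -/

namespace IsLocalVariation

variable {E N N' : Type*} [NormedAddCommGroup E] [NormedSpace ℂ E]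
  [NormedAddCommGroup N] [NormedSpace ℂ N] [FiniteDimensional ℂ N]
  [NormedAddCommGroup N'] [NormedSpace ℂ N'] [FiniteDimensional ℂ N']
  {Ω : Set E} {c : N →ₛₗ[starRingEnd ℂ] N} {W : ℤ → Submodule ℂ N}
  {K : ℤ → E → Submodule ℂ N} {c' : N' →ₛₗ[starRingEnd ℂ] N'} {W' : ℤ → Submodule ℂ N'}
  {K' : ℤ → E → Submodule ℂ N'} {z₀ : E} {a b : ℤ}

/-- A flat isomorphism which is compatible with the Higgs fields of two local variations, and is an
isomorphism of mixed Hodge structures at one point, respects the Hodge filtrations. -/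
theorem map_hodge_eq_of_commute (h : IsLocalVariation Ω c W K) (h' : IsLocalVariation Ω c' W' K')
    (hz₀ : z₀ ∈ Ω) (hab : a ≤ b)
    (hb : ∀ z ∈ Ω, (∀ p ≤ a, hodgeProj c W K z₀ p z = 1) ∧
      (∀ p > b, hodgeProj c W K z₀ p z = 0))
    (hb' : ∀ z ∈ Ω, (∀ p ≤ a, hodgeProj c' W' K' z₀ p z = 1) ∧
      (∀ p > b, hodgeProj c' W' K' z₀ p z = 0))
    (C : N ≃ₗ[ℂ] N')
    (hC : ∀ z ∈ Ω, ∀ v w, fderiv ℂ (gradingOp c' W' K' z₀ a b) z v (C w) =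
      C (fderiv ℂ (gradingOp c W K z₀ a b) z v w))
    (hconj : ∀ w, c' (C w) = C (c w)) (hW : ∀ k, (W k).map C.toLinearMap = W' k)
    {z₁ : E} (hz₁ : z₁ ∈ Ω) (hK : ∀ p, (K p z₁).map C.toLinearMap = K' p z₁)
    {z : E} (hz : z ∈ Ω) (p : ℤ) : (K p z).map C.toLinearMap = K' p z := by
  -- At `z₁` the map respects `F`, `W` and the conjugation, hence also `G`; flatness of `G` moves it
  -- to the base point `z₀` of the projections.
  have h₁ : ∀ p w, hodgeProj c' W' K' z₀ p z₁ (C w) = C (hodgeProj c W K z₀ p z₁ w) := by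
    intro p w
    obtain ⟨h2, h3⟩ := h.hodgeProj_spec hz₀ hz₁ p w
    refine h'.hodgeProj_eq hz₀ hz₁ p ?_ ?_
    · rw [← hK]
      exact Submodule.mem_map_of_mem h2
    · have h4 := oppFil_map C hconj W (fun r => K r z₁) (p - 1)
      simp only [hW, hK] at h4
      rw [h.oppFil_eq hz₀ hz₁] at h3
      rw [h'.oppFil_eq hz₀ hz₁, h4, ← map_sub]
      exact Submodule.mem_map_of_mem h3
  let D : N →L[ℂ] N' := LinearMap.toContinuousLinearMap C.toLinearMap
  let D' : N' →L[ℂ] N := LinearMap.toContinuousLinearMap C.symm.toLinearMap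
  apply le_antisymm
  · rintro _ ⟨w, hw, rfl⟩
    exact h.map_mem_hodge_of_commute hz₀ hb h' hz₀ hab hb' D hC hz₁ h₁ hz p hw
  · intro w hw
    refine ⟨C.symm w, ?_, C.apply_symm_apply w⟩
    refine h'.map_mem_hodge_of_commute hz₀ hb' h hz₀ hab hb D' (fun z hz v w => ?_) hz₁
      (fun p w => ?_) hz p hw
    · change _ = C.symm _
      rw [LinearEquiv.eq_symm_apply]
      have := hC z hz v (C.symm w)
      rw [LinearEquiv.apply_symm_apply] at this
      exact this.symm
    · change _ = C.symm _
      rw [LinearEquiv.eq_symm_apply]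
      have := h₁ p (C.symm w)
      rw [LinearEquiv.apply_symm_apply] at this
      exact this.symm

end IsLocalVariation

namespace RatLocalSystem

section

variable {S : Type u} [TopologicalSpace S] (L : RatLocalSystem.{u, v} S)

/-- Parallel transport, in the flat trivialization at `x`. -/
def transition {x s s' : S} (hs : s ∈ L.nhd x) (hs' : s' ∈ L.nhd x) : L.Fib s ≃ₗ[ℚ] L.Fib s' :=
  (L.transport x s hs).symm.trans (L.transport x s' hs')

variable {L}

theorem frame_transition {x s s' : S} (hs : s ∈ L.nhd x) (hs' : s' ∈ L.nhd x) (w : L.VC s) :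
    L.frame x s' hs' ((L.transition hs hs').toLinearMap.baseChange ℂ w) = L.frame x s hs w := by
  obtain ⟨w, rfl⟩ := (L.transportC x s hs).surjective w
  have h1 : (L.transition hs hs').toLinearMap.baseChange ℂ (L.transportC x s hs w) =
      L.transportC x s' hs' w := by
    rw [transportC_apply, transportC_apply, ← LinearMap.comp_apply, ← LinearMap.baseChange_comp]
    congr 2
    ext a
    simp [transition]
  rw [h1]
  simp [frame]

theorem _root_.WeightFiltration.map_transition (w : WeightFiltration L) {x s s' : S}
    (hs : s ∈ L.nhd x) (hs' : s' ∈ L.nhd x) (k : ℤ) :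
    (w.W k s).map (L.transition hs hs').toLinearMap = w.W k s' := by
  rw [← w.flat k x s hs, ← w.flat k x s' hs', ← Submodule.map_comp]
  congr 1
  ext a
  simp [transition]

end

variable {E : Type*} [NormedAddCommGroup E] [NormedSpace ℂ E]
  {S : Type u} [TopologicalSpace S] [ChartedSpace E S]

theorem _root_.VGPMHS.pol_transition (𝒱 : VGPMHS.{u, v} E S) {x s s' : S}
    (hs : s ∈ 𝒱.L.nhd x) (hs' : s' ∈ 𝒱.L.nhd x) (k : ℤ) (a b : 𝒱.wt.W k s) (a' b' : 𝒱.wt.W k s')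
    (ha : 𝒱.L.transition hs hs' a = a') (hb : 𝒱.L.transition hs hs' b = b') :
    𝒱.pol k s' (𝒱.wt.grMk k s' a') (𝒱.wt.grMk k s' b') =
      𝒱.pol k s (𝒱.wt.grMk k s a) (𝒱.wt.grMk k s b) := by
  have key : ∀ y (hy : y ∈ 𝒱.L.nhd x) (a₀ b₀ : 𝒱.wt.W k x) (a b : 𝒱.wt.W k y),
      𝒱.L.transport x y hy a₀ = a → 𝒱.L.transport x y hy b₀ = b →
      𝒱.pol k y (𝒱.wt.grMk k y a) (𝒱.wt.grMk k y b) =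
        𝒱.pol k x (𝒱.wt.grMk k x a₀) (𝒱.wt.grMk k x b₀) := by
    intro y hy a₀ b₀ a b ha hb
    have h1 := (𝒱.graded k).form_flat x y hy (𝒱.wt.grMk k x a₀) (𝒱.wt.grMk k x b₀)
    have h2 : ∀ (a₀ : 𝒱.wt.W k x) (a : 𝒱.wt.W k y), 𝒱.L.transport x y hy a₀ = a →
        (𝒱.wt.gr k).transport x y hy (𝒱.wt.grMk k x a₀) = 𝒱.wt.grMk k y a := fun a₀ a ha =>
      congrArg Submodule.Quotient.mk (Subtype.ext ha)
    rw [h2 a₀ a ha, h2 b₀ b hb] at h1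
    exact h1
  have hpre : ∀ a : 𝒱.wt.W k s, ∃ a₀ : 𝒱.wt.W k x, 𝒱.L.transport x s hs a₀ = a := by
    rintro ⟨a, ha⟩
    rw [← 𝒱.wt.flat k x s hs] at ha
    obtain ⟨a₀, ha₀, rfl⟩ := ha
    exact ⟨⟨a₀, ha₀⟩, rfl⟩
  obtain ⟨a₀, ha₀⟩ := hpre a
  obtain ⟨b₀, hb₀⟩ := hpre b
  rw [key s hs a₀ b₀ a b ha₀ hb₀]
  refine key s' hs' a₀ b₀ a' b' ?_ ?_
  · rw [← ha, ← ha₀]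
    simp [transition]
  · rw [← hb, ← hb₀]
    simp [transition]

end RatLocalSystem

section Recovery

open RatLocalSystem VGPMHS

variable {E : Type*} [NormedAddCommGroup E] [NormedSpace ℂ E]
  {S : Type u} [TopologicalSpace S] [ChartedSpace E S]
  {𝒱 : VGPMHS.{u, v} E S} {𝒱' : VGPMHS.{u, v'} E S}

/-- A bundle isomorphism at `x`, in flat coordinates. -/
def localIso (Φ : ∀ s, 𝒱.L.VC s ≃ₗ[ℂ] 𝒱'.L.VC s) (x : S) :
    (Fin (𝒱.L.rk x) → ℂ) ≃ₗ[ℂ] (Fin (𝒱'.L.rk x) → ℂ) :=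
  ((𝒱.L.frame x x (𝒱.L.mem_nhd x)).symm.trans (Φ x)).trans (𝒱'.L.frame x x (𝒱'.L.mem_nhd x))

variable [IsManifold 𝓘(ℂ, E) ω S]

/-- `Φ` sends the flat section through `e` to a smooth section with zero covariant derivative, whose
flat components are therefore constant on the ball. -/
theorem IsFlatBundleIso.frame_apply {Φ : ∀ s, 𝒱.L.VC s ≃ₗ[ℂ] 𝒱'.L.VC s}
    (hΦ : IsFlatBundleIso 𝒱 𝒱' Φ) {x : S} {r : ℝ} (hr : 𝒱.L.IsGoodBall E x r)
    (hr' : 𝒱'.L.IsGoodBall E x r) {s : S} (hs : s ∈ 𝒱.L.nhd x) (hs' : s ∈ 𝒱'.L.nhd x)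
    (hsx : s ∈ (chartAt E x).source) (hz : chartAt E x s ∈ Metric.ball (chartAt E x x) r)
    (e : 𝒱.L.VC s) :
    𝒱'.L.frame x s hs' (Φ s e) = localIso Φ x (𝒱.L.frame x s hs e) := by
  set w := 𝒱.L.frame x s hs e with hw
  let σ : 𝒱.L.Section := sectionOf (E := E) x fun _ => w
  have hσ : ∀ y ∈ Metric.ball (chartAt E x x) r, localRep E x σ =ᶠ[𝓝 y] fun _ => w := by
    intro y hy
    filter_upwards [Metric.isOpen_ball.mem_nhds hy] with y' hy'
    exact localRep_sectionOf hr _ hy'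
  have hd : ∀ y ∈ Metric.ball (chartAt E x x) r,
      HasFDerivAt (localRep E x fun s => Φ s (σ s)) (0 : E →L[ℝ] _) y := by
    intro y hy
    obtain ⟨s, rfl, hs, hs', hsx⟩ : ∃ s, chartAt E x s = y ∧ s ∈ 𝒱.L.nhd x ∧ s ∈ 𝒱'.L.nhd x ∧
        s ∈ (chartAt E x).source :=
      ⟨_, hr.chart_symm hy, hr.mem_nhd hy, hr'.mem_nhd hy, hr.mem_source hy⟩
    have h1 : 𝒱.L.SmoothAt E σ s := by
      rw [smoothAt_iff hs hsx, contDiffAt_congr_iff (hσ _ hy)]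
      exact contDiffAt_const
    obtain ⟨h2, h3⟩ := hΦ σ s h1
    rw [smoothAt_iff hs' hsx] at h2
    have h4 := h2.differentiableAt (by simp)
    have h5 : fderiv ℝ (localRep E x fun s => Φ s (σ s)) (chartAt E x s) = 0 := by
      ext1 u
      obtain ⟨v, rfl⟩ := chartDeriv_surjective (E := E) hsx u
      have h6 : 𝒱.L.nabla E σ s v = 0 := by
        apply (𝒱.L.frame x s hs).injective
        rw [frame_nabla hs hsx ((hσ _ hy).differentiableAt_iff.2 (differentiableAt_const _)),
          (hσ _ hy).fderiv_eq]
        simp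
      rw [← frame_nabla hs' hsx h4, h3, h6]
      simp
    rw [← h5]
    exact h4.hasFDerivAt
  have hconst := Metric.isOpen_ball.is_const_of_fderiv_eq_zero (𝕜 := ℝ)
    (convex_ball (chartAt E x x) r).isPreconnected
    (fun y hy => (hd y hy).differentiableAt.differentiableWithinAt) (fun y hy => (hd y hy).fderiv)
    hz hr.mem_self
  rw [localRep_of_mem hs' hsx, localRep_of_mem (𝒱'.L.mem_nhd x) (mem_chart_source E x)] at hconst
  have h7 : σ s = e := by
    apply (𝒱.L.frame x s hs).injective
    rw [frame_sectionOf]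
  have h8 : σ x = (𝒱.L.frame x x (𝒱.L.mem_nhd x)).symm w := by
    rw [LinearEquiv.eq_symm_apply, frame_sectionOf]
  rw [h7, h8] at hconst
  exact hconst

/-- Neither `s₁` nor `s` has to be the centre of the ball, so the property passes both from the
centre and to it. -/
theorem IsFlatBundleIso.isFiberIso_of_isFiberIso (h𝒱 : 𝒱.IsUnipotent) (h𝒱' : 𝒱'.IsUnipotent)
    {Φ : ∀ s, 𝒱.L.VC s ≃ₗ[ℂ] 𝒱'.L.VC s} (hΦ : IsFlatBundleIso 𝒱 𝒱' Φ) (hθ : IsHiggsIso 𝒱 𝒱' Φ)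
    {x : S} {r : ℝ} {a b : ℤ} (hA : 𝒱.IsAdapted x r a b) (hA' : 𝒱'.IsAdapted x r a b)
    {s₁ s : S} (hs₁ : s₁ ∈ (chartAt E x).source)
    (hz₁ : chartAt E x s₁ ∈ Metric.ball (chartAt E x x) r)
    (hs : s ∈ (chartAt E x).source) (hz : chartAt E x s ∈ Metric.ball (chartAt E x x) r)
    (h₁ : IsFiberIso 𝒱 𝒱' s₁ (Φ s₁)) : IsFiberIso 𝒱 𝒱' s (Φ s) := by
  have hm₁ := (hA.good.eventually_ball hs₁ hz₁).self_of_nhds.2.2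
  have hm₁' := (hA'.good.eventually_ball hs₁ hz₁).self_of_nhds.2.2
  have hm := (hA.good.eventually_ball hs hz).self_of_nhds.2.2
  have hm' := (hA'.good.eventually_ball hs hz).self_of_nhds.2.2
  obtain ⟨φ, hφ, hφW, hφF, hφQ⟩ := h₁
  set C := localIso Φ x with hCdef
  have hC₁ := hΦ.frame_apply hA.good hA'.good hm₁ hm₁' hs₁ hz₁
  have hC := hΦ.frame_apply hA.good hA'.good hm hm' hs hz
  have hφ' : ∀ e, Φ s₁ e = φ.toLinearMap.baseChange ℂ e := fun e =>
    congrArg (fun T => T e) hφ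
  have hmap : ∀ {s : S} (hm : s ∈ 𝒱.L.nhd x) (hm' : s ∈ 𝒱'.L.nhd x) (_ : ∀ e,
      𝒱'.L.frame x s hm' (Φ s e) = C (𝒱.L.frame x s hm e)) (A : Submodule ℂ (𝒱.L.VC s)),
      (A.map (𝒱.L.frame x s hm).toLinearMap).map C.toLinearMap =
        (A.map (Φ s).toLinearMap).map (𝒱'.L.frame x s hm').toLinearMap := by
    intro s hm hm' hC A
    rw [← Submodule.map_comp, ← Submodule.map_comp]
    congr 1
    exact LinearMap.ext fun e => (hC e).symm
  have hK : ∀ z ∈ Metric.ball (chartAt E x x) r, ∀ p,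
      (𝒱.localK x p z).map C.toLinearMap = 𝒱'.localK x p z := by
    intro z hz p
    refine (isLocalVariation h𝒱 hA.good).map_hodge_eq_of_commute
      (isLocalVariation h𝒱' hA'.good) hA.good.mem_self hA.le hA.bounds hA'.bounds C ?_ ?_ ?_ hz₁
      (fun p => ?_) hz p
    · intro z hz v w
      obtain ⟨s, rfl, hs, hs', hsx⟩ : ∃ s, chartAt E x s = z ∧ s ∈ 𝒱.L.nhd x ∧ s ∈ 𝒱'.L.nhd x ∧
          s ∈ (chartAt E x).source :=
        ⟨_, hA.good.chart_symm hz, hA.good.mem_nhd hz, hA'.good.mem_nhd hz, hA.good.mem_source hz⟩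
      obtain ⟨u, rfl⟩ := chartDeriv_surjective (E := E) hsx v
      obtain ⟨e, rfl⟩ := (𝒱.L.frame x s hs).surjective w
      have e₁ := frame_θ h𝒱 hA hs hsx hz u e
      have e₂ := frame_θ h𝒱' hA' hs' hsx hz u (Φ s e)
      have e₃ := hΦ.frame_apply hA.good hA'.good hs hs' hsx hz
      rw [hθ, e₃, e₁, e₃] at e₂
      exact e₂.symm
    · intro w
      obtain ⟨e, rfl⟩ := (𝒱.L.frame x s₁ hm₁).surjective w
      rw [← hC₁, localConj_frame, localConj_frame, ← hC₁, hφ', hφ', conjC_baseChange]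
    · intro k
      rw [← map_frame_WC hm₁, ← map_frame_WC hm₁', hmap hm₁ hm₁' hC₁, hφ, WC, WC,
        ← Submodule.baseChange_map_eq, hφW]
    · rw [localK_of_mem hm₁ hs₁, localK_of_mem hm₁' hs₁, hmap hm₁ hm₁' hC₁, hφF]
  -- The rational structure of `Φ s` is found by parallel transport to `s₁`, then `φ`, then parallel
  -- transport back; this agrees with `Φ s` because `Φ` is constant in flat frames.
  let ψ : 𝒱.L.Fib s ≃ₗ[ℚ] 𝒱'.L.Fib s :=
    ((𝒱.L.transition hm hm₁).trans φ).trans (𝒱'.L.transition hm₁' hm')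
  refine ⟨ψ, ?_, ?_, ?_, ?_⟩
  · refine LinearMap.ext fun e => (𝒱'.L.frame x s hm').injective ?_
    have h1 : ψ.toLinearMap.baseChange ℂ e = (𝒱'.L.transition hm₁' hm').toLinearMap.baseChange ℂ
        (φ.toLinearMap.baseChange ℂ ((𝒱.L.transition hm hm₁).toLinearMap.baseChange ℂ e)) := by
      rw [← LinearMap.comp_apply, ← LinearMap.comp_apply, ← LinearMap.baseChange_comp,
        ← LinearMap.baseChange_comp]
      rfl
    rw [h1, frame_transition, ← hφ', hC₁, frame_transition]
    exact hC e
  · intro k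
    have h1 : ψ.toLinearMap = (𝒱'.L.transition hm₁' hm').toLinearMap ∘ₗ φ.toLinearMap ∘ₗ
      (𝒱.L.transition hm hm₁).toLinearMap := rfl
    rw [h1, Submodule.map_comp, Submodule.map_comp, 𝒱.wt.map_transition, hφW,
      𝒱'.wt.map_transition]
  · intro p
    have h1 := hK _ hz p
    rw [localK_of_mem hm hs, localK_of_mem hm' hs, hmap hm hm' hC] at h1
    exact Submodule.map_injective_of_injective (𝒱'.L.frame x s hm').injective h1
  · intro k a b a' b' ha hb
    have hmem : ∀ a : 𝒱.wt.W k s, 𝒱.L.transition hm hm₁ a ∈ 𝒱.wt.W k s₁ := fun a => by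
      rw [← 𝒱.wt.map_transition hm hm₁]
      exact Submodule.mem_map_of_mem a.2
    have hmem' : ∀ a : 𝒱.wt.W k s, φ (𝒱.L.transition hm hm₁ a) ∈ 𝒱'.wt.W k s₁ := fun a => by
      rw [← hφW]
      exact Submodule.mem_map_of_mem (hmem a)
    rw [𝒱'.pol_transition hm₁' hm' k ⟨_, hmem' a⟩ ⟨_, hmem' b⟩ a' b' ha hb,
      hφQ k ⟨_, hmem a⟩ ⟨_, hmem b⟩ _ _ rfl rfl]
    exact 𝒱.pol_transition hm hm₁ k a b _ _ rfl rfl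

theorem isFiberIso_of_preconnectedSpace [PreconnectedSpace S] (h𝒱 : 𝒱.IsUnipotent)
    (h𝒱' : 𝒱'.IsUnipotent) {Φ : ∀ s, 𝒱.L.VC s ≃ₗ[ℂ] 𝒱'.L.VC s} (hΦ : IsFlatBundleIso 𝒱 𝒱' Φ)
    (hθ : IsHiggsIso 𝒱 𝒱' Φ) {s₀ : S} (h₀ : IsFiberIso 𝒱 𝒱' s₀ (Φ s₀)) (s : S) :
    IsFiberIso 𝒱 𝒱' s (Φ s) := by
  have hloc : IsLocallyConstant fun s => IsFiberIso 𝒱 𝒱' s (Φ s) := by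
    rw [IsLocallyConstant.iff_eventually_eq]
    intro x
    obtain ⟨r₁, hr₁, h1⟩ := exists_isGoodBall E 𝒱.L x
    obtain ⟨r₂, hr₂, h2⟩ := exists_isGoodBall E 𝒱'.L x
    have hr : 0 < min r₁ r₂ := lt_min hr₁ hr₂
    obtain ⟨a₁, b₁, h3⟩ := h𝒱.exists_isAdapted (h1 _ hr (min_le_left _ _))
    obtain ⟨a₂, b₂, h4⟩ := h𝒱'.exists_isAdapted (h2 _ hr (min_le_right _ _))
    -- Both variations need the same `a, b`: otherwise their operators `Y` would differ by an
    -- additive constant on matching summands.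
    have hA := h3 (min a₁ a₂) (min_le_left _ _) (max b₁ b₂) (le_max_left _ _)
    have hA' := h4 (min a₁ a₂) (min_le_right _ _) (max b₁ b₂) (le_max_right _ _)
    have hx := mem_chart_source E x
    have hz₀ := hA.good.mem_self
    filter_upwards [hA.good.eventually_ball hx hz₀] with s hs
    obtain ⟨hs', hz, -⟩ := hs
    exact propext ⟨hΦ.isFiberIso_of_isFiberIso h𝒱 h𝒱' hθ hA hA' hs' hz hx hz₀,
      hΦ.isFiberIso_of_isFiberIso h𝒱 h𝒱' hθ hA hA' hx hz₀ hs' hz⟩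
  exact (hloc.apply_eq_of_preconnectedSpace s₀ s).mp h₀

end Recovery

end

theorem theorem5p30
    {E : Type*} [NormedAddCommGroup E] [NormedSpace ℂ E] [FiniteDimensional ℂ E]
    {S : Type u} [TopologicalSpace S] [ChartedSpace E S] [IsManifold 𝓘(ℂ, E) ω S]
    (𝒱 : VGPMHS.{u, v} E S) (h𝒱 : 𝒱.IsUnipotent) :
    -- the Higgs field is a smooth form, and lowers the weight filtration
    (𝒱.L.IsSmoothForm 𝒱.θ ∧
      ∀ (k : ℤ) (x : S) (ξ : E), (𝒱.WC k x).map (𝒱.θ x ξ) ≤ 𝒱.WC (k - 1) x) ∧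
    -- the complex structures coincide
    (∀ (σ : 𝒱.L.Section) (x : S), 𝒱.L.SmoothAt E σ x → 𝒱.delbar σ x = 𝒱.L.nabla01 E σ x) ∧
    -- `∂̄ + ∂ = ∇ - θ` is a flat connection
    (∀ (σ : 𝒱.L.Section) (x : S), 𝒱.L.SmoothAt E σ x →
      𝒱.delbarAddDel σ x = 𝒱.nablaSubθ σ x) ∧
    𝒱.L.IsFlat 𝒱.nablaSubθ ∧
    -- the Higgs field is flat relative both to `∇` and to `∂̄ + ∂`
    𝒱.L.IsFlatForm (𝒱.L.nabla E) 𝒱.θ ∧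
    𝒱.L.IsFlatForm 𝒱.delbarAddDel 𝒱.θ ∧
    -- the summands `𝓤^p` are smooth subbundles, parallel for `∇ - θ`
    (∀ p, 𝒱.L.IsSmoothSubbundle E (𝒱.U p) ∧ 𝒱.L.IsParallel 𝒱.nablaSubθ (𝒱.U p)) ∧
    -- the variation is recovered from `∇`, `θ` and a single fibre
    (PreconnectedSpace S →
      ∀ (𝒱' : VGPMHS.{u, v'} E S), 𝒱'.IsUnipotent →
        ∀ Φ : (∀ s, 𝒱.L.VC s ≃ₗ[ℂ] 𝒱'.L.VC s),
          IsFlatBundleIso 𝒱 𝒱' Φ → IsHiggsIso 𝒱 𝒱' Φ →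
          ∀ s₀ : S, IsFiberIso 𝒱 𝒱' s₀ (Φ s₀) → ∀ s : S, IsFiberIso 𝒱 𝒱' s (Φ s)) := by
  -- Completeness is used in the computation of Lie brackets in a chart.
  have : CompleteSpace E := FiniteDimensional.complete ℂ E
  refine ⟨⟨VGPMHS.isSmoothForm_θ h𝒱, VGPMHS.map_θ_WC_le h𝒱⟩,
    fun _ _ => VGPMHS.delbar_eq_nabla01 h𝒱, fun _ _ => VGPMHS.delbarAddDel_eq_nablaSubθ h𝒱,
    VGPMHS.isFlat_nablaSubθ h𝒱, VGPMHS.isFlatForm_nabla h𝒱, VGPMHS.isFlatForm_delbarAddDel h𝒱,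
    fun p => ⟨VGPMHS.isSmoothSubbundle_U h𝒱 p, VGPMHS.isParallel_U h𝒱 p⟩, ?_⟩
  intro _ 𝒱' h𝒱' Φ hΦ hθ s₀ h₀ s
  exact isFiberIso_of_preconnectedSpace h𝒱 h𝒱' hΦ hθ h₀ s
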